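/- Let $n\ge 2$, $0<R\le\infty$, and let $f:[0,R)\to[0,\infty)$ be of class $C^3$ with $f(0)=0$, $f'(0)=1$, $f''(0)=0$ and $f>0$ on $(0,R)$. Let $M$ be the spherically symmetric $n$-manifold with metric $dr^2+f(r)^2d\theta^2$ (in geodesic polar coordinates around its pole, $d\theta^2$ being the round metric of the unit sphere $\mathbb S^{n-1}$). For $0<r<R$ let $\lambda(r)$ be the first Dirichlet eigenvalue of the Laplace--Beltrami operator on the geodesic ball $B(r)$ of radius $r$ centred at the pole, that is, the infimum of the Rayleigh quotients $\int_{B(r)}|\nabla u|^2\,dV\big/\int_{B(r)}u^2\,dV$ over the nonzero $u\in C_c^\infty(B(r))$. For each $r\in(0,R)$ let $\psi_r\not\equiv 0$ be a corresponding radial eigenfunction, i.e. a solution of $$-\bigl[f^{n-1}\psi_r'\bigr]'=\lambda(r)\,f^{n-1}\psi_r\ \text{ on }(0,r),\qquad \psi_r'(0)=\psi_r(r)=0 .$$ Put $g=f'/f$, $h=g'+\frac{n-1}{2}g^2$, $H(t)=t\,h'(t)+2h(t)$ for $0<t<R$, and $$Q(t)=\frac{\int_0^tH(s)f^{n-1}(s)\psi_t^2(s)\,ds}{\int_0^tf^{n-1}(s)\psi_t^2(s)\,ds}\qquad(0<t<R).$$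 Then the integrals defining $Q$ converge, $\lambda$ is differentiable on $(0,R)$, and $$r\lambda'(r)+2\lambda(r)=\frac{n-1}{2}\,Q(r)\qquad(0<r<R).$$ Moreover, for every $r_0\in[0,R)$ and $r\in(0,R)$ the function $t\mapsto tQ(t)$ is integrable between $r_0$ and $r$, the limit of $s^2\lambda(s)$ as $s\to r_0$, $s\in(0,R)$, exists, and $$\lambda(r)=\frac1{r^2}\lim_{s\to r_0}\bigl[s^2\lambda(s)\bigr]+\frac{n-1}{2r^2}\int_{r_0}^r t\,Q(t)\,dt .$$ In particular, for $r_0=0$, $$\lambda(r)=\frac{j_{\frac n2-1,1}^2}{r^2}+\frac{n-1}{2r^2}\int_0^r t\,Q(t)\,dt\qquad(0<r<R),$$ where $j_{\frac n2-1,1}$ is the first positive zero of the Bessel function $J_{\frac n2-1}$. -/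

import Mathlib

open Set Filter Topology MeasureTheory
open scoped ContDiff

noncomputable section

/-- The metric `dr² + f(r)² dθ²` in geodesic polar coordinates `x = r θ` around the pole, where
`r = ‖x‖` and `θ` is in the unit sphere of `ℝⁿ`, as a bilinear form on tangent vectors at `x`:
the radial parts of `v`, `w` are measured by the Euclidean metric, and the parts tangent to the
sphere are scaled by `f(r) / r`. At the pole `x = 0` it is the Euclidean metric. -/
def polarMetric {n : ℕ} (f : ℝ → ℝ) (x v w : EuclideanSpace ℝ (Fin n)) : ℝ :=
  if x = 0 then inner ℝ v w
  else
    inner ℝ x v * inner ℝ x w / ‖x‖ ^ 2 +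
      (f ‖x‖ / ‖x‖) ^ 2 * (inner ℝ v w - inner ℝ x v * inner ℝ x w / ‖x‖ ^ 2)

/-- The Riemannian gradient of `u` at `x` for `polarMetric f`, see `polarMetric_polarGrad`. -/
def polarGrad {n : ℕ} (f : ℝ → ℝ) (u : EuclideanSpace ℝ (Fin n) → ℝ)
    (x : EuclideanSpace ℝ (Fin n)) : EuclideanSpace ℝ (Fin n) :=
  if x = 0 then gradient u x
  else
    (inner ℝ x (gradient u x) / ‖x‖ ^ 2) • x +
      (‖x‖ / f ‖x‖) ^ 2 • (gradient u x - (inner ℝ x (gradient u x) / ‖x‖ ^ 2) • x)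

/-- The defining property of the Riemannian gradient: it represents the differential. -/
theorem polarMetric_polarGrad {n : ℕ} (f : ℝ → ℝ) (u : EuclideanSpace ℝ (Fin n) → ℝ)
    (x v : EuclideanSpace ℝ (Fin n)) (hx : x ≠ 0 → f ‖x‖ ≠ 0) :
    polarMetric f x (polarGrad f u x) v = fderiv ℝ u x v := by
  have key : inner ℝ (gradient u x) v = fderiv ℝ u x v := by
    simp [gradient]
  by_cases h : x = 0
  · simp only [polarMetric, polarGrad, h, if_true] at key ⊢
    exact key
  · have hf := hx h
    have hn : ‖x‖ ≠ 0 := norm_ne_zero_iff.mpr h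
    rw [← key]
    simp only [polarMetric, polarGrad, h, if_false, inner_add_right, inner_add_left,
      inner_smul_left, inner_smul_right, inner_sub_left, inner_sub_right,
      real_inner_self_eq_norm_sq, conj_trivial]
    field_simp
    ring

/-- The density of the Riemannian volume of `polarMetric f` with respect to Lebesgue measure. -/
def polarDensity {n : ℕ} (f : ℝ → ℝ) (x : EuclideanSpace ℝ (Fin n)) : ℝ :=
  if x = 0 then 1 else (f ‖x‖ / ‖x‖) ^ (n - 1)

/-- The first eigenvalue `λ(r)` of the Laplace-Beltrami operator, with Dirichlet boundary
conditions, on the geodesic ball of radius `r` centred at the pole of the spherically symmetric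
`n`-manifold with metric `dr² + f(r)² dθ²`: the infimum of the Rayleigh quotients
`∫ |∇u|² dV / ∫ u² dV` of the nonzero smooth functions with compact support in the ball.
In geodesic polar coordinates this ball is the Euclidean ball of radius `r` about `0`. -/
def firstEigenvalue (n : ℕ) (f : ℝ → ℝ) (r : ℝ) : ℝ :=
  sInf {q : ℝ | ∃ u : EuclideanSpace ℝ (Fin n) → ℝ,
    ContDiff ℝ ∞ u ∧ HasCompactSupport u ∧ tsupport u ⊆ Metric.ball 0 r ∧ u ≠ 0 ∧
    q = (∫ x in Metric.ball 0 r,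
          polarMetric f x (polarGrad f u x) (polarGrad f u x) * polarDensity f x) /
        ∫ x in Metric.ball 0 r, u x ^ 2 * polarDensity f x}

/-- `ψ` is a nontrivial classical solution of the radial eigenvalue problem
`-(f^(n-1) ψ')' = μ f^(n-1) ψ` on `(0, r)`, `ψ'(0) = ψ(r) = 0`. -/
structure IsRadialEigenfunction (n : ℕ) (f : ℝ → ℝ) (r μ : ℝ) (ψ : ℝ → ℝ) : Prop where
  continuousOn : ContinuousOn ψ (Icc 0 r)
  differentiableOn : DifferentiableOn ℝ ψ (Ioo 0 r)
  equation : ∀ t ∈ Ioo 0 r,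
    HasDerivAt (fun s => f s ^ (n - 1) * deriv ψ s) (-(μ * f t ^ (n - 1) * ψ t)) t
  deriv_zero : HasDerivWithinAt ψ 0 (Ici 0) 0
  boundary : ψ r = 0
  nontrivial : ∃ t ∈ Ioo 0 r, ψ t ≠ 0

/-- `g = f' / f`. -/
def gFun (f : ℝ → ℝ) (t : ℝ) : ℝ := deriv f t / f t

/-- `h = g' + (n - 1) g² / 2`. -/
def hFun (n : ℕ) (f : ℝ → ℝ) (t : ℝ) : ℝ :=
  deriv (gFun f) t + ((n : ℝ) - 1) / 2 * gFun f t ^ 2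

/-- `H(t) = t h'(t) + 2 h(t)`. -/
def HFun (n : ℕ) (f : ℝ → ℝ) (t : ℝ) : ℝ := t * deriv (hFun n f) t + 2 * hFun n f t

/-- The mean of `H` over `(0, t)` with weight `f^(n-1) ψ²`. -/
def weightedMeanH (n : ℕ) (f : ℝ → ℝ) (ψ : ℝ → ℝ) (t : ℝ) : ℝ :=
  (∫ s in (0 : ℝ)..t, HFun n f s * f s ^ (n - 1) * ψ s ^ 2) /
    ∫ s in (0 : ℝ)..t, f s ^ (n - 1) * ψ s ^ 2

/-- The Bessel function of the first kind `J_ν(x)`, for `ν > -1` and `x > 0`. -/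
def besselJ (ν x : ℝ) : ℝ :=
  ∑' m : ℕ, (-1) ^ m / ((m.factorial : ℝ) * Real.Gamma (m + ν + 1)) *
    (x / 2) ^ (2 * (m : ℝ) + ν)

/-- The first positive zero `j_{ν,1}` of `J_ν`. -/
def besselFirstZero (ν : ℝ) : ℝ := sInf {x : ℝ | 0 < x ∧ besselJ ν x = 0}

end

/-! ### Calculus on an interval -/

/-! Write w = f^(n-1) and φ_r = ψ_r / ψ_r(0). Two formulas for the boundary term w(r) φ_r'(r)² carry
the proof. Hadamard's formula (`IsDirichletFamily.hasDerivAt`) says λ'(r) = -w(r) φ_r'(r)² / ∫ w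
φ_r². The virial identity (`IsProfile.virial_identity`) says r w(r) φ_r'(r)² = 2λ ∫ w φ_r² - (n-1)/2
∫ H w φ_r². Eliminating the boundary term gives rλ' + 2λ = (n-1)/2 Q, that is, (s²λ)' = (n-1)/2 · s
Q(s). Since f''(0) = 0 forces f - t f' = O(t³), H is bounded near the pole; so is its mean Q, and
the formula can be integrated down to 0.

The equation is singular at the pole, so it is used in the Volterra form w φ' = -μ ∫₀ᵗ w φ, φ(0) =
1. Its kernel w(s)/w(t), s ≤ t, is bounded because f is comparable to t, and a Grönwall estimate
yields uniqueness and continuous dependence on both μ and w.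

Of the variational definition of λ only three facts are needed: λ ≥ 0, λ is antitone, and λ(r) ≤ μ
whenever a regular solution for μ vanishes at r (tested on radial functions). Together with
uniqueness they force φ_r ≥ 0, without spectral theory. The Wronskian of φ_s and φ_t on [0, s] then
expresses λ(t) - λ(s) through φ_t(s), which gives first a Lipschitz bound and then the derivative.

For the constant at the pole, let L be the limit of s²λ(s). The functions x ↦ φ_s(s x) solve the
equation on [0, 1] with eigenvalue s²λ(s) and weight f(s x)^(n-1), whose kernel tends to the
Euclidean one because f(t)/t → 1. They converge to the Bessel solution with eigenvalue L, which is
therefore nonnegative on [0, 1] and zero at 1; hence √L is the first Bessel zero. -/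

theorem intervalIntegrable_of_continuousOn_Icc {F : ℝ → ℝ} {a b s t : ℝ}
    (hF : ContinuousOn F (Icc a b)) (hs : s ∈ Icc a b) (ht : t ∈ Icc a b) :
    IntervalIntegrable F volume s t :=
  (hF.mono (uIcc_subset_Icc hs ht)).intervalIntegrable

theorem hasDerivAt_primitive_of_continuousOn_Icc {F : ℝ → ℝ} {a b t : ℝ}
    (hF : ContinuousOn F (Icc a b)) (ht : t ∈ Ioo a b) :
    HasDerivAt (fun x => ∫ s in a..x, F s) (F t) t := by
  have hab : a ≤ b := (ht.1.trans ht.2).le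
  refine intervalIntegral.integral_hasDerivAt_right
    (intervalIntegrable_of_continuousOn_Icc hF (left_mem_Icc.2 hab) (Ioo_subset_Icc_self ht)) ?_
    (hF.continuousAt (Icc_mem_nhds ht.1 ht.2))
  exact (hF.mono Ioo_subset_Icc_self).stronglyMeasurableAtFilter isOpen_Ioo t ht

theorem continuousOn_primitive_of_continuousOn_Icc {F : ℝ → ℝ} {a b : ℝ} (hab : a ≤ b)
    (hF : ContinuousOn F (Icc a b)) :
    ContinuousOn (fun x => ∫ s in a..x, F s) (Icc a b) := by
  have h := intervalIntegral.continuousOn_primitive_interval' (b₁ := a) (b₂ := b) (a := a)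
    (intervalIntegrable_of_continuousOn_Icc hF (left_mem_Icc.2 hab) (right_mem_Icc.2 hab))
    left_mem_uIcc
  rwa [uIcc_of_le hab] at h

theorem abs_sub_le_of_hasDerivAt {δ d : ℝ → ℝ} {a b M : ℝ} (hab : a ≤ b)
    (hc : ContinuousOn δ (Icc a b)) (hd : ∀ t ∈ Ioo a b, HasDerivAt δ (d t) t)
    (hM : ∀ t ∈ Ioo a b, |d t| ≤ M) : |δ b - δ a| ≤ M * (b - a) := by
  rcases hab.eq_or_lt with rfl | hab
  · simp
  obtain ⟨c, hcm, hc'⟩ := exists_hasDerivAt_eq_slope δ d hab hc hd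
  have := hM c hcm
  rw [hc', abs_div, abs_of_pos (sub_pos.2 hab), div_le_iff₀ (sub_pos.2 hab)] at this
  exact this

/-- A Grönwall inequality with a Volterra right hand side. -/
theorem abs_le_of_abs_deriv_le_integral {δ d : ℝ → ℝ} {b K ε : ℝ} (hb : 0 ≤ b) (hK : 0 ≤ K)
    (hε : 0 ≤ ε) (hc : ContinuousOn δ (Icc 0 b)) (h0 : δ 0 = 0)
    (hd : ∀ t ∈ Ioo 0 b, HasDerivAt δ (d t) t)
    (hbd : ∀ t ∈ Ioo 0 b, |d t| ≤ K * (∫ s in (0 : ℝ)..t, |δ s|) + ε) :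
    ∀ t ∈ Icc 0 b, |δ t| ≤ ε * b * Real.exp (K * b ^ 2) := by
  -- Extending δ constantly beyond the interval makes its primitive differentiable on all of ℝ.
  set δ' : ℝ → ℝ := fun t => |IccExtend hb ((Icc 0 b).domRestrict δ) t| with hδ'
  have hδc : Continuous δ' := (hc.domRestrict.Icc_extend' (h := hb)).abs
  have heq : ∀ t ∈ Icc 0 b, δ' t = |δ t| := by
    intro t ht
    simp [hδ', IccExtend_of_mem hb _ ht, domRestrict_apply]
  set G : ℝ → ℝ := fun t => ∫ s in (0 : ℝ)..t, δ' s with hG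
  have hGd : ∀ t, HasDerivAt G (δ' t) t := fun t => hδc.integral_hasStrictDerivAt 0 t |>.hasDerivAt
  have hGeq : ∀ t ∈ Icc 0 b, G t = ∫ s in (0 : ℝ)..t, |δ s| := by
    intro t ht
    apply intervalIntegral.integral_congr
    intro s hs
    rw [uIcc_of_le ht.1] at hs
    exact heq s ⟨hs.1, hs.2.trans ht.2⟩
  have hGmono : Monotone G := monotone_of_hasDerivAt_nonneg hGd (fun t => abs_nonneg _)
  have hG0 : G 0 = 0 := by simp [hG]
  have hGnn : ∀ t ∈ Icc 0 b, 0 ≤ G t := fun t ht => hG0 ▸ hGmono ht.1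
  -- As G is monotone, the mean value theorem turns the Volterra bound into a pointwise one. Since
  -- G' = |δ|, this is an ordinary Grönwall inequality for G, with constant K b; hence the exponent
  -- K b².
  have key : ∀ t ∈ Icc 0 b, |δ t| ≤ (K * b) * G t + ε * b := by
    intro t ht
    have := abs_sub_le_of_hasDerivAt (M := K * G t + ε) ht.1
      (hc.mono (Icc_subset_Icc_right ht.2))
      (fun s hs => hd s ⟨hs.1, hs.2.trans_le ht.2⟩) (fun s hs => by
        have hs' : s ∈ Ioo 0 b := ⟨hs.1, hs.2.trans_le ht.2⟩
        refine (hbd s hs').trans ?_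
        rw [← hGeq s (Ioo_subset_Icc_self hs')]
        have := hGmono hs.2.le
        gcongr)
    rw [h0, sub_zero, sub_zero] at this
    refine this.trans ?_
    have h1 := mul_le_mul_of_nonneg_left ht.2
      (add_nonneg (mul_nonneg hK (hGnn t ht)) hε)
    linarith
  have gron := norm_le_gronwallBound_of_norm_deriv_right_le (f := G) (f' := δ') (δ := 0)
    (K := K * b) (ε := ε * b) (a := 0) (b := b)
    (fun t _ => (hGd t).continuousAt.continuousWithinAt)
    (fun t _ => (hGd t).hasDerivWithinAt) (by simp [hG0]) (fun t ht => by
      have ht' := Ico_subset_Icc_self ht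
      rw [Real.norm_eq_abs, Real.norm_eq_abs, abs_of_nonneg (hGnn t ht'), heq t ht', abs_abs]
      exact key t ht')
  intro t ht
  have hg := gron t ht
  rw [Real.norm_eq_abs, abs_of_nonneg (hGnn t ht), sub_zero] at hg
  have hKb : 0 ≤ K * b := mul_nonneg hK hb
  have h2 : K * b * gronwallBound 0 (K * b) (ε * b) t + ε * b
      = ε * b * Real.exp (K * b * t) := by
    rcases hKb.eq_or_lt with h | h
    · simp [← h]
    · rw [gronwallBound_of_K_ne_0 h.ne']
      have : (K * b) * (ε * b / (K * b)) = ε * b := mul_div_cancel₀ _ h.ne'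
      simp only [zero_mul, zero_add]
      rw [← mul_assoc, this]
      ring
  have h3 : Real.exp (K * b * t) ≤ Real.exp (K * b ^ 2) := by
    apply Real.exp_le_exp.2
    have := mul_le_mul_of_nonneg_left ht.2 hKb
    linarith
  calc |δ t| ≤ K * b * G t + ε * b := key t ht
    _ ≤ K * b * gronwallBound 0 (K * b) (ε * b) t + ε * b := by gcongr
    _ = ε * b * Real.exp (K * b * t) := h2
    _ ≤ _ := by gcongr

/-! ### Regular solutions of singular Sturm-Liouville equations -/

/-- A continuous weight on `[0, b]`, vanishing only at `0`, and increasing up to the factor `C`. -/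
structure IsAdmissibleWeight (w : ℝ → ℝ) (b C : ℝ) : Prop where
  continuousOn : ContinuousOn w (Icc 0 b)
  pos : ∀ t ∈ Ioc 0 b, 0 < w t
  zero : w 0 = 0
  le : ∀ s t, 0 ≤ s → s ≤ t → t ≤ b → w s ≤ C * w t

/-- `φ` solves `-(w φ')' = μ w φ` on `(0, b)` with `φ 0 = 1` and `w φ' → 0` at `0`. -/
structure IsRegularSolution (w : ℝ → ℝ) (μ b : ℝ) (φ : ℝ → ℝ) : Prop where
  continuousOn : ContinuousOn φ (Icc 0 b)
  zero : φ 0 = 1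
  hasDerivAt : ∀ t ∈ Ioo 0 b, HasDerivAt φ (-(μ * ∫ s in (0 : ℝ)..t, w s * φ s) / w t) t

namespace IsAdmissibleWeight

variable {w : ℝ → ℝ} {b C : ℝ}

theorem nonneg (h : IsAdmissibleWeight w b C) {t : ℝ} (ht : t ∈ Icc 0 b) : 0 ≤ w t := by
  rcases ht.1.eq_or_lt with h0 | h0
  · rw [← h0, h.zero]
  · exact (h.pos t ⟨h0, ht.2⟩).le

theorem mono (h : IsAdmissibleWeight w b C) {b' : ℝ} (hb : b' ≤ b) :
    IsAdmissibleWeight w b' C where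
  continuousOn := h.continuousOn.mono (Icc_subset_Icc_right hb)
  pos t ht := h.pos t ⟨ht.1, ht.2.trans hb⟩
  zero := h.zero
  le s t hs hst ht := h.le s t hs hst (ht.trans hb)

theorem one_le (h : IsAdmissibleWeight w b C) (hb : 0 < b) : 1 ≤ C := by
  have h1 := h.le b b hb.le le_rfl le_rfl
  have h2 := h.pos b ⟨hb, le_rfl⟩
  by_contra! h3
  nlinarith

theorem div_nonneg (h : IsAdmissibleWeight w b C) {s t : ℝ} (hs : 0 ≤ s) (hst : s ≤ t)
    (ht : t ≤ b) : 0 ≤ w s / w t :=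
  _root_.div_nonneg (h.nonneg ⟨hs, hst.trans ht⟩) (h.nonneg ⟨hs.trans hst, ht⟩)

theorem div_le (h : IsAdmissibleWeight w b C) {s t : ℝ} (hs : 0 ≤ s) (hst : s ≤ t)
    (ht0 : 0 < t) (ht : t ≤ b) : w s / w t ≤ C :=
  (div_le_iff₀ (h.pos t ⟨ht0, ht⟩)).2 (h.le s t hs hst ht)

theorem integral_pos (h : IsAdmissibleWeight w b C) (hb : 0 < b) :
    0 < ∫ s in (0 : ℝ)..b, w s := by
  apply intervalIntegral.intervalIntegral_pos_of_pos_on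
    (intervalIntegrable_of_continuousOn_Icc h.continuousOn (left_mem_Icc.2 hb.le)
      (right_mem_Icc.2 hb.le)) (fun t ht => h.pos t ⟨ht.1, ht.2.le⟩) hb

end IsAdmissibleWeight

namespace IsRegularSolution

variable {w φ : ℝ → ℝ} {μ b C : ℝ}

theorem mono (h : IsRegularSolution w μ b φ) {b' : ℝ} (hb : b' ≤ b) :
    IsRegularSolution w μ b' φ where
  continuousOn := h.continuousOn.mono (Icc_subset_Icc_right hb)
  zero := h.zero
  hasDerivAt t ht := h.hasDerivAt t ⟨ht.1, ht.2.trans_le hb⟩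

theorem continuousOn_mul (h : IsRegularSolution w μ b φ) (hw : IsAdmissibleWeight w b C) :
    ContinuousOn (fun s => w s * φ s) (Icc 0 b) :=
  hw.continuousOn.mul h.continuousOn

/-- Two regular solutions differ little if the kernels of their integral equations do. -/
theorem abs_sub_le {w₂ φ₂ : ℝ → ℝ} {μ₂ C₂ B ε : ℝ} (hb : 0 ≤ b)
    (hw : IsAdmissibleWeight w b C) (hw₂ : IsAdmissibleWeight w₂ b C₂)
    (h : IsRegularSolution w μ b φ) (h₂ : IsRegularSolution w₂ μ₂ b φ₂)
    (hB : ∀ t ∈ Icc 0 b, |φ₂ t| ≤ B) (hε0 : 0 ≤ ε)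
    (hε : ∀ s t, 0 ≤ s → s ≤ t → 0 < t → t ≤ b → |μ * (w s / w t) - μ₂ * (w₂ s / w₂ t)| ≤ ε) :
    ∀ t ∈ Icc 0 b, |φ t - φ₂ t| ≤ ε * B * b * b * Real.exp (|μ| * C * b ^ 2) := by
  rcases hb.eq_or_lt with rfl | hb0
  · intro t ht
    have : t = 0 := le_antisymm ht.2 ht.1
    simp [this, h.zero, h₂.zero]
  have hB0 : 0 ≤ B := (abs_nonneg _).trans (hB 0 (left_mem_Icc.2 hb))
  have hC := hw.one_le hb0
  refine abs_le_of_abs_deriv_le_integral (K := |μ| * C) (ε := ε * B * b)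
    (δ := fun t => φ t - φ₂ t) hb (by positivity) (by positivity)
    (h.continuousOn.sub h₂.continuousOn) (by simp [h.zero, h₂.zero])
    (fun t ht => (h.hasDerivAt t ht).sub (h₂.hasDerivAt t ht)) ?_
  intro t ht
  have hsub : Icc 0 t ⊆ Icc 0 b := Icc_subset_Icc_right ht.2.le
  have h0t : (0 : ℝ) ∈ Icc 0 b := left_mem_Icc.2 hb
  have htb : t ∈ Icc 0 b := Ioo_subset_Icc_self ht
  have i1 : IntervalIntegrable (fun s => μ * (w s / w t) * φ s) volume 0 t :=
    intervalIntegrable_of_continuousOn_Icc ((continuousOn_const.mul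
      (hw.continuousOn.div_const _)).mul h.continuousOn) h0t htb
  have i2 : IntervalIntegrable (fun s => μ₂ * (w₂ s / w₂ t) * φ₂ s) volume 0 t :=
    intervalIntegrable_of_continuousOn_Icc ((continuousOn_const.mul
      (hw₂.continuousOn.div_const _)).mul h₂.continuousOn) h0t htb
  have i3 : IntervalIntegrable (fun s => |φ s - φ₂ s|) volume 0 t :=
    intervalIntegrable_of_continuousOn_Icc (h.continuousOn.sub h₂.continuousOn).abs h0t htb
  -- The division by w t goes under the integral, where the ratio w s / w t is bounded even though w
  -- vanishes at the pole.
  have e1 : -(μ * ∫ s in (0 : ℝ)..t, w s * φ s) / w t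
      = -∫ s in (0 : ℝ)..t, μ * (w s / w t) * φ s := by
    rw [← intervalIntegral.integral_const_mul, neg_div, ← intervalIntegral.integral_div]
    congr 1
    refine intervalIntegral.integral_congr fun s _ => ?_
    ring
  have e2 : -(μ₂ * ∫ s in (0 : ℝ)..t, w₂ s * φ₂ s) / w₂ t
      = -∫ s in (0 : ℝ)..t, μ₂ * (w₂ s / w₂ t) * φ₂ s := by
    rw [← intervalIntegral.integral_const_mul, neg_div, ← intervalIntegral.integral_div]
    congr 1
    refine intervalIntegral.integral_congr fun s _ => ?_
    ring
  rw [e1, e2, ← neg_sub', abs_neg, ← intervalIntegral.integral_sub i1 i2]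
  calc |∫ s in (0 : ℝ)..t, (μ * (w s / w t) * φ s - μ₂ * (w₂ s / w₂ t) * φ₂ s)|
      ≤ ∫ s in (0 : ℝ)..t, |μ * (w s / w t) * φ s - μ₂ * (w₂ s / w₂ t) * φ₂ s| :=
        intervalIntegral.abs_integral_le_integral_abs ht.1.le
    _ ≤ ∫ s in (0 : ℝ)..t, (|μ| * C * |φ s - φ₂ s| + ε * B) := by
        refine intervalIntegral.integral_mono_on ht.1.le (i1.sub i2).abs
          ((i3.const_mul _).add intervalIntegrable_const) fun s hs => ?_
        have a1 := hε s t hs.1 hs.2 ht.1 ht.2.le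
        have a2 := hB s (hsub hs)
        have a3 := hw.div_le hs.1 hs.2 ht.1 ht.2.le
        have a4 := hw.div_nonneg hs.1 hs.2 ht.2.le
        have : μ * (w s / w t) * φ s - μ₂ * (w₂ s / w₂ t) * φ₂ s
            = μ * (w s / w t) * (φ s - φ₂ s)
              + (μ * (w s / w t) - μ₂ * (w₂ s / w₂ t)) * φ₂ s := by ring
        rw [this]
        refine (abs_add_le _ _).trans ?_
        rw [abs_mul, abs_mul, abs_mul, abs_of_nonneg a4]
        gcongr
    _ = |μ| * C * (∫ s in (0 : ℝ)..t, |φ s - φ₂ s|) + ε * B * t := by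
        rw [intervalIntegral.integral_add (i3.const_mul _) intervalIntegrable_const,
          intervalIntegral.integral_const_mul]
        simp
        ring
    _ ≤ _ := by
        have := mul_le_mul_of_nonneg_left ht.2.le (mul_nonneg hε0 hB0)
        linarith

/-- Continuous dependence of a regular solution on the eigenvalue. -/
theorem abs_sub_le_of_same_weight {φ₂ : ℝ → ℝ} {μ₂ B : ℝ} (hb : 0 ≤ b)
    (hw : IsAdmissibleWeight w b C)
    (h : IsRegularSolution w μ b φ) (h₂ : IsRegularSolution w μ₂ b φ₂)
    (hB : ∀ t ∈ Icc 0 b, |φ₂ t| ≤ B) :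
    ∀ t ∈ Icc 0 b, |φ t - φ₂ t| ≤
      |μ - μ₂| * C * B * b * b * Real.exp (|μ| * C * b ^ 2) := by
  rcases hb.eq_or_lt with rfl | hb0
  · intro t ht
    have : t = 0 := le_antisymm ht.2 ht.1
    simp [this, h.zero, h₂.zero]
  have hC := hw.one_le hb0
  refine abs_sub_le hb hw hw h h₂ hB (by positivity) fun s t hs hst ht0 ht => ?_
  rw [← sub_mul, abs_mul, abs_of_nonneg (hw.div_nonneg hs hst ht)]
  have := hw.div_le hs hst ht0 ht
  gcongr

/-- Continuous dependence with equal eigenvalues leaves the bound 0. -/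
theorem eqOn {φ₂ : ℝ → ℝ} (hb : 0 ≤ b) (hw : IsAdmissibleWeight w b C)
    (h : IsRegularSolution w μ b φ) (h₂ : IsRegularSolution w μ b φ₂) :
    EqOn φ φ₂ (Icc 0 b) := by
  obtain ⟨B, hB⟩ := isCompact_Icc.exists_bound_of_continuousOn h₂.continuousOn
  intro t ht
  have := abs_sub_le_of_same_weight hb hw h h₂ hB t ht
  simp only [sub_self, abs_zero, zero_mul] at this
  exact sub_eq_zero.1 (abs_nonpos_iff.1 this)

theorem integral_nonneg (h : IsAdmissibleWeight w b C)
    (hn : ∀ t ∈ Icc 0 b, 0 ≤ φ t) {t : ℝ} (ht : t ∈ Icc 0 b) :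
    0 ≤ ∫ s in (0 : ℝ)..t, w s * φ s :=
  intervalIntegral.integral_nonneg ht.1 fun s hs =>
    mul_nonneg (h.nonneg ⟨hs.1, hs.2.trans ht.2⟩) (hn s ⟨hs.1, hs.2.trans ht.2⟩)

theorem antitoneOn (h : IsRegularSolution w μ b φ) (hw : IsAdmissibleWeight w b C)
    (hμ : 0 ≤ μ) (hn : ∀ t ∈ Icc 0 b, 0 ≤ φ t) : AntitoneOn φ (Icc 0 b) := by
  refine antitoneOn_of_deriv_nonpos (convex_Icc 0 b) h.continuousOn ?_ ?_
  · rw [interior_Icc]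
    exact fun t ht => (h.hasDerivAt t ht).differentiableAt.differentiableWithinAt
  · rw [interior_Icc]
    intro t ht
    rw [(h.hasDerivAt t ht).deriv, neg_div]
    exact neg_nonpos.2 (_root_.div_nonneg (mul_nonneg hμ
      (integral_nonneg hw hn (Ioo_subset_Icc_self ht))) (hw.nonneg (Ioo_subset_Icc_self ht)))

theorem le_one (h : IsRegularSolution w μ b φ) (hw : IsAdmissibleWeight w b C)
    (hμ : 0 ≤ μ) (hn : ∀ t ∈ Icc 0 b, 0 ≤ φ t) {t : ℝ} (ht : t ∈ Icc 0 b) : φ t ≤ 1 := by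
  rw [← h.zero]
  exact h.antitoneOn hw hμ hn (left_mem_Icc.2 (ht.1.trans ht.2)) ht ht.1

/-- Near 0 the integrand is positive because φ 0 = 1, and elsewhere it is nonnegative. This strict
sign of the flux is what makes φ strictly decreasing. -/
theorem integral_pos (h : IsRegularSolution w μ b φ) (hw : IsAdmissibleWeight w b C)
    (hn : ∀ t ∈ Icc 0 b, 0 ≤ φ t) {t : ℝ} (ht : t ∈ Ioc 0 b) :
    0 < ∫ s in (0 : ℝ)..t, w s * φ s := by
  have h0 : (0 : ℝ) ∈ Icc 0 b := ⟨le_rfl, ht.1.le.trans ht.2⟩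
  have hev : ∀ᶠ x in 𝓝[Icc 0 b] (0 : ℝ), 0 < φ x :=
    (h.continuousOn 0 h0).eventually (lt_mem_nhds (h.zero ▸ one_pos))
  obtain ⟨ε, hε, hεs⟩ := Metric.mem_nhdsWithin_iff.1 hev
  have hx0 : 0 < min (ε / 2) t := lt_min (by positivity) ht.1
  set x := min (ε / 2) t with hx
  have hxt : x ≤ t := min_le_right _ _
  have hxb : x ∈ Icc 0 b := ⟨hx0.le, hxt.trans ht.2⟩
  have hcont := h.continuousOn_mul hw
  have i1 := intervalIntegrable_of_continuousOn_Icc hcont h0 hxb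
  have i2 := intervalIntegrable_of_continuousOn_Icc hcont hxb (Ioc_subset_Icc_self ht)
  rw [← intervalIntegral.integral_add_adjacent_intervals i1 i2]
  refine add_pos_of_pos_of_nonneg ?_ ?_
  · refine intervalIntegral.intervalIntegral_pos_of_pos_on i1 (fun s hs => ?_) hx0
    have hsb : s ∈ Icc 0 b := ⟨hs.1.le, hs.2.le.trans hxb.2⟩
    refine mul_pos (hw.pos s ⟨hs.1, hsb.2⟩) (hεs ⟨?_, hsb⟩)
    rw [Metric.mem_ball, Real.dist_eq, sub_zero, abs_of_pos hs.1]
    have := min_le_left (ε / 2) t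
    linarith [hs.2]
  · exact intervalIntegral.integral_nonneg hxt fun s hs =>
      mul_nonneg (hw.nonneg ⟨hx0.le.trans hs.1, hs.2.trans ht.2⟩)
        (hn s ⟨hx0.le.trans hs.1, hs.2.trans ht.2⟩)

theorem ne_zero_of_eq_zero (h : IsRegularSolution w μ b φ) (hb : 0 ≤ b) (h0 : φ b = 0) :
    μ ≠ 0 := by
  rintro rfl
  have := abs_sub_le_of_hasDerivAt (M := 0) hb h.continuousOn h.hasDerivAt (by simp)
  rw [h.zero, h0] at this
  norm_num at this

/-- The end value 0 excludes μ = 0, so the flux is strictly negative on (0, b) and φ decreases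
strictly to its value 0 at b. -/
theorem pos_of_nonneg (h : IsRegularSolution w μ b φ) (hw : IsAdmissibleWeight w b C)
    (hμ : 0 ≤ μ) (hn : ∀ t ∈ Icc 0 b, 0 ≤ φ t) (h0 : φ b = 0) :
    ∀ t ∈ Ico 0 b, 0 < φ t := by
  intro t ht
  have hb : 0 ≤ b := ht.1.trans ht.2.le
  have hμ' : 0 < μ := lt_of_le_of_ne hμ (h.ne_zero_of_eq_zero hb h0).symm
  rw [← h0]
  refine strictAntiOn_of_deriv_neg (convex_Icc 0 b) h.continuousOn ?_ ⟨ht.1, ht.2.le⟩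
    ⟨hb, le_rfl⟩ ht.2
  rw [interior_Icc]
  intro s hs
  rw [(h.hasDerivAt s hs).deriv, neg_div]
  exact neg_neg_of_pos (div_pos (mul_pos hμ' (h.integral_pos hw hn (Ioo_subset_Ioc_self hs)))
    (hw.pos s (Ioo_subset_Ioc_self hs)))

/-- In the integral w s ≤ C w t, so the quotient is O(t): the derivative extends continuously by 0
to the pole. At t = 0 the expression is 0 because the integral is. -/
theorem abs_deriv_le (hw : IsAdmissibleWeight w b C) {B : ℝ}
    (hB : ∀ t ∈ Icc 0 b, |φ t| ≤ B) {t : ℝ} (ht : t ∈ Icc 0 b) :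
    |-(μ * ∫ s in (0 : ℝ)..t, w s * φ s) / w t| ≤ |μ| * C * B * t := by
  rcases ht.1.eq_or_lt with rfl | ht0
  · simp
  have hwt := hw.pos t ⟨ht0, ht.2⟩
  rw [abs_div, abs_neg, abs_mul, abs_of_pos hwt, div_le_iff₀ hwt]
  have hb0 : (0 : ℝ) ∈ Icc 0 b := ⟨le_rfl, ht.1.trans ht.2⟩
  have h1 : |∫ s in (0 : ℝ)..t, w s * φ s| ≤ C * w t * B * |t - 0| := by
    rw [← Real.norm_eq_abs]
    refine intervalIntegral.norm_integral_le_of_norm_le_const fun s hs => ?_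
    rw [uIoc_of_le ht.1] at hs
    have hsb : s ∈ Icc 0 b := ⟨hs.1.le, hs.2.trans ht.2⟩
    rw [Real.norm_eq_abs, abs_mul, abs_of_nonneg (hw.nonneg hsb)]
    have a1 := hw.le s t hs.1.le hs.2 ht.2
    have a2 := hB s hsb
    have a3 := hw.nonneg hsb
    gcongr
    exact a3.trans a1
  rw [sub_zero, abs_of_pos ht0] at h1
  calc |μ| * |∫ s in (0 : ℝ)..t, w s * φ s| ≤ |μ| * (C * w t * B * t) := by gcongr
    _ = _ := by ring

/-- The Wronskian identity. -/
theorem wronskian {φ₂ : ℝ → ℝ} {μ₂ : ℝ} (hb : 0 ≤ b) (hw : IsAdmissibleWeight w b C)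
    (h : IsRegularSolution w μ b φ) (h₂ : IsRegularSolution w μ₂ b φ₂) (h0 : φ b = 0) :
    -(μ * ∫ s in (0 : ℝ)..b, w s * φ s) * φ₂ b =
      (μ₂ - μ) * ∫ s in (0 : ℝ)..b, w s * φ s * φ₂ s := by
  have c1 := h.continuousOn_mul hw
  have c2 := h₂.continuousOn_mul hw
  have key := intervalIntegral.integral_eq_sub_of_hasDerivAt_of_le hb
    (f := fun t => -(μ * ∫ s in (0 : ℝ)..t, w s * φ s) * φ₂ t
      - -(μ₂ * ∫ s in (0 : ℝ)..t, w s * φ₂ s) * φ t)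
    (f' := fun t => (μ₂ - μ) * (w t * φ t * φ₂ t))
    (((continuousOn_const.mul (continuousOn_primitive_of_continuousOn_Icc hb c1)).neg.mul
      h₂.continuousOn).sub ((continuousOn_const.mul
        (continuousOn_primitive_of_continuousOn_Icc hb c2)).neg.mul h.continuousOn))
    (fun t ht => by
      have d1 := (((hasDerivAt_primitive_of_continuousOn_Icc c1 ht).const_mul μ).neg.mul
        (h₂.hasDerivAt t ht)).sub
        (((hasDerivAt_primitive_of_continuousOn_Icc c2 ht).const_mul μ₂).neg.mul
        (h.hasDerivAt t ht))
      refine d1.congr_deriv ?_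
      have := (hw.pos t (Ioo_subset_Ioc_self ht)).ne'
      simp only [Pi.neg_apply]
      field_simp
      ring)
    (intervalIntegrable_of_continuousOn_Icc (continuousOn_const.mul (c1.mul h₂.continuousOn))
      (left_mem_Icc.2 hb) (right_mem_Icc.2 hb))
  rw [intervalIntegral.integral_const_mul] at key
  rw [key]
  simp [h0]

end IsRegularSolution

/-! ### The profile of a spherically symmetric metric -/

/-- `f₁, f₂, f₃` are the derivatives of the profile `f` on `[0, b]`. -/
structure IsProfile (f f₁ f₂ f₃ : ℝ → ℝ) (b : ℝ) : Prop where
  cont : ContinuousOn f (Icc 0 b)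
  cont₁ : ContinuousOn f₁ (Icc 0 b)
  cont₂ : ContinuousOn f₂ (Icc 0 b)
  cont₃ : ContinuousOn f₃ (Icc 0 b)
  deriv₁ : ∀ t ∈ Ioo 0 b, HasDerivAt f (f₁ t) t
  deriv₂ : ∀ t ∈ Ioo 0 b, HasDerivAt f₁ (f₂ t) t
  deriv₃ : ∀ t ∈ Ioo 0 b, HasDerivAt f₂ (f₃ t) t
  zero : f 0 = 0
  zero₁ : f₁ 0 = 1
  zero₂ : f₂ 0 = 0
  pos : ∀ t ∈ Ioc 0 b, 0 < f t

theorem exists_isProfile {R : EReal} {f : ℝ → ℝ}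
    (hf : ContDiffOn ℝ 3 f {t : ℝ | 0 ≤ t ∧ (t : EReal) < R})
    (hf0 : f 0 = 0) (hf1 : derivWithin f (Ici 0) 0 = 1)
    (hf2 : iteratedDerivWithin 2 f (Ici 0) 0 = 0)
    (hfpos : ∀ t : ℝ, 0 < t → (t : EReal) < R → 0 < f t) :
    ∃ f₁ f₂ f₃ : ℝ → ℝ, ∀ b : ℝ, 0 < b → (b : EReal) < R → IsProfile f f₁ f₂ f₃ b := by
  set S := {t : ℝ | 0 ≤ t ∧ (t : EReal) < R} with hS
  refine ⟨iteratedDerivWithin 1 f S, iteratedDerivWithin 2 f S, iteratedDerivWithin 3 f S,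
    fun b hb hbR => ?_⟩
  have hsub : Icc 0 b ⊆ S := fun t ht => ⟨ht.1, (EReal.coe_le_coe_iff.2 ht.2).trans_lt hbR⟩
  have hconv : Convex ℝ S := by
    refine OrdConnected.convex ⟨fun x hx y hy z hz => ⟨hx.1.trans hz.1, ?_⟩⟩
    exact (EReal.coe_le_coe_iff.2 hz.2).trans_lt hy.2
  have hmem : ∀ t ∈ Ioo 0 b, S ∈ 𝓝 t := fun t ht =>
    mem_of_superset (Icc_mem_nhds ht.1 ht.2) hsub
  have huniq : UniqueDiffOn ℝ S := by
    refine uniqueDiffOn_convex hconv ⟨b / 2, mem_interior_iff_mem_nhds.2 ?_⟩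
    exact hmem _ ⟨by linarith, by linarith⟩
  have hc : ∀ k : ℕ, k ≤ 3 → ContinuousOn (iteratedDerivWithin k f S) (Icc 0 b) := fun k hk =>
    (hf.continuousOn_iteratedDerivWithin (by exact_mod_cast hk) huniq).mono hsub
  have hd : ∀ k : ℕ, k < 3 → ∀ t ∈ Ioo 0 b,
      HasDerivAt (iteratedDerivWithin k f S) (iteratedDerivWithin (k + 1) f S t) t := by
    intro k hk t ht
    have h1 := hf.differentiableOn_iteratedDerivWithin (m := k) (by exact_mod_cast hk) huniq t
      (hsub (Ioo_subset_Icc_self ht))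
    rw [iteratedDerivWithin_succ]
    exact h1.hasDerivWithinAt.hasDerivAt (hmem t ht)
  -- The derivatives are taken within [0, R) but the values at the pole are given within [0, ∞); the
  -- two sets agree near 0.
  have heq : S =ᶠ[𝓝 0] Ici (0 : ℝ) := by
    filter_upwards [Iio_mem_nhds hb] with x hx
    refine propext ⟨fun h => h.1, fun h => hsub ⟨h, le_of_lt hx⟩⟩
  refine ⟨hf.continuousOn.mono hsub, hc 1 (by norm_num), hc 2 (by norm_num), hc 3 le_rfl,
    fun t ht => ?_, hd 1 (by norm_num), hd 2 (by norm_num), hf0, ?_, ?_,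
    fun t ht => hfpos t ht.1 ((EReal.coe_le_coe_iff.2 ht.2).trans_lt hbR)⟩
  · have := hd 0 (by norm_num) t ht
    rwa [iteratedDerivWithin_zero] at this
  · rw [iteratedDerivWithin_one, derivWithin_congr_set heq, hf1]
  · refine Eq.trans ?_ hf2
    exact congrArg
      (fun L : ContinuousMultilinearMap ℝ (fun _ : Fin 2 => ℝ) ℝ => L fun _ => 1)
      (iteratedFDerivWithin_congr_set heq 2)

namespace IsProfile

variable {f f₁ f₂ f₃ : ℝ → ℝ} {b : ℝ}

/-- The Taylor data at 0 are propagated upwards by the mean value theorem: f₂ = O(t), f₁ - 1 = O(t),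
f - t = O(t²). The last bound uses (f - t f₁)' = -t f₂ = O(t²), and is exactly what the f³ in the
denominator of H requires. -/
theorem exists_bounds (h : IsProfile f f₁ f₂ f₃ b) (hb : 0 < b) :
    ∃ K c : ℝ, 0 < K ∧ 0 < c ∧ ∀ t ∈ Icc 0 b,
      c * t ≤ f t ∧ f t ≤ K * t ∧ |f t - t| ≤ K * t * t ∧ |f₁ t| ≤ K ∧ |f₂ t| ≤ K * t ∧
        |f₃ t| ≤ K ∧ |f t - t * f₁ t| ≤ K * t ^ 3 := by
  obtain ⟨K₁, hK₁⟩ := isCompact_Icc.exists_bound_of_continuousOn h.cont₁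
  obtain ⟨K₂, hK₂⟩ := isCompact_Icc.exists_bound_of_continuousOn h.cont₂
  obtain ⟨K₃, hK₃⟩ := isCompact_Icc.exists_bound_of_continuousOn h.cont₃
  have h0b : (0 : ℝ) ∈ Icc 0 b := left_mem_Icc.2 hb.le
  have hK₁0 := (norm_nonneg _).trans (hK₁ 0 h0b)
  have hK₂0 := (norm_nonneg _).trans (hK₂ 0 h0b)
  have hK₃0 := (norm_nonneg _).trans (hK₃ 0 h0b)
  simp only [Real.norm_eq_abs] at hK₁ hK₂ hK₃
  set K := K₁ + K₂ + K₃ + 1 with hK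
  have hKpos : 0 < K := by positivity
  have s1 : ∀ t ∈ Icc 0 b, Icc 0 t ⊆ Icc 0 b := fun t ht => Icc_subset_Icc_right ht.2
  have s2 : ∀ t ∈ Icc 0 b, ∀ s ∈ Ioo 0 t, s ∈ Ioo 0 b := fun t ht s hs =>
    ⟨hs.1, hs.2.trans_le ht.2⟩
  have b2 : ∀ t ∈ Icc 0 b, |f₂ t| ≤ K * t := by
    intro t ht
    have := abs_sub_le_of_hasDerivAt (M := K) ht.1 (h.cont₂.mono (s1 t ht))
      (fun s hs => h.deriv₃ s (s2 t ht s hs))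
      (fun s hs => (hK₃ s (Ioo_subset_Icc_self (s2 t ht s hs))).trans (by linarith))
    simpa [h.zero₂] using this
  have b1 : ∀ t ∈ Icc 0 b, |f₁ t - 1| ≤ K * t := by
    intro t ht
    have := abs_sub_le_of_hasDerivAt (M := K) ht.1 (h.cont₁.mono (s1 t ht))
      (fun s hs => h.deriv₂ s (s2 t ht s hs))
      (fun s hs => (hK₂ s (Ioo_subset_Icc_self (s2 t ht s hs))).trans (by linarith))
    simpa [h.zero₁] using this
  have b0 : ∀ t ∈ Icc 0 b, f t ≤ K * t := by
    intro t ht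
    have := abs_sub_le_of_hasDerivAt (M := K) ht.1 (h.cont.mono (s1 t ht))
      (fun s hs => h.deriv₁ s (s2 t ht s hs))
      (fun s hs => (hK₁ s (Ioo_subset_Icc_self (s2 t ht s hs))).trans (by linarith))
    rw [h.zero, sub_zero, sub_zero] at this
    exact (le_abs_self _).trans this
  have b4 : ∀ t ∈ Icc 0 b, |f t - t| ≤ K * t * t := by
    intro t ht
    have := abs_sub_le_of_hasDerivAt (δ := fun t => f t - t) (M := K * t) ht.1
      ((h.cont.mono (s1 t ht)).sub continuousOn_id)
      (fun s hs => (h.deriv₁ s (s2 t ht s hs)).sub (hasDerivAt_id s))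
      (fun s hs => (b1 s (Ioo_subset_Icc_self (s2 t ht s hs))).trans (by
        have := hs.2.le; gcongr))
    simpa [h.zero] using this
  have b3 : ∀ t ∈ Icc 0 b, |f t - t * f₁ t| ≤ K * t ^ 3 := by
    intro t ht
    have := abs_sub_le_of_hasDerivAt (δ := fun t => f t - t * f₁ t)
      (d := fun t => - (t * f₂ t)) (M := t * (K * t)) ht.1
      ((h.cont.mono (s1 t ht)).sub (continuousOn_id.mul (h.cont₁.mono (s1 t ht))))
      (fun s hs => ((h.deriv₁ s (s2 t ht s hs)).sub
        ((hasDerivAt_id s).mul (h.deriv₂ s (s2 t ht s hs)))).congr_deriv (by simp))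
      (fun s hs => by
        have h1 := b2 s (Ioo_subset_Icc_self (s2 t ht s hs))
        have h2 := hs.2.le
        have h3 := hs.1.le
        have h4 := ht.1
        rw [abs_neg, abs_mul, abs_of_pos hs.1]
        gcongr
        exact h1.trans (by gcongr))
    simp only [h.zero, zero_mul, sub_zero] at this
    linarith
  -- For t ≤ 1/(2K) the estimate |f t - t| ≤ K t² gives f t ≥ t/2; on the remaining compact interval
  -- f has a positive minimum f x, and f x ≥ (f x / b) t.
  obtain ⟨c, hc, hcl⟩ : ∃ c > 0, ∀ t ∈ Icc 0 b, c * t ≤ f t := by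
    set δ := min b (1 / (2 * K)) with hδ
    have hδ0 : 0 < δ := lt_min hb (by positivity)
    have hδb : δ ≤ b := min_le_left _ _
    obtain ⟨x, hx, hmin⟩ := isCompact_Icc.exists_isMinOn (nonempty_Icc.2 hδb)
      (h.cont.mono (Icc_subset_Icc_left hδ0.le))
    have hfx : 0 < f x := h.pos x ⟨hδ0.trans_le hx.1, hx.2⟩
    refine ⟨min (1 / 2) (f x / b), lt_min (by norm_num) (by positivity), fun t ht => ?_⟩
    rcases le_total t δ with htδ | htδ
    · have h1 := (abs_le.1 (b4 t ht)).1
      have h2 : K * t ≤ 1 / 2 := by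
        have := htδ.trans (min_le_right _ _)
        calc K * t ≤ K * (1 / (2 * K)) := by gcongr
          _ = 1 / 2 := by field_simp
      have h3 := mul_le_mul_of_nonneg_right h2 ht.1
      have h4 := mul_le_mul_of_nonneg_right (min_le_left (1 / 2) (f x / b)) ht.1
      linarith
    · have h1 : f x ≤ f t := hmin ⟨htδ, ht.2⟩
      have h4 := mul_le_mul_of_nonneg_right (min_le_right (1 / 2) (f x / b)) ht.1
      have h5 : f x / b * t ≤ f x := by
        rw [div_mul_eq_mul_div, div_le_iff₀ hb]
        exact mul_le_mul_of_nonneg_left ht.2 hfx.le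
      linarith
  exact ⟨K, c, hKpos, hc, fun t ht => ⟨hcl t ht, b0 t ht, b4 t ht,
    (hK₁ t ht).trans (by linarith), b2 t ht, (hK₃ t ht).trans (by linarith), b3 t ht⟩⟩

theorem tendsto_div_self (h : IsProfile f f₁ f₂ f₃ b) (hb : 0 < b) :
    Tendsto (fun t => f t / t) (𝓝[>] 0) (𝓝 1) := by
  obtain ⟨K, c, -, -, hKc⟩ := h.exists_bounds hb
  rw [← tendsto_sub_nhds_zero_iff]
  have hlim : Tendsto (fun t : ℝ => K * t) (𝓝[>] 0) (𝓝 0) := by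
    have : Continuous fun t : ℝ => K * t := by fun_prop
    simpa using (this.tendsto 0).mono_left nhdsWithin_le_nhds
  refine squeeze_zero_norm' ?_ hlim
  filter_upwards [Ioo_mem_nhdsGT hb] with t ht
  have := (hKc t (Ioo_subset_Icc_self ht)).2.2.1
  have h0 : t ≠ 0 := ht.1.ne'
  rw [div_sub_one h0, norm_div, Real.norm_eq_abs, Real.norm_eq_abs, abs_of_pos ht.1,
    div_le_iff₀ ht.1]
  exact this

/-- Since c t ≤ f t ≤ K t, f is increasing up to the factor K / c. -/
theorem exists_isAdmissibleWeight (h : IsProfile f f₁ f₂ f₃ b) (hb : 0 < b) {m : ℕ}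
    (hm : m ≠ 0) : ∃ C, IsAdmissibleWeight (fun t => f t ^ m) b C := by
  obtain ⟨K, c, hK, hc, hKc⟩ := h.exists_bounds hb
  refine ⟨(K / c) ^ m, h.cont.pow m, fun t ht => pow_pos (h.pos t ht) m,
    by simp [h.zero, hm], fun s t hs hst ht => ?_⟩
  have h0t := hs.trans hst
  have hb1 := hKc s ⟨hs, hst.trans ht⟩
  have hb2 := hKc t ⟨h0t, ht⟩
  rw [← mul_pow]
  have h1 : 0 ≤ f s := (mul_nonneg hc.le hs).trans hb1.1
  refine pow_le_pow_left₀ h1 ?_ m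
  calc f s ≤ K * s := hb1.2.1
    _ ≤ K * t := by gcongr
    _ = K / c * (c * t) := by field_simp
    _ ≤ K / c * f t := by gcongr; exact hb2.1

theorem deriv_eq (h : IsProfile f f₁ f₂ f₃ b) {t : ℝ} (ht : t ∈ Ioo 0 b) : deriv f t = f₁ t :=
  (h.deriv₁ t ht).deriv

theorem gFun_eq (h : IsProfile f f₁ f₂ f₃ b) {t : ℝ} (ht : t ∈ Ioo 0 b) :
    gFun f t = f₁ t / f t := by rw [gFun, h.deriv_eq ht]

theorem hasDerivAt_gFun (h : IsProfile f f₁ f₂ f₃ b) {t : ℝ} (ht : t ∈ Ioo 0 b) :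
    HasDerivAt (gFun f) (f₂ t / f t - f₁ t ^ 2 / f t ^ 2) t := by
  have hft := (h.pos t (Ioo_subset_Ioc_self ht)).ne'
  have h1 := (h.deriv₂ t ht).div (h.deriv₁ t ht) hft
  refine (h1.congr_of_eventuallyEq ?_).congr_deriv ?_
  · filter_upwards [Ioo_mem_nhds ht.1 ht.2] with s hs using h.gFun_eq hs
  · field_simp

theorem deriv_gFun_eq (h : IsProfile f f₁ f₂ f₃ b) {t : ℝ} (ht : t ∈ Ioo 0 b) :
    deriv (gFun f) t = f₂ t / f t - f₁ t ^ 2 / f t ^ 2 := (h.hasDerivAt_gFun ht).deriv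

theorem hasDerivAt_deriv_gFun (h : IsProfile f f₁ f₂ f₃ b) {t : ℝ} (ht : t ∈ Ioo 0 b) :
    HasDerivAt (deriv (gFun f)) (f₃ t / f t - f₂ t * f₁ t / f t ^ 2
      - 2 * (f₁ t / f t) * (f₂ t / f t - f₁ t ^ 2 / f t ^ 2)) t := by
  have hft := (h.pos t (Ioo_subset_Ioc_self ht)).ne'
  have h1 := ((h.deriv₃ t ht).div (h.deriv₁ t ht) hft).sub
    (((h.deriv₂ t ht).pow 2).div ((h.deriv₁ t ht).pow 2) (pow_ne_zero 2 hft))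
  refine (h1.congr_of_eventuallyEq ?_).congr_deriv ?_
  · filter_upwards [Ioo_mem_nhds ht.1 ht.2] with s hs using h.deriv_gFun_eq hs
  · simp
    field_simp

theorem HFun_eq_deriv (h : IsProfile f f₁ f₂ f₃ b) (n : ℕ) {t : ℝ} (ht : t ∈ Ioo 0 b) :
    HFun n f t = t * (deriv (deriv (gFun f)) t + ((n : ℝ) - 1) * gFun f t * deriv (gFun f) t)
      + 2 * (deriv (gFun f) t + ((n : ℝ) - 1) / 2 * gFun f t ^ 2) := by
  have h1 := (h.hasDerivAt_deriv_gFun ht).differentiableAt.hasDerivAt.add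
    (((h.hasDerivAt_gFun ht).differentiableAt.hasDerivAt.pow 2).const_mul (((n : ℝ) - 1) / 2))
  have h2 : deriv (hFun n f) t = _ := h1.deriv
  rw [HFun, h2, hFun]
  push_cast
  ring

/-- The terms are grouped into the quotients t/f, f₂/f and (f - t f₁)/f³, each of which is bounded
at the pole; the singularities of t h' and 2h separately cancel in this form. -/
theorem HFun_eq (h : IsProfile f f₁ f₂ f₃ b) (n : ℕ) {t : ℝ} (ht : t ∈ Ioo 0 b) :
    HFun n f t = t / f t * f₃ t - t / f t * (f₂ t / f t) * f₁ t + 2 * (f₂ t / f t)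
      + ((n : ℝ) - 3) * (t / f t * f₁ t * (f₂ t / f t)
        + f₁ t ^ 2 * ((f t - t * f₁ t) / f t ^ 3)) := by
  have hft := (h.pos t (Ioo_subset_Ioc_self ht)).ne'
  rw [h.HFun_eq_deriv n ht, (h.hasDerivAt_deriv_gFun ht).deriv, h.deriv_gFun_eq ht, h.gFun_eq ht]
  field_simp
  ring

theorem continuousOn_HFun (h : IsProfile f f₁ f₂ f₃ b) (n : ℕ) :
    ContinuousOn (HFun n f) (Ioo 0 b) := by
  have hs : Ioo 0 b ⊆ Icc 0 b := Ioo_subset_Icc_self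
  have h0 := h.cont.mono hs
  have h1 := h.cont₁.mono hs
  have h2 := h.cont₂.mono hs
  have h3 := h.cont₃.mono hs
  have hne : ∀ t ∈ Ioo 0 b, f t ≠ 0 := fun t ht => (h.pos t (Ioo_subset_Ioc_self ht)).ne'
  have hne3 : ∀ t ∈ Ioo 0 b, f t ^ 3 ≠ 0 := fun t ht => pow_ne_zero 3 (hne t ht)
  refine ContinuousOn.congr ?_ (fun t ht => h.HFun_eq n ht)
  have e := continuousOn_id.div h0 hne
  have a := h2.div h0 hne
  exact (((e.mul h3).sub ((e.mul a).mul h1)).add (continuousOn_const.mul a)).add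
    (continuousOn_const.mul (((e.mul h1).mul a).add
      ((h1.pow 2).mul ((h0.sub (continuousOn_id.mul h1)).div (h0.pow 3) hne3))))

theorem exists_bound_HFun (h : IsProfile f f₁ f₂ f₃ b) (hb : 0 < b) (n : ℕ) :
    ∃ M, 0 ≤ M ∧ ∀ t ∈ Ioo 0 b, |HFun n f t| ≤ M := by
  obtain ⟨K, c, hK, hc, hKc⟩ := h.exists_bounds hb
  refine ⟨1 / c * K + 1 / c * (K / c) * K + 2 * (K / c)
    + |(n : ℝ) - 3| * (1 / c * K * (K / c) + K ^ 2 * (K / c ^ 3)), by positivity,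
    fun t ht => ?_⟩
  obtain ⟨k1, k2, -, k3, k4, k5, k6⟩ := hKc t (Ioo_subset_Icc_self ht)
  have hft := h.pos t (Ioo_subset_Ioc_self ht)
  have ht0 := ht.1
  have e1 : |t / f t| ≤ 1 / c := by
    rw [abs_of_pos (div_pos ht0 hft), div_le_div_iff₀ hft hc]
    linarith
  have e2 : |f₂ t / f t| ≤ K / c := by
    rw [abs_div, abs_of_pos hft]
    calc |f₂ t| / f t ≤ K * t / (c * t) := by gcongr
      _ = K / c := by field_simp
  have e3 : |(f t - t * f₁ t) / f t ^ 3| ≤ K / c ^ 3 := by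
    rw [abs_div, abs_of_pos (pow_pos hft 3)]
    calc |f t - t * f₁ t| / f t ^ 3 ≤ K * t ^ 3 / (c * t) ^ 3 := by gcongr
      _ = K / c ^ 3 := by field_simp
  rw [h.HFun_eq n ht]
  have a1 : |t / f t * f₃ t| ≤ 1 / c * K := by rw [abs_mul]; gcongr
  have a2 : |t / f t * (f₂ t / f t) * f₁ t| ≤ 1 / c * (K / c) * K := by
    rw [abs_mul, abs_mul]; gcongr
  have a3 : |2 * (f₂ t / f t)| ≤ 2 * (K / c) := by
    rw [abs_mul, abs_two]; gcongr
  have a4 : |t / f t * f₁ t * (f₂ t / f t)| ≤ 1 / c * K * (K / c) := by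
    rw [abs_mul, abs_mul]; gcongr
  have a5 : |f₁ t ^ 2 * ((f t - t * f₁ t) / f t ^ 3)| ≤ K ^ 2 * (K / c ^ 3) := by
    rw [abs_mul, abs_pow]; gcongr
  have a6 := (abs_add_le (t / f t * f₁ t * (f₂ t / f t))
    (f₁ t ^ 2 * ((f t - t * f₁ t) / f t ^ 3))).trans (add_le_add a4 a5)
  have a7 := mul_le_mul_of_nonneg_left a6 (abs_nonneg ((n : ℝ) - 3))
  rw [← abs_mul] at a7
  refine (abs_add_le _ _).trans (add_le_add ?_ a7)
  refine (abs_add_le _ _).trans (add_le_add ?_ a3)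
  exact (abs_sub _ _).trans (add_le_add a1 a2)

end IsProfile


/-! ### The virial identity, and the regularity of radial eigenfunctions at the pole -/

namespace IsRegularSolution

variable {w φ : ℝ → ℝ} {μ b C : ℝ}

theorem tendsto_flux_zero (h : IsRegularSolution w μ b φ) (hw : IsAdmissibleWeight w b C)
    (hb : 0 < b) :
    Tendsto (fun t => μ * ∫ s in (0 : ℝ)..t, w s * φ s) (𝓝[>] 0) (𝓝 0) := by
  have hc : ContinuousOn (fun t => μ * ∫ s in (0 : ℝ)..t, w s * φ s) (Icc 0 b) :=
    continuousOn_const.mul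
      (continuousOn_primitive_of_continuousOn_Icc hb.le (h.continuousOn_mul hw))
  have h0 := hc 0 (left_mem_Icc.2 hb.le)
  rw [ContinuousWithinAt] at h0
  simp only [intervalIntegral.integral_same, mul_zero] at h0
  exact h0.mono_left (nhdsWithin_le_of_mem (mem_of_superset (Ioo_mem_nhdsGT hb)
    Ioo_subset_Icc_self))

end IsRegularSolution

namespace IsProfile

variable {f f₁ f₂ f₃ : ℝ → ℝ} {b : ℝ}

theorem hasDerivAt_weight (h : IsProfile f f₁ f₂ f₃ b) {n : ℕ} (hn : 2 ≤ n) {t : ℝ}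
    (ht : t ∈ Ioo 0 b) :
    HasDerivAt (fun t => f t ^ (n - 1)) (((n : ℝ) - 1) * gFun f t * f t ^ (n - 1)) t := by
  obtain ⟨k, rfl⟩ := Nat.exists_eq_add_of_le' hn
  have hft := (h.pos t (Ioo_subset_Ioc_self ht)).ne'
  have h1 := (h.deriv₁ t ht).pow (k + 2 - 1)
  refine h1.congr_deriv ?_
  rw [h.gFun_eq ht]
  have : k + 2 - 1 = k + 1 := rfl
  rw [this, Nat.add_sub_cancel]
  push_cast
  field_simp
  ring

theorem intervalIntegrable_HFun_mul (h : IsProfile f f₁ f₂ f₃ b) (hb : 0 < b) (n : ℕ)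
    {F : ℝ → ℝ} {r : ℝ} (hr : r ∈ Ioo 0 b) (hF : ContinuousOn F (Icc 0 r)) :
    IntervalIntegrable (fun t => HFun n f t * F t) volume 0 r := by
  obtain ⟨M, hM0, hM⟩ := h.exists_bound_HFun hb n
  have hi : IntervalIntegrable F volume 0 r := by
    rw [← uIcc_of_le hr.1.le] at hF
    exact hF.intervalIntegrable
  rw [intervalIntegrable_iff, uIoc_of_le hr.1.le] at hi ⊢
  have hsub : Ioc 0 r ⊆ Ioo 0 b := fun t ht => ⟨ht.1, ht.2.trans_lt hr.2⟩
  refine Integrable.bdd_mul hi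
    (((h.continuousOn_HFun n).mono hsub).aestronglyMeasurable measurableSet_Ioc) (c := M) ?_
  filter_upwards [ae_restrict_mem measurableSet_Ioc] with t ht
  exact hM t (hsub ht)

/-- The quantity of the virial identity for the equation `-(w φ')' = μ w φ` with
`w = f ^ (n - 1)`, written with the flux `z = w φ'`. -/
noncomputable def virial (n : ℕ) (f : ℝ → ℝ) (μ : ℝ) (φ z : ℝ → ℝ) (t : ℝ) : ℝ :=
  t * (z t ^ 2 / f t ^ (n - 1)) +
    φ t * (((n : ℝ) - 1) * (t * gFun f t) * z t + μ * t * f t ^ (n - 1) * φ t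
      - ((n : ℝ) - 1) / 2 * f t ^ (n - 1) * (t * deriv (gFun f) t + gFun f t) * φ t - z t)

/-- With z = w φ', the multiplier t φ' produces t z²/w + μ t w φ². Adding -φ z cancels z²/w and
doubles μ w φ²; adding (n-1) t g φ z cancels the terms from w' = (n-1) g w; subtracting (n-1)/2 · w
(t g)' φ² removes the remaining φ z. What is left multiplies w φ² by t g'' + 2 g' + (n-1) g (t g' +
g), which is H. -/
theorem hasDerivAt_virial (h : IsProfile f f₁ f₂ f₃ b) {n : ℕ} (hn : 2 ≤ n) {μ : ℝ}
    {φ z : ℝ → ℝ} {t : ℝ} (ht : t ∈ Ioo 0 b)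
    (hφ : HasDerivAt φ (z t / f t ^ (n - 1)) t)
    (hz : HasDerivAt z (-(μ * (f t ^ (n - 1) * φ t))) t) :
    HasDerivAt (virial n f μ φ z)
      (2 * μ * (f t ^ (n - 1) * φ t ^ 2)
        - ((n : ℝ) - 1) / 2 * (HFun n f t * (f t ^ (n - 1) * φ t ^ 2))) t := by
  have hw := h.hasDerivAt_weight hn ht
  have hwne : f t ^ (n - 1) ≠ 0 := pow_ne_zero _ (h.pos t (Ioo_subset_Ioc_self ht)).ne'
  have hg := (h.hasDerivAt_gFun ht).differentiableAt.hasDerivAt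
  have hg' := (h.hasDerivAt_deriv_gFun ht).differentiableAt.hasDerivAt
  have hid := hasDerivAt_id t
  have hd := (hid.mul ((hz.pow 2).div hw hwne)).add
    (hφ.mul ((((((hid.mul hg).const_mul ((n : ℝ) - 1)).mul hz).add
      ((((hid.const_mul μ).mul hw)).mul hφ)).sub
      (((hw.const_mul (((n : ℝ) - 1) / 2)).mul ((hid.mul hg').add hg)).mul hφ)).sub hz))
  refine hd.congr_deriv ?_
  rw [h.HFun_eq_deriv n ht]
  simp only [id, Pi.mul_apply, Pi.add_apply, Pi.sub_apply, Pi.pow_apply, Pi.div_apply]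
  generalize f t ^ (n - 1) = W at *
  generalize deriv (deriv (gFun f)) t = g2
  generalize deriv (gFun f) t = g1
  generalize gFun f t = g0
  field_simp
  push_cast
  ring

theorem continuousOn_virial (h : IsProfile f f₁ f₂ f₃ b) (n : ℕ) {μ r : ℝ}
    {φ z : ℝ → ℝ} (hr : r < b) (hφ : ContinuousOn φ (Icc 0 r)) (hz : ContinuousOn z (Icc 0 r)) :
    ContinuousOn (virial n f μ φ z) (Ioc 0 r) := by
  have hsub : Ioc 0 r ⊆ Ioo 0 b := fun t ht => ⟨ht.1, ht.2.trans_lt hr⟩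
  have hφ' := hφ.mono Ioc_subset_Icc_self
  have hz' := hz.mono Ioc_subset_Icc_self
  have hf := (h.cont.mono (hsub.trans Ioo_subset_Icc_self)).pow (n - 1)
  have hg : ContinuousOn (gFun f) (Ioc 0 r) := fun t ht =>
    (h.hasDerivAt_gFun (hsub ht)).continuousAt.continuousWithinAt
  have hg' : ContinuousOn (deriv (gFun f)) (Ioc 0 r) := fun t ht =>
    (h.hasDerivAt_deriv_gFun (hsub ht)).continuousAt.continuousWithinAt
  have hid : ContinuousOn (fun t : ℝ => t) (Ioc 0 r) := continuousOn_id
  have hne : ∀ t ∈ Ioc 0 r, f t ^ (n - 1) ≠ 0 := fun t ht =>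
    pow_ne_zero _ (h.pos t (Ioo_subset_Ioc_self (hsub ht))).ne'
  exact (hid.mul ((hz'.pow 2).div hf hne)).add
    (hφ'.mul (((((continuousOn_const.mul (hid.mul hg)).mul hz').add
      (((continuousOn_const.mul hid).mul hf).mul hφ')).sub
      (((continuousOn_const.mul hf).mul ((hid.mul hg').add hg)).mul hφ')).sub hz'))

/-- The virial identity for a regular solution that vanishes at the end point. -/
theorem virial_identity (h : IsProfile f f₁ f₂ f₃ b) {n : ℕ} (hn : 2 ≤ n) {μ r : ℝ}
    {φ : ℝ → ℝ} (hr : r ∈ Ioo 0 b)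
    (hφ : IsRegularSolution (fun t => f t ^ (n - 1)) μ r φ) (h0 : φ r = 0) :
    r * ((μ * ∫ s in (0 : ℝ)..r, f s ^ (n - 1) * φ s) ^ 2 / f r ^ (n - 1)) =
      2 * μ * (∫ s in (0 : ℝ)..r, f s ^ (n - 1) * φ s ^ 2)
        - ((n : ℝ) - 1) / 2 * ∫ s in (0 : ℝ)..r, HFun n f s * (f s ^ (n - 1) * φ s ^ 2) := by
  have hb : 0 < b := hr.1.trans hr.2
  obtain ⟨C, hwb⟩ := h.exists_isAdmissibleWeight hb (m := n - 1) (by omega)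
  have hw := hwb.mono hr.2.le
  have hcm := hφ.continuousOn_mul hw
  have hsq : ContinuousOn (fun s => f s ^ (n - 1) * φ s ^ 2) (Icc 0 r) :=
    hw.continuousOn.mul (hφ.continuousOn.pow 2)
  set z : ℝ → ℝ := fun t => -(μ * ∫ s in (0 : ℝ)..t, f s ^ (n - 1) * φ s) with hz
  have hzc : ContinuousOn z (Icc 0 r) :=
    (continuousOn_const.mul (continuousOn_primitive_of_continuousOn_Icc hr.1.le hcm)).neg
  have i1 : IntervalIntegrable (fun s => f s ^ (n - 1) * φ s ^ 2) volume 0 r :=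
    intervalIntegrable_of_continuousOn_Icc hsq (left_mem_Icc.2 hr.1.le) (right_mem_Icc.2 hr.1.le)
  have i2 := h.intervalIntegrable_HFun_mul hb n hr hsq
  have hz0 : Tendsto z (𝓝[>] 0) (𝓝 0) := by
    simpa using (hφ.tendsto_flux_zero hw hr.1).neg
  have hw0 : Tendsto (fun t => f t ^ (n - 1)) (𝓝[>] 0) (𝓝 0) := by
    have h1 := hw.continuousOn 0 (left_mem_Icc.2 hr.1.le)
    rw [ContinuousWithinAt] at h1
    simp only [hw.zero] at h1
    exact h1.mono_left (nhdsWithin_le_of_mem (mem_of_superset (Ioo_mem_nhdsGT hr.1)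
      Ioo_subset_Icc_self))
  obtain ⟨B, hB⟩ := isCompact_Icc.exists_bound_of_continuousOn hφ.continuousOn
  have hB0 := (norm_nonneg _).trans (hB 0 (left_mem_Icc.2 hr.1.le))
  simp only [Real.norm_eq_abs] at hB
  obtain ⟨K, c, hK, hc, hKc⟩ := h.exists_bounds hb
  have hn1 : (0 : ℝ) ≤ (n : ℝ) - 1 := by
    have : (2 : ℝ) ≤ n := by exact_mod_cast hn
    linarith
  have hC : 0 ≤ C := by linarith [hw.one_le hr.1]
  have h0r := hr.1.le
  -- Although g behaves like 1/t, the combinations t g and t g' + g = t f₂/f + f₁ (f - t f₁)/f² stay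
  -- bounded, and z/w is bounded. Each term thus carries a factor z or w that tends to 0.
  have lim0 : Tendsto (virial n f μ φ z) (𝓝[>] 0) (𝓝 0) := by
    have hlim : Tendsto (fun t => (r * (|μ| * C * B * r)) * |z t|
        + B * (((n : ℝ) - 1) * (K / c) * |z t| + |μ| * r * f t ^ (n - 1) * B
          + ((n : ℝ) - 1) / 2 * f t ^ (n - 1) * (r * (K / c) + K * (K * r / c ^ 2)) * B + |z t|))
        (𝓝[>] 0) (𝓝 0) := by
      have hza : Tendsto (fun t => |z t|) (𝓝[>] 0) (𝓝 0) := by simpa using hz0.abs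
      have := (hza.const_mul (r * (|μ| * C * B * r))).add
        ((((((hza.const_mul (((n : ℝ) - 1) * (K / c))).add
        ((hw0.const_mul (|μ| * r)).mul_const B)).add
        (((hw0.const_mul (((n : ℝ) - 1) / 2)).mul_const
          (r * (K / c) + K * (K * r / c ^ 2))).mul_const B)).add hza)).const_mul B)
      simpa using this
    refine squeeze_zero_norm' ?_ hlim
    filter_upwards [Ioo_mem_nhdsGT hr.1] with t ht
    have htr : t ∈ Icc 0 r := Ioo_subset_Icc_self ht
    have htb : t ∈ Ioo 0 b := ⟨ht.1, ht.2.trans hr.2⟩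
    have ht0 := ht.1
    have hft := h.pos t (Ioo_subset_Ioc_self htb)
    have hwt : 0 < f t ^ (n - 1) := pow_pos hft _
    obtain ⟨k1, k2, -, k3, k4, k5, k6⟩ := hKc t (Ioo_subset_Icc_self htb)
    have e1 : |z t ^ 2 / f t ^ (n - 1)| ≤ (|μ| * C * B * r) * |z t| := by
      have := IsRegularSolution.abs_deriv_le (μ := μ) hw hB htr
      have h2 : |z t ^ 2 / f t ^ (n - 1)| = |z t / f t ^ (n - 1)| * |z t| := by
        rw [← abs_mul]; congr 1; ring
      rw [h2]
      have h3 : |z t / f t ^ (n - 1)| ≤ |μ| * C * B * r :=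
        this.trans (by have := ht.2.le; gcongr)
      gcongr
    have e2 : |t * gFun f t| ≤ K / c := by
      rw [h.gFun_eq htb, ← mul_div_assoc, abs_div, abs_of_pos hft, abs_mul, abs_of_pos ht0]
      calc t * |f₁ t| / f t ≤ t * K / (c * t) := by gcongr
        _ = K / c := by field_simp
    have e3 : |t * deriv (gFun f) t + gFun f t| ≤ r * (K / c) + K * (K * r / c ^ 2) := by
      have : t * deriv (gFun f) t + gFun f t
          = t * (f₂ t / f t) + f₁ t * ((f t - t * f₁ t) / f t ^ 2) := by
        rw [h.deriv_gFun_eq htb, h.gFun_eq htb]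
        field_simp
        ring
      rw [this]
      have a2 : |f₂ t / f t| ≤ K / c := by
        rw [abs_div, abs_of_pos hft]
        calc |f₂ t| / f t ≤ K * t / (c * t) := by gcongr
          _ = K / c := by field_simp
      have a3 : |(f t - t * f₁ t) / f t ^ 2| ≤ K * r / c ^ 2 := by
        rw [abs_div, abs_of_pos (pow_pos hft 2)]
        calc |f t - t * f₁ t| / f t ^ 2 ≤ K * t ^ 3 / (c * t) ^ 2 := by gcongr
          _ = K * t / c ^ 2 := by field_simp
          _ ≤ _ := by have := ht.2.le; gcongr
      refine (abs_add_le _ _).trans (add_le_add ?_ ?_)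
      · rw [abs_mul, abs_of_pos ht0]
        have := ht.2.le
        gcongr
      · rw [abs_mul]
        gcongr
    have e4 := hB t htr
    rw [Real.norm_eq_abs, virial]
    refine (abs_add_le _ _).trans (add_le_add ?_ ?_)
    · rw [abs_mul, abs_of_pos ht0, mul_assoc]
      have := ht.2.le
      gcongr
    · rw [abs_mul]
      refine mul_le_mul e4 ?_ (abs_nonneg _) hB0
      refine (abs_sub _ _).trans (add_le_add ?_ le_rfl)
      refine (abs_sub _ _).trans (add_le_add ((abs_add_le _ _).trans (add_le_add ?_ ?_)) ?_)
      · rw [abs_mul, abs_mul, abs_of_nonneg hn1]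
        gcongr
      · rw [abs_mul, abs_mul, abs_mul, abs_of_pos hwt, abs_of_pos ht0]
        have := ht.2.le
        gcongr
      · rw [abs_mul, abs_mul, abs_mul, abs_of_pos hwt, abs_of_nonneg (by positivity)]
        gcongr
  have limr : Tendsto (virial n f μ φ z) (𝓝[<] r) (𝓝 (virial n f μ φ z r)) :=
    (h.continuousOn_virial n hr.2 hφ.continuousOn hzc r (right_mem_Ioc.2 hr.1)).mono_left
      (nhdsWithin_le_of_mem (mem_of_superset (Ioo_mem_nhdsLT hr.1) Ioo_subset_Ioc_self))
  have key := intervalIntegral.integral_eq_sub_of_hasDerivAt_of_tendsto hr.1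
    (fun t ht => h.hasDerivAt_virial hn (μ := μ) (z := z) ⟨ht.1, ht.2.trans hr.2⟩
      (hφ.hasDerivAt t ht)
      ((hasDerivAt_primitive_of_continuousOn_Icc hcm ht).const_mul μ).neg)
    ((i1.const_mul (2 * μ)).sub (i2.const_mul (((n : ℝ) - 1) / 2))) lim0 limr
  rw [intervalIntegral.integral_sub (i1.const_mul _) (i2.const_mul _),
    intervalIntegral.integral_const_mul, intervalIntegral.integral_const_mul] at key
  rw [key, virial, h0]
  simp [hz]

/-- A radial eigenfunction is a multiple of a regular solution. -/
theorem isRegularSolution_of_isRadialEigenfunction (h : IsProfile f f₁ f₂ f₃ b) {n : ℕ}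
    (hn : 2 ≤ n) {μ r : ℝ} {ψ : ℝ → ℝ} (hr : r ∈ Ioc 0 b)
    (hψ : IsRadialEigenfunction n f r μ ψ) :
    ψ 0 ≠ 0 ∧ IsRegularSolution (fun t => f t ^ (n - 1)) μ r (fun t => ψ t / ψ 0) := by
  have hb : 0 < b := hr.1.trans_le hr.2
  obtain ⟨C, hwb⟩ := h.exists_isAdmissibleWeight hb (m := n - 1) (by omega)
  have hw := hwb.mono hr.2
  have hcm : ContinuousOn (fun s => f s ^ (n - 1) * ψ s) (Icc 0 r) :=
    hw.continuousOn.mul hψ.continuousOn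
  have hcp := continuousOn_primitive_of_continuousOn_Icc hr.1.le hcm
  set P : ℝ → ℝ := fun t => ∫ s in (0 : ℝ)..t, f s ^ (n - 1) * ψ s with hP
  have hderψ : ∀ t ∈ Ioo 0 r, HasDerivAt ψ (deriv ψ t) t := fun t ht =>
    ((hψ.differentiableOn t ht).differentiableAt (Ioo_mem_nhds ht.1 ht.2)).hasDerivAt
  set Z : ℝ → ℝ := fun t => f t ^ (n - 1) * deriv ψ t with hZ
  -- The equation says that flux plus μ times the mass has zero derivative; it remains to see that
  -- the constant is 0.
  have hconst : ∃ A, ∀ t ∈ Ioo 0 r, Z t + μ * P t = A := by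
    have hd : ∀ t ∈ Ioo 0 r, HasDerivAt (fun t => Z t + μ * P t) 0 t := by
      intro t ht
      have := (hψ.equation t ht).add
        ((hasDerivAt_primitive_of_continuousOn_Icc hcm ht).const_mul μ)
      exact this.congr_deriv (by ring)
    refine ⟨Z (r / 2) + μ * P (r / 2), fun t ht => ?_⟩
    have hmem : r / 2 ∈ Ioo 0 r := ⟨by linarith [hr.1], by linarith [hr.1]⟩
    exact isOpen_Ioo.is_const_of_deriv_eq_zero isPreconnected_Ioo
      (fun t ht => (hd t ht).differentiableAt.differentiableWithinAt)
      (fun t ht => (hd t ht).deriv) ht hmem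
  obtain ⟨A, hA⟩ := hconst
  have hξ : ∀ t ∈ Ioo 0 r, ∃ ξ ∈ Ioo 0 t, deriv ψ ξ = (ψ t - ψ 0) / (t - 0) := fun t ht =>
    exists_hasDerivAt_eq_slope ψ (deriv ψ) ht.1
      (hψ.continuousOn.mono (Icc_subset_Icc_right ht.2.le))
      (fun s hs => hderψ s ⟨hs.1, hs.2.trans ht.2⟩)
  -- The hypothesis gives only the one-sided derivative at 0, not a limit of ψ'. The constant is
  -- therefore evaluated along mean value points ξ t, where ψ' equals a difference quotient tending
  -- to 0.
  have hA0 : A = 0 := by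
    choose! ξ hξ1 hξ2 using hξ
    have hev : ∀ᶠ t in 𝓝[>] (0 : ℝ), t ∈ Ioo 0 r := Ioo_mem_nhdsGT hr.1
    have hid : Tendsto (fun t : ℝ => t) (𝓝[>] 0) (𝓝 0) := nhdsWithin_le_nhds
    have hξlim : Tendsto ξ (𝓝[>] 0) (𝓝 0) :=
      squeeze_zero' (hev.mono fun t ht => (hξ1 t ht).1.le)
        (hev.mono fun t ht => (hξ1 t ht).2.le) hid
    have hξin : Tendsto ξ (𝓝[>] 0) (𝓝[Icc 0 r] 0) :=
      tendsto_nhdsWithin_iff.2 ⟨hξlim, hev.mono fun t ht =>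
        ⟨(hξ1 t ht).1.le, ((hξ1 t ht).2.trans ht.2).le⟩⟩
    have hslope : Tendsto (fun t => (ψ t - ψ 0) / (t - 0)) (𝓝[>] 0) (𝓝 0) := by
      have := hψ.deriv_zero.Ioi_of_Ici
      rw [hasDerivWithinAt_iff_tendsto_slope' (by simp)] at this
      refine this.congr fun t => ?_
      rw [slope_def_field]
    have h0mem : (0 : ℝ) ∈ Icc 0 r := left_mem_Icc.2 hr.1.le
    have hwlim : Tendsto (fun t => f (ξ t) ^ (n - 1)) (𝓝[>] 0) (𝓝 0) := by
      have := (hw.continuousOn 0 h0mem).tendsto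
      rw [hw.zero] at this
      exact this.comp hξin
    have hPlim : Tendsto (fun t => P (ξ t)) (𝓝[>] 0) (𝓝 0) := by
      have := (hcp 0 h0mem).tendsto
      simp only [hP, intervalIntegral.integral_same] at this
      exact this.comp hξin
    have hlim := (hwlim.mul hslope).add (hPlim.const_mul μ)
    have hlim' : Tendsto (fun _ : ℝ => A) (𝓝[>] (0 : ℝ)) (𝓝 (0 * 0 + μ * 0)) := by
      refine hlim.congr' (hev.mono fun t ht => ?_)
      rw [← hξ2 t ht]
      exact hA (ξ t) ⟨(hξ1 t ht).1, (hξ1 t ht).2.trans ht.2⟩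
    simpa using tendsto_nhds_unique tendsto_const_nhds hlim'
  have hder : ∀ t ∈ Ioo 0 r, HasDerivAt ψ (-(μ * P t) / f t ^ (n - 1)) t := by
    intro t ht
    have hwt := (hw.pos t (Ioo_subset_Ioc_self ht)).ne'
    refine (hderψ t ht).congr_deriv ?_
    rw [eq_div_iff hwt]
    have := hA t ht
    rw [hA0] at this
    simp only [hZ] at this
    linarith
  -- If ψ 0 were 0, the Grönwall inequality with ε = 0 would make ψ vanish identically.
  have hψ0 : ψ 0 ≠ 0 := by
    intro h0
    have hC : 0 ≤ C := by linarith [hw.one_le hr.1]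
    have hz := abs_le_of_abs_deriv_le_integral (K := |μ| * C) (ε := 0) hr.1.le (by positivity)
      le_rfl hψ.continuousOn h0 hder (fun t ht => by
        have hwt := hw.pos t (Ioo_subset_Ioc_self ht)
        have htm := Ioo_subset_Icc_self ht
        have h0m : (0 : ℝ) ∈ Icc 0 r := left_mem_Icc.2 hr.1.le
        rw [add_zero, abs_div, abs_neg, abs_mul, abs_of_pos hwt, div_le_iff₀ hwt, mul_assoc,
          mul_assoc]
        refine mul_le_mul_of_nonneg_left ?_ (abs_nonneg μ)
        calc |P t| ≤ ∫ s in (0 : ℝ)..t, |f s ^ (n - 1) * ψ s| :=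
              intervalIntegral.abs_integral_le_integral_abs ht.1.le
          _ ≤ ∫ s in (0 : ℝ)..t, C * f t ^ (n - 1) * |ψ s| := by
              refine intervalIntegral.integral_mono_on ht.1.le
                (intervalIntegrable_of_continuousOn_Icc hcm h0m htm).abs
                (((intervalIntegrable_of_continuousOn_Icc hψ.continuousOn h0m htm).abs).const_mul
                  _) fun s hs => ?_
              rw [abs_mul, abs_of_nonneg (hw.nonneg ⟨hs.1, hs.2.trans ht.2.le⟩)]
              have := hw.le s t hs.1 hs.2 ht.2.le
              gcongr
          _ = _ := by rw [intervalIntegral.integral_const_mul]; ring)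
    obtain ⟨t, ht, hne⟩ := hψ.nontrivial
    have := hz t (Ioo_subset_Icc_self ht)
    simp only [zero_mul] at this
    exact hne (abs_nonpos_iff.1 this)
  refine ⟨hψ0, hψ.continuousOn.div_const _, div_self hψ0, fun t ht => ?_⟩
  refine ((hder t ht).div_const (ψ 0)).congr_deriv ?_
  simp only [← mul_div_assoc, intervalIntegral.integral_div]
  ring

end IsProfile


/-! ### The variational eigenvalue -/

/-- The Rayleigh quotients whose infimum is `firstEigenvalue`. -/
def rayleighQuotients (n : ℕ) (f : ℝ → ℝ) (r : ℝ) : Set ℝ :=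
  {q : ℝ | ∃ u : EuclideanSpace ℝ (Fin n) → ℝ,
    ContDiff ℝ ∞ u ∧ HasCompactSupport u ∧ tsupport u ⊆ Metric.ball 0 r ∧ u ≠ 0 ∧
    q = (∫ x in Metric.ball 0 r,
          polarMetric f x (polarGrad f u x) (polarGrad f u x) * polarDensity f x) /
        ∫ x in Metric.ball 0 r, u x ^ 2 * polarDensity f x}

theorem polarMetric_self_nonneg {n : ℕ} (f : ℝ → ℝ) (x v : EuclideanSpace ℝ (Fin n)) :
    0 ≤ polarMetric f x v v := by
  rw [polarMetric]
  split_ifs with hx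
  · exact real_inner_self_nonneg
  · have hn : 0 < ‖x‖ ^ 2 := by positivity
    have h1 : inner ℝ x v * inner ℝ x v ≤ ‖x‖ ^ 2 * inner ℝ v v := by
      have := real_inner_mul_inner_self_le x v
      rwa [real_inner_self_eq_norm_sq x] at this
    have h2 : inner ℝ x v * inner ℝ x v / ‖x‖ ^ 2 ≤ inner ℝ v v := by
      rw [div_le_iff₀ hn]
      linarith
    exact add_nonneg (div_nonneg (mul_self_nonneg _) hn.le)
      (mul_nonneg (sq_nonneg _) (sub_nonneg.2 h2))

theorem polarDensity_nonneg {n : ℕ} {f : ℝ → ℝ} {r : ℝ} (hf : ∀ t ∈ Ioo 0 r, 0 < f t)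
    {x : EuclideanSpace ℝ (Fin n)} (hx : x ∈ Metric.ball 0 r) : 0 ≤ polarDensity f x := by
  rw [polarDensity]
  split_ifs with h
  · exact zero_le_one
  · have h1 : 0 < ‖x‖ := norm_pos_iff.2 h
    exact pow_nonneg (div_nonneg (hf _ ⟨h1, mem_ball_zero_iff.1 hx⟩).le h1.le) _

theorem nonneg_of_mem_rayleighQuotients {n : ℕ} {f : ℝ → ℝ} {r : ℝ}
    (hf : ∀ t ∈ Ioo 0 r, 0 < f t) {q : ℝ} (hq : q ∈ rayleighQuotients n f r) : 0 ≤ q := by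
  obtain ⟨u, -, -, -, -, rfl⟩ := hq
  refine div_nonneg (setIntegral_nonneg measurableSet_ball fun x hx => ?_)
    (setIntegral_nonneg measurableSet_ball fun x hx => ?_)
  · exact mul_nonneg (polarMetric_self_nonneg f x _) (polarDensity_nonneg hf hx)
  · exact mul_nonneg (sq_nonneg _) (polarDensity_nonneg hf hx)

theorem bddBelow_rayleighQuotients {n : ℕ} {f : ℝ → ℝ} {r : ℝ}
    (hf : ∀ t ∈ Ioo 0 r, 0 < f t) : BddBelow (rayleighQuotients n f r) :=
  ⟨0, fun _ hq => nonneg_of_mem_rayleighQuotients hf hq⟩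

theorem firstEigenvalue_nonneg {n : ℕ} {f : ℝ → ℝ} {r : ℝ}
    (hf : ∀ t ∈ Ioo 0 r, 0 < f t) : 0 ≤ firstEigenvalue n f r :=
  Real.sInf_nonneg fun _ hq => nonneg_of_mem_rayleighQuotients hf hq

theorem rayleighQuotients_nonempty (n : ℕ) (f : ℝ → ℝ) {r : ℝ} (hr : 0 < r) :
    (rayleighQuotients n f r).Nonempty := by
  let u : ContDiffBump (0 : EuclideanSpace ℝ (Fin n)) :=
    ⟨r / 4, r / 2, by positivity, by linarith⟩
  refine ⟨_, u, u.contDiff, u.hasCompactSupport, ?_, ?_, rfl⟩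
  · rw [u.tsupport_eq]
    exact Metric.closedBall_subset_ball (by change r / 2 < r; linarith)
  · intro h
    have h1 : u 0 = 1 := u.one_of_mem_closedBall (Metric.mem_closedBall_self (by positivity))
    rw [h] at h1
    simp at h1

theorem polarMetric_polarGrad_self_eq_zero {n : ℕ} (f : ℝ → ℝ)
    {u : EuclideanSpace ℝ (Fin n) → ℝ} {x : EuclideanSpace ℝ (Fin n)} (hg : gradient u x = 0) :
    polarMetric f x (polarGrad f u x) (polarGrad f u x) = 0 := by
  have : polarGrad f u x = 0 := by simp [polarGrad, hg]
  simp [this, polarMetric]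

/-- The same test function serves on the larger ball: off its support both the function and its
gradient vanish, so neither integral changes. This is domain monotonicity. -/
theorem rayleighQuotients_subset (n : ℕ) (f : ℝ → ℝ) {s r : ℝ} (hsr : s ≤ r) :
    rayleighQuotients n f s ⊆ rayleighQuotients n f r := by
  rintro _ ⟨u, h1, h2, h3, h4, rfl⟩
  have hsub : Metric.ball (0 : EuclideanSpace ℝ (Fin n)) s ⊆ Metric.ball 0 r :=
    Metric.ball_subset_ball hsr
  refine ⟨u, h1, h2, h3.trans hsub, h4, ?_⟩
  congr 1
  · refine Eq.symm (setIntegral_eq_of_subset_of_forall_sdiff_eq_zero measurableSet_ball hsub fun x hx => ?_)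
    have hx' : x ∉ tsupport u := fun h => hx.2 (h3 h)
    have hev : u =ᶠ[𝓝 x] fun _ => 0 := notMem_tsupport_iff_eventuallyEq.1 hx'
    have hg : gradient u x = 0 := by rw [hev.gradient_eq]; simp
    rw [polarMetric_polarGrad_self_eq_zero f hg, zero_mul]
  · refine Eq.symm (setIntegral_eq_of_subset_of_forall_sdiff_eq_zero measurableSet_ball hsub fun x hx => ?_)
    rw [image_eq_zero_of_notMem_tsupport fun h => hx.2 (h3 h)]
    simp

theorem firstEigenvalue_anti {n : ℕ} {f : ℝ → ℝ} {s r : ℝ} (hs : 0 < s) (hsr : s ≤ r)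
    (hf : ∀ t ∈ Ioo 0 r, 0 < f t) : firstEigenvalue n f r ≤ firstEigenvalue n f s :=
  csInf_le_csInf (bddBelow_rayleighQuotients hf) (rayleighQuotients_nonempty n f hs)
    (rayleighQuotients_subset n f hsr)

/-- Polar coordinates. The dimensional constant, the area of the unit sphere, cancels in Rayleigh
quotients. -/
theorem setIntegral_ball_norm {n : ℕ} (hn : 2 ≤ n) (F : ℝ → ℝ) {r : ℝ} (hr : 0 ≤ r) :
    ∫ x in Metric.ball (0 : EuclideanSpace ℝ (Fin n)) r, F ‖x‖ =
      (n * volume.real (Metric.ball (0 : EuclideanSpace ℝ (Fin n)) 1)) *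
        ∫ t in (0 : ℝ)..r, t ^ (n - 1) * F t := by
  have : Nonempty (Fin n) := ⟨⟨0, by omega⟩⟩
  have : Nontrivial (EuclideanSpace ℝ (Fin n)) := inferInstance
  have h1 := integral_fun_norm_addHaar (volume : Measure (EuclideanSpace ℝ (Fin n)))
    ((Iio r).indicator F)
  rw [← integral_indicator measurableSet_ball]
  have h2 : (Metric.ball (0 : EuclideanSpace ℝ (Fin n)) r).indicator (fun x => F ‖x‖)
      = fun x => (Iio r).indicator F ‖x‖ := by
    ext x
    by_cases hx : ‖x‖ < r <;> simp [indicator, hx]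
  rw [h2, h1, finrank_euclideanSpace_fin, nsmul_eq_mul, smul_eq_mul, ← mul_assoc]
  congr 1
  have h3 : (fun y : ℝ => y ^ (n - 1) • (Iio r).indicator F y)
      = (Iio r).indicator fun y => y ^ (n - 1) * F y := by
    ext y
    by_cases hy : y < r <;> simp [indicator, hy]
  rw [h3, setIntegral_indicator measurableSet_Iio, Ioi_inter_Iio,
    intervalIntegral.integral_of_le hr, integral_Ioc_eq_integral_Ioo]

theorem hasGradientAt_radial {n : ℕ} {χ : ℝ → ℝ} {x : EuclideanSpace ℝ (Fin n)} (hx : x ≠ 0)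
    (hχ : DifferentiableAt ℝ χ ‖x‖) :
    HasGradientAt (fun y : EuclideanSpace ℝ (Fin n) => χ ‖y‖)
      ((deriv χ ‖x‖ / ‖x‖) • x) x := by
  have hn : 0 < ‖x‖ := norm_pos_iff.2 hx
  have h1 : HasFDerivAt (fun y : EuclideanSpace ℝ (Fin n) => ‖y‖)
      ((‖x‖⁻¹) • innerSL ℝ x) x := by
    have := (hasStrictFDerivAt_norm_sq x).hasFDerivAt.sqrt (by positivity)
    simp only [Real.sqrt_sq (norm_nonneg _)] at this
    refine this.congr_fderiv ?_
    ext v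
    simp
    field_simp
  have h2 := hχ.hasDerivAt.comp_hasFDerivAt x h1
  rw [hasGradientAt_iff_hasFDerivAt]
  refine h2.congr_fderiv ?_
  ext v
  simp
  ring

theorem polarMetric_polarGrad_radial {n : ℕ} (f : ℝ → ℝ) {χ : ℝ → ℝ}
    {x : EuclideanSpace ℝ (Fin n)} (hx : x ≠ 0) (hχ : DifferentiableAt ℝ χ ‖x‖) :
    polarMetric f x (polarGrad f (fun y => χ ‖y‖) x) (polarGrad f (fun y => χ ‖y‖) x) =
      deriv χ ‖x‖ ^ 2 := by
  have hn : ‖x‖ ≠ 0 := norm_ne_zero_iff.2 hx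
  have hg := (hasGradientAt_radial hx hχ).gradient
  have h1 : polarGrad f (fun y => χ ‖y‖) x = (deriv χ ‖x‖ / ‖x‖) • x := by
    have : inner ℝ x ((deriv χ ‖x‖ / ‖x‖) • x) / ‖x‖ ^ 2 = deriv χ ‖x‖ / ‖x‖ := by
      rw [inner_smul_right, real_inner_self_eq_norm_sq]
      field_simp
    rw [polarGrad, if_neg hx, hg, this]
    simp
  rw [h1, polarMetric, if_neg hx]
  simp only [inner_smul_left, inner_smul_right, real_inner_self_eq_norm_sq, conj_trivial]
  field_simp
  ring

/-- The variational inequality for radial test functions. -/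
theorem firstEigenvalue_mul_le_of_radial {n : ℕ} (hn : 2 ≤ n) {f χ : ℝ → ℝ} {a c r : ℝ}
    (hf : ∀ t ∈ Ioo 0 r, 0 < f t) (hr : 0 < r) (hχ : ContDiff ℝ ∞ χ) (ha : 0 < a)
    (hχa : ∀ t < a, χ t = χ 0) (hc : c < r) (hχc : ∀ t, c ≤ t → χ t = 0) :
    firstEigenvalue n f r * ∫ t in (0 : ℝ)..r, f t ^ (n - 1) * χ t ^ 2 ≤
      ∫ t in (0 : ℝ)..r, f t ^ (n - 1) * deriv χ t ^ 2 := by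
  have hpos : ∀ F : ℝ → ℝ, 0 ≤ ∫ t in (0 : ℝ)..r, f t ^ (n - 1) * F t ^ 2 := fun F => by
    rw [intervalIntegral.integral_of_le hr.le, integral_Ioc_eq_integral_Ioo]
    exact setIntegral_nonneg measurableSet_Ioo fun t ht =>
      mul_nonneg (pow_nonneg (hf t ht).le _) (sq_nonneg _)
  -- With zero mass there is no quotient, but the inequality is trivial.
  rcases (hpos χ).eq_or_lt with h0 | h0
  · rw [← h0, mul_zero]
    exact hpos _
  rw [← le_div_iff₀ h0]
  have : Nonempty (Fin n) := ⟨⟨0, by omega⟩⟩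
  have : Nontrivial (EuclideanSpace ℝ (Fin n)) := inferInstance
  set u : EuclideanSpace ℝ (Fin n) → ℝ := fun x => χ ‖x‖ with hu
  have hsupp : tsupport u ⊆ Metric.closedBall 0 c := by
    refine closure_minimal (fun x hx => ?_) Metric.isClosed_closedBall
    rw [mem_closedBall_zero_iff]
    by_contra! h
    exact hx (hχc _ h.le)
  -- Constancy of χ near 0 is what makes χ(‖x‖) smooth at the pole, where the norm is not.
  have hu0 : u =ᶠ[𝓝 0] fun _ => χ 0 := by
    filter_upwards [Metric.ball_mem_nhds 0 ha] with x hx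
    exact hχa _ (mem_ball_zero_iff.1 hx)
  have hmem : (∫ x in Metric.ball 0 r,
      polarMetric f x (polarGrad f u x) (polarGrad f u x) * polarDensity f x) /
        (∫ x in Metric.ball 0 r, u x ^ 2 * polarDensity f x) ∈ rayleighQuotients n f r := by
    refine ⟨u, ?_, ?_, hsupp.trans (Metric.closedBall_subset_ball hc), ?_, rfl⟩
    · rw [contDiff_iff_contDiffAt]
      intro x
      by_cases hx : x = 0
      · subst hx
        exact contDiffAt_const.congr_of_eventuallyEq hu0
      · exact hχ.contDiffAt.comp x (contDiffAt_norm ℝ hx)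
    · exact HasCompactSupport.of_support_subset_isCompact (isCompact_closedBall 0 c)
        ((subset_tsupport u).trans hsupp)
    · intro h
      refine h0.ne' ?_
      rw [intervalIntegral.integral_of_le hr.le]
      refine setIntegral_eq_zero_of_forall_eq_zero fun t ht => ?_
      obtain ⟨x, hx⟩ := exists_norm_eq (EuclideanSpace ℝ (Fin n)) ht.1.le
      have := congrFun h x
      simp only [hu, hx] at this
      simp [this]
  have hden : ∀ x : EuclideanSpace ℝ (Fin n), polarDensity f x =
      (fun t => if t = 0 then 1 else (f t / t) ^ (n - 1)) ‖x‖ := by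
    intro x
    by_cases hx : x = 0 <;> simp [polarDensity, hx]
  have hder0 : deriv χ 0 = 0 := by
    have : χ =ᶠ[𝓝 0] fun _ => χ 0 := by
      filter_upwards [Iio_mem_nhds ha] with t ht using hχa t ht
    rw [this.deriv_eq]
    simp
  have hnum : ∀ x : EuclideanSpace ℝ (Fin n),
      polarMetric f x (polarGrad f u x) (polarGrad f u x) = deriv χ ‖x‖ ^ 2 := by
    intro x
    by_cases hx : x = 0
    · subst hx
      rw [polarMetric_polarGrad_self_eq_zero, norm_zero, hder0]
      · simp
      · rw [hu0.gradient_eq]; simp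
    · exact polarMetric_polarGrad_radial f hx
        (hχ.differentiable (by simp)).differentiableAt
  have hint : ∀ F : ℝ → ℝ, ∫ x in Metric.ball (0 : EuclideanSpace ℝ (Fin n)) r,
      F ‖x‖ ^ 2 * polarDensity f x =
        (n * volume.real (Metric.ball (0 : EuclideanSpace ℝ (Fin n)) 1)) *
          ∫ t in (0 : ℝ)..r, f t ^ (n - 1) * F t ^ 2 := by
    intro F
    simp_rw [hden]
    rw [setIntegral_ball_norm hn
      (fun t => F t ^ 2 * (if t = 0 then 1 else (f t / t) ^ (n - 1))) hr.le]
    congr 1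
    rw [intervalIntegral.integral_of_le hr.le, intervalIntegral.integral_of_le hr.le]
    refine setIntegral_congr_fun measurableSet_Ioc fun t ht => ?_
    have ht0 : t ≠ 0 := ht.1.ne'
    simp only [ht0, if_false, div_pow]
    field_simp
  have hle := csInf_le (bddBelow_rayleighQuotients hf) hmem
  have hvol : (n * volume.real (Metric.ball (0 : EuclideanSpace ℝ (Fin n)) 1)) ≠ 0 := by
    refine mul_ne_zero (by norm_cast; omega) (ne_of_gt ?_)
    exact ENNReal.toReal_pos (Metric.measure_ball_pos volume _ one_pos).ne'
      measure_ball_lt_top.ne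
  simp_rw [hnum, hu] at hle
  rw [hint, hint, mul_div_mul_left _ _ hvol] at hle
  exact hle

/-- A continuous function on `[0, r]` is a bounded pointwise limit of smooth functions with
compact support in `(0, r)`. -/
theorem exists_seq_contDiff_tendsto {q : ℝ → ℝ} {r : ℝ} (hr : 0 < r)
    (hq : ContinuousOn q (Icc 0 r)) :
    ∃ (B : ℝ) (p : ℕ → ℝ → ℝ), (∀ k, ContDiff ℝ ∞ (p k)) ∧ (∀ k t, |p k t| ≤ B) ∧
      (∀ k, ∃ a > 0, ∀ t, t < a ∨ r - a < t → p k t = 0) ∧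
      ∀ t ∈ Ioo 0 r, Tendsto (fun k => p k t) atTop (𝓝 (q t)) := by
  obtain ⟨B, hB⟩ := isCompact_Icc.exists_bound_of_continuousOn hq
  have hB0 := (norm_nonneg _).trans (hB 0 (left_mem_Icc.2 hr.le))
  set qe : ℝ → ℝ := IccExtend hr.le ((Icc 0 r).domRestrict q) with hqe
  have hqc : Continuous qe := hq.domRestrict.Icc_extend' (h := hr.le)
  have hqB : ∀ t, |qe t| ≤ B := fun t => hB _ (projIcc 0 r hr.le t).2
  set d : ℝ → ℝ := fun t => min t (r - t) with hd
  -- With d the distance to the ends inside the interval, this cutoff is 0 where d ≤ 1/(k+1) and 1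
  -- where d ≥ 2/(k+1). The smooth approximation is taken with support inside that of the product,
  -- so it keeps the cutoff.
  set τ : ℕ → ℝ → ℝ := fun k t => min 1 (max 0 ((k + 1) * d t - 1)) with hτ
  have hdc : Continuous d := by fun_prop
  have hτc : ∀ k, Continuous (τ k) := fun k => by fun_prop
  have hτ0 : ∀ k t, 0 ≤ τ k t := fun k t => le_min zero_le_one (le_max_left _ _)
  have hτ1 : ∀ k t, τ k t ≤ 1 := fun k t => min_le_left _ _
  have key : ∀ k : ℕ, ∃ g : ℝ → ℝ, ContDiff ℝ ∞ g ∧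
      (∀ x, dist (g x) (τ k x * qe x) < 1 / ((k : ℝ) + 1)) ∧
      Function.support g ⊆ Function.support fun x => τ k x * qe x := fun k =>
    Continuous.exists_contDiff_approx (⊤ : ℕ∞) ((hτc k).mul hqc) continuous_const
      (fun _ => by positivity)
  choose p hp1 hp2 hp3 using key
  refine ⟨B + 1, p, hp1, fun k t => ?_, fun k => ?_, fun t ht => ?_⟩
  · have h1 := (hp2 k t).le
    rw [Real.dist_eq] at h1
    have h2 : |τ k t * qe t| ≤ 1 * B := by
      rw [abs_mul, abs_of_nonneg (hτ0 k t)]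
      exact mul_le_mul (hτ1 k t) (hqB t) (abs_nonneg _) zero_le_one
    have h3 : 1 / ((k : ℝ) + 1) ≤ 1 := by
      rw [div_le_one (by positivity)]
      have : (0 : ℝ) ≤ k := by positivity
      linarith
    have h4 := abs_sub_abs_le_abs_sub (p k t) (τ k t * qe t)
    linarith
  · refine ⟨1 / ((k : ℝ) + 1), by positivity, fun t ht => ?_⟩
    by_contra hne
    have h1 : τ k t * qe t ≠ 0 := hp3 k hne
    refine h1 ?_
    have h2 : d t ≤ 1 / ((k : ℝ) + 1) := by
      rcases ht with ht | ht
      · exact (min_le_left _ _).trans ht.le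
      · exact (min_le_right _ _).trans (by linarith)
    have h3 : ((k : ℝ) + 1) * d t - 1 ≤ 0 := by
      rw [le_div_iff₀ (by positivity)] at h2
      linarith
    simp [hτ, max_eq_left h3]
  · have hqt : qe t = q t := by
      simp [hqe, IccExtend_of_mem hr.le _ (Ioo_subset_Icc_self ht), domRestrict_apply]
    have hdt : 0 < d t := lt_min ht.1 (by linarith [ht.2])
    rw [← tendsto_sub_nhds_zero_iff]
    refine squeeze_zero_norm' ?_ tendsto_one_div_add_atTop_nhds_zero_nat
    obtain ⟨N, hN⟩ := exists_nat_gt (2 / d t)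
    filter_upwards [eventually_ge_atTop N] with k hk
    have h1 : 2 ≤ ((k : ℝ) + 1) * d t := by
      rw [div_lt_iff₀ hdt] at hN
      have : (N : ℝ) ≤ k := by exact_mod_cast hk
      nlinarith
    have h2 : τ k t = 1 := by
      simp only [hτ]
      rw [max_eq_right (by linarith), min_eq_left (by linarith)]
    have h3 := (hp2 k t).le
    rw [h2, one_mul, hqt, dist_eq_norm] at h3
    exact h3

/-- The first eigenvalue is at most the eigenvalue of any regular radial solution. -/
theorem firstEigenvalue_le_of_isRegularSolution {n : ℕ} (hn : 2 ≤ n) {f φ : ℝ → ℝ}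
    {C μ r : ℝ} (hr : 0 < r) (hf : ∀ t ∈ Ioo 0 r, 0 < f t)
    (hw : IsAdmissibleWeight (fun t => f t ^ (n - 1)) r C)
    (hφ : IsRegularSolution (fun t => f t ^ (n - 1)) μ r φ) (h0 : φ r = 0) :
    firstEigenvalue n f r ≤ μ := by
  set w : ℝ → ℝ := fun t => f t ^ (n - 1) with hwdef
  have hcm := hφ.continuousOn_mul hw
  set z : ℝ → ℝ := fun t => -(μ * ∫ s in (0 : ℝ)..t, w s * φ s) with hz
  have hzc : ContinuousOn z (Icc 0 r) :=
    (continuousOn_const.mul (continuousOn_primitive_of_continuousOn_Icc hr.le hcm)).neg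
  set q : ℝ → ℝ := fun t => z t / w t with hq
  obtain ⟨B, hB⟩ := isCompact_Icc.exists_bound_of_continuousOn hφ.continuousOn
  simp only [Real.norm_eq_abs] at hB
  have h0m : (0 : ℝ) ∈ Icc 0 r := left_mem_Icc.2 hr.le
  have hrm : r ∈ Icc 0 r := right_mem_Icc.2 hr.le
  have hq0 : q 0 = 0 := by simp [hq, hz]
  have hqc : ContinuousOn q (Icc 0 r) := by
    intro t ht
    rcases ht.1.eq_or_lt with rfl | ht0
    · rw [ContinuousWithinAt, hq0]
      have hlim : Tendsto (fun t : ℝ => |μ| * C * B * t) (𝓝[Icc 0 r] 0) (𝓝 0) := by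
        have : Continuous fun t : ℝ => |μ| * C * B * t := by fun_prop
        simpa using (this.tendsto 0).mono_left nhdsWithin_le_nhds
      refine squeeze_zero_norm' ?_ hlim
      filter_upwards [self_mem_nhdsWithin] with s hs
      exact IsRegularSolution.abs_deriv_le hw hB hs
    · exact (hzc t ht).div (hw.continuousOn t ht) (hw.pos t ⟨ht0, ht.2⟩).ne'
  obtain ⟨M, p, hp1, hp2, hp3, hp4⟩ := exists_seq_contDiff_tendsto hr hqc
  -- It is φ' that is approximated, and the result is integrated back from r: as p k vanishes near
  -- both ends, χ k is constant near 0 and zero near r, hence an admissible radial test function.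
  set χ : ℕ → ℝ → ℝ := fun k t => ∫ s in r..t, p k s with hχ
  have hχd : ∀ k t, HasDerivAt (χ k) (p k t) t := fun k t =>
    ((hp1 k).continuous.integral_hasStrictDerivAt r t).hasDerivAt
  have hχs : ∀ k, ContDiff ℝ ∞ (χ k) := fun k => by
    rw [contDiff_infty_iff_deriv]
    refine ⟨fun t => (hχd k t).differentiableAt, ?_⟩
    have : deriv (χ k) = p k := funext fun t => (hχd k t).deriv
    rw [this]
    exact hp1 k
  have hM : 0 ≤ M := (abs_nonneg _).trans (hp2 0 0)
  have hvar : ∀ k, firstEigenvalue n f r * ∫ t in (0 : ℝ)..r, w t * χ k t ^ 2 ≤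
      ∫ t in (0 : ℝ)..r, w t * p k t ^ 2 := by
    intro k
    obtain ⟨a, ha, hpa⟩ := hp3 k
    have h1 := firstEigenvalue_mul_le_of_radial hn (a := a) (c := r - a / 2) hf hr (hχs k) ha
      (fun t ht => by
        have : ∫ s in (0 : ℝ)..t, p k s = 0 := by
          refine intervalIntegral.integral_zero_ae (Eventually.of_forall fun s hs => ?_)
          refine hpa s (Or.inl ?_)
          rcases le_total 0 t with h | h
          · rw [uIoc_of_le h] at hs
            exact hs.2.trans_lt ht
          · rw [uIoc_of_ge h] at hs
            exact hs.2.trans_lt ha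
        have h2 := intervalIntegral.integral_add_adjacent_intervals
          ((hp1 k).continuous.intervalIntegrable (μ := volume) r 0)
          ((hp1 k).continuous.intervalIntegrable 0 t)
        rw [this, add_zero] at h2
        exact h2.symm)
      (by linarith)
      (fun t ht => by
        refine intervalIntegral.integral_zero_ae (Eventually.of_forall fun s hs => ?_)
        refine hpa s (Or.inr ?_)
        rcases le_total r t with h | h
        · rw [uIoc_of_le h] at hs
          linarith [hs.1]
        · rw [uIoc_of_ge h] at hs
          linarith [hs.1])
    have h2 : deriv (χ k) = p k := funext fun t => (hχd k t).deriv
    rw [h2] at h1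
    exact h1
  have hae : ∀ᵐ t ∂(volume : Measure ℝ), t ≠ r := by
    simp [ae_iff]
  have lim1 : Tendsto (fun k => ∫ t in (0 : ℝ)..r, w t * p k t ^ 2) atTop
      (𝓝 (∫ t in (0 : ℝ)..r, w t * q t ^ 2)) := by
    refine intervalIntegral.tendsto_integral_filter_of_dominated_convergence
      (fun t => w t * M ^ 2) (Eventually.of_forall fun k => ?_)
      (Eventually.of_forall fun k => Eventually.of_forall fun t ht => ?_)
      (intervalIntegrable_of_continuousOn_Icc (hw.continuousOn.mul continuousOn_const) h0m hrm) ?_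
    · rw [uIoc_of_le hr.le]
      exact ((hw.continuousOn.mono Ioc_subset_Icc_self).mul
        ((hp1 k).continuous.continuousOn.pow 2)).aestronglyMeasurable measurableSet_Ioc
    · rw [uIoc_of_le hr.le] at ht
      have hwt := hw.nonneg (Ioc_subset_Icc_self ht)
      rw [Real.norm_eq_abs, abs_mul, abs_of_nonneg hwt, abs_pow]
      have := hp2 k t
      gcongr
    · filter_upwards [hae] with t htr ht
      rw [uIoc_of_le hr.le] at ht
      exact ((hp4 t ⟨ht.1, lt_of_le_of_ne ht.2 htr⟩).pow 2).const_mul _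
  have hφq : ∀ t ∈ Icc 0 r, ∫ s in r..t, q s = φ t := by
    intro t ht
    have := intervalIntegral.integral_eq_sub_of_hasDerivAt_of_le (f := φ) (f' := q) ht.2
      (hφ.continuousOn.mono (Icc_subset_Icc_left ht.1))
      (fun s hs => hφ.hasDerivAt s ⟨ht.1.trans_lt hs.1, hs.2⟩)
      (intervalIntegrable_of_continuousOn_Icc hqc ht hrm)
    rw [intervalIntegral.integral_symm, this, h0]
    ring
  have limχ : ∀ t ∈ Icc 0 r, Tendsto (fun k => χ k t) atTop (𝓝 (φ t)) := by
    intro t ht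
    rw [← hφq t ht]
    refine intervalIntegral.tendsto_integral_filter_of_dominated_convergence
      (fun _ => M) (Eventually.of_forall fun k => (hp1 k).continuous.aestronglyMeasurable)
      (Eventually.of_forall fun k => Eventually.of_forall fun s _ => hp2 k s)
      intervalIntegrable_const ?_
    filter_upwards [hae] with s hsr hs
    rw [uIoc_of_ge ht.2] at hs
    exact hp4 s ⟨ht.1.trans_lt hs.1, lt_of_le_of_ne hs.2 hsr⟩
  have hχB : ∀ k, ∀ t ∈ Icc 0 r, |χ k t| ≤ M * r := by
    intro k t ht
    have := intervalIntegral.norm_integral_le_of_norm_le_const (a := r) (b := t) (f := p k)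
      (C := M) (fun s _ => hp2 k s)
    refine this.trans ?_
    gcongr
    rw [abs_sub_comm, abs_of_nonneg (by linarith [ht.2])]
    linarith [ht.1]
  have lim2 : Tendsto (fun k => ∫ t in (0 : ℝ)..r, w t * χ k t ^ 2) atTop
      (𝓝 (∫ t in (0 : ℝ)..r, w t * φ t ^ 2)) := by
    refine intervalIntegral.tendsto_integral_filter_of_dominated_convergence
      (fun t => w t * (M * r) ^ 2) (Eventually.of_forall fun k => ?_)
      (Eventually.of_forall fun k => Eventually.of_forall fun t ht => ?_)
      (intervalIntegrable_of_continuousOn_Icc (hw.continuousOn.mul continuousOn_const) h0m hrm)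
      (Eventually.of_forall fun t ht => ?_)
    · rw [uIoc_of_le hr.le]
      exact ((hw.continuousOn.mono Ioc_subset_Icc_self).mul
        ((hχs k).continuous.continuousOn.pow 2)).aestronglyMeasurable measurableSet_Ioc
    · rw [uIoc_of_le hr.le] at ht
      have hwt := hw.nonneg (Ioc_subset_Icc_self ht)
      rw [Real.norm_eq_abs, abs_mul, abs_of_nonneg hwt, abs_pow]
      have := hχB k t (Ioc_subset_Icc_self ht)
      gcongr
    · rw [uIoc_of_le hr.le] at ht
      exact ((limχ t (Ioc_subset_Icc_self ht)).pow 2).const_mul _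
  have hle := le_of_tendsto_of_tendsto' (lim2.const_mul (firstEigenvalue n f r)) lim1 hvar
  have hsq : ContinuousOn (fun t => w t * φ t ^ 2) (Icc 0 r) :=
    hw.continuousOn.mul (hφ.continuousOn.pow 2)
  have i1 := intervalIntegrable_of_continuousOn_Icc hsq h0m hrm
  have i2 : IntervalIntegrable (fun t => w t * q t ^ 2) volume 0 r :=
    intervalIntegrable_of_continuousOn_Icc (hw.continuousOn.mul (hqc.pow 2)) h0m hrm
  -- Integration by parts: z φ vanishes at both ends, so the Rayleigh quotient of φ is exactly μ.
  have hparts := intervalIntegral.integral_eq_sub_of_hasDerivAt_of_le (f := fun t => z t * φ t)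
    (f' := fun t => w t * q t ^ 2 - μ * (w t * φ t ^ 2)) hr.le (hzc.mul hφ.continuousOn)
    (fun t ht => by
      refine (((hasDerivAt_primitive_of_continuousOn_Icc hcm ht).const_mul μ).neg.mul
        (hφ.hasDerivAt t ht)).congr_deriv ?_
      have hwt := (hw.pos t (Ioo_subset_Ioc_self ht)).ne'
      simp only [hq, hz, Pi.neg_apply]
      field_simp
      ring) (i2.sub (i1.const_mul μ))
  rw [intervalIntegral.integral_sub i2 (i1.const_mul μ), intervalIntegral.integral_const_mul,
    h0] at hparts
  have hz0 : z 0 = 0 := by simp [hz]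
  rw [hz0] at hparts
  have hN : 0 < ∫ t in (0 : ℝ)..r, w t * φ t ^ 2 := by
    refine intervalIntegral.integral_pos hr hsq
      (fun t ht => mul_nonneg (hw.nonneg (Ioc_subset_Icc_self ht)) (sq_nonneg _)) ?_
    have hev : ∀ᶠ x in 𝓝[Icc 0 r] (0 : ℝ), 0 < φ x :=
      (hφ.continuousOn 0 h0m).eventually (lt_mem_nhds (hφ.zero ▸ one_pos))
    obtain ⟨ε, hε, hεs⟩ := Metric.mem_nhdsWithin_iff.1 hev
    have hx0 : 0 < min (ε / 2) r := lt_min (by positivity) hr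
    have hxr : min (ε / 2) r ≤ r := min_le_right _ _
    refine ⟨min (ε / 2) r, ⟨hx0.le, hxr⟩, mul_pos (hw.pos _ ⟨hx0, hxr⟩) (pow_pos
      (hεs ⟨?_, hx0.le, hxr⟩) 2)⟩
    rw [Metric.mem_ball, Real.dist_eq, sub_zero, abs_of_pos hx0]
    have := min_le_left (ε / 2) r
    linarith
  refine le_of_mul_le_mul_right ?_ hN
  linarith


/-! ### Differentiability of the eigenvalue -/

/-- A family of eigenvalues `Λ r` and regular solutions `φ r` vanishing at `r`, where `Λ` is
antitone and `Λ r` is minimal among the eigenvalues of the Dirichlet problem on `[0, r]`. -/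
structure IsDirichletFamily (w : ℝ → ℝ) (b C : ℝ) (Λ : ℝ → ℝ) (φ : ℝ → ℝ → ℝ) : Prop where
  weight : IsAdmissibleWeight w b C
  sol : ∀ r ∈ Ioc 0 b, IsRegularSolution w (Λ r) r (φ r)
  boundary : ∀ r ∈ Ioc 0 b, φ r r = 0
  nonneg : ∀ r ∈ Ioc 0 b, 0 ≤ Λ r
  anti : AntitoneOn Λ (Ioc 0 b)
  le_of_sol : ∀ r ∈ Ioc 0 b, ∀ μ χ, IsRegularSolution w μ r χ → χ r = 0 → Λ r ≤ μ

theorem integral_indicator_Ioc_of_le (F : ℝ → ℝ) {a b : ℝ} (ha : 0 ≤ a) (hab : a ≤ b) :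
    ∫ t in (0 : ℝ)..b, (Ioc 0 a).indicator F t = ∫ t in (0 : ℝ)..a, F t := by
  rw [intervalIntegral.integral_of_le (ha.trans hab), intervalIntegral.integral_of_le ha,
    setIntegral_indicator measurableSet_Ioc, Ioc_inter_Ioc, sup_idem, inf_eq_right.2 hab]

theorem aestronglyMeasurable_indicator_of_continuousOn {F : ℝ → ℝ} {a : ℝ} {s : Set ℝ}
    (hF : ContinuousOn F (Icc 0 a)) :
    AEStronglyMeasurable ((Ioc 0 a).indicator F) (volume.restrict s) := by
  refine AEStronglyMeasurable.restrict ?_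
  rw [aestronglyMeasurable_indicator_iff measurableSet_Ioc]
  exact (hF.mono Ioc_subset_Icc_self).aestronglyMeasurable measurableSet_Ioc

namespace IsDirichletFamily

variable {w Λ : ℝ → ℝ} {φ : ℝ → ℝ → ℝ} {b C : ℝ}

/-- Let t₀ be the first zero of φ r. Minimality at t₀ gives Λ t₀ ≤ Λ r, and antitonicity then makes
Λ constant on [t₀, r]. For each t there, uniqueness identifies φ t with φ r on [0, t], so φ r t = φ
t t = 0: no sign change can follow t₀. -/
theorem nonneg_sol (h : IsDirichletFamily w b C Λ φ) {r : ℝ} (hr : r ∈ Ioc 0 b) :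
    ∀ t ∈ Icc 0 r, 0 ≤ φ r t := by
  have hs := h.sol r hr
  have hwr := h.weight.mono hr.2
  have h0r : (0 : ℝ) ∈ Icc 0 r := left_mem_Icc.2 hr.1.le
  have hcl : IsCompact {t ∈ Icc 0 r | φ r t = 0} := by
    have : IsClosed (Icc 0 r ∩ φ r ⁻¹' {0}) :=
      hs.continuousOn.preimage_isClosed_of_isClosed isClosed_Icc isClosed_singleton
    exact isCompact_Icc.of_isClosed_subset this inter_subset_left
  obtain ⟨t₀, ⟨ht₀, hφt₀⟩, hleast⟩ := hcl.exists_isLeast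
    ⟨r, right_mem_Icc.2 hr.1.le, h.boundary r hr⟩
  have ht₀0 : 0 < t₀ := by
    refine lt_of_le_of_ne ht₀.1 fun he => ?_
    rw [← he, hs.zero] at hφt₀
    exact one_ne_zero hφt₀
  have hbefore : ∀ t ∈ Icc 0 t₀, 0 ≤ φ r t := by
    intro t ht
    by_contra! hneg
    have hsub : Icc 0 t ⊆ Icc 0 r := Icc_subset_Icc_right (ht.2.trans ht₀.2)
    have := intermediate_value_Icc' ht.1 (hs.continuousOn.mono hsub)
    obtain ⟨s, hs1, hs2⟩ := this (show (0 : ℝ) ∈ Icc (φ r t) (φ r 0) from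
      ⟨hneg.le, hs.zero ▸ zero_le_one⟩)
    have h1 : t₀ ≤ s := hleast ⟨hsub hs1, hs2⟩
    have h2 : t = t₀ := le_antisymm ht.2 (h1.trans hs1.2)
    rw [h2, hφt₀] at hneg
    exact lt_irrefl _ hneg
  have ht₀b : t₀ ∈ Ioc 0 b := ⟨ht₀0, ht₀.2.trans hr.2⟩
  have hle : Λ t₀ ≤ Λ r := h.le_of_sol t₀ ht₀b (Λ r) (φ r) (hs.mono ht₀.2) hφt₀
  intro t ht
  rcases le_total t t₀ with htt | htt
  · exact hbefore t ⟨ht.1, htt⟩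
  · have htb : t ∈ Ioc 0 b := ⟨ht₀0.trans_le htt, ht.2.trans hr.2⟩
    have heq : Λ t = Λ r := le_antisymm ((h.anti ht₀b htb htt).trans hle)
      (h.anti htb hr ht.2)
    have hst := h.sol t htb
    rw [heq] at hst
    have := hst.eqOn ht.1 (h.weight.mono htb.2) (hs.mono ht.2) (right_mem_Icc.2 ht.1)
    rw [← this, h.boundary t htb]

theorem le_one (h : IsDirichletFamily w b C Λ φ) {r : ℝ} (hr : r ∈ Ioc 0 b) {t : ℝ}
    (ht : t ∈ Icc 0 r) : φ r t ≤ 1 :=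
  (h.sol r hr).le_one (h.weight.mono hr.2) (h.nonneg r hr) (h.nonneg_sol hr) ht

theorem abs_le_one (h : IsDirichletFamily w b C Λ φ) {r : ℝ} (hr : r ∈ Ioc 0 b) :
    ∀ t ∈ Icc 0 r, |φ r t| ≤ 1 := fun t ht => by
  rw [abs_of_nonneg (h.nonneg_sol hr t ht)]
  exact h.le_one hr ht

theorem wronskian (h : IsDirichletFamily w b C Λ φ) {s t : ℝ} (hs : s ∈ Ioc 0 b)
    (ht : t ∈ Ioc 0 b) (hst : s ≤ t) :
    -(Λ s * ∫ x in (0 : ℝ)..s, w x * φ s x) * φ t s =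
      (Λ t - Λ s) * ∫ x in (0 : ℝ)..s, w x * φ s x * φ t x :=
  (h.sol s hs).wronskian hs.1.le (h.weight.mono hs.2) ((h.sol t ht).mono hst) (h.boundary s hs)

/-- In the Wronskian identity for s ≤ t the right side is (Λ t - Λ s) times an overlap integral, and
the left side contains φ t s = O(t - s), because φ t vanishes at t. The overlap is bounded below
since all the solutions exceed 1/2 on a common interval [0, δ]; the constants are uniform for radii
in [r, b]. -/
theorem lipschitz (h : IsDirichletFamily w b C Λ φ) {r : ℝ} (hr : r ∈ Ioc 0 b) :
    ∃ L, ∀ s t, r ≤ s → s ≤ t → t ≤ b → |Λ t - Λ s| ≤ L * (t - s) := by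
  have hb : 0 < b := hr.1.trans_le hr.2
  have hC : 0 ≤ C := by linarith [h.weight.one_le hb]
  have hM : 0 ≤ Λ r := h.nonneg r hr
  set K := Λ r * C * 1 * b with hK
  have hK0 : 0 ≤ K := by positivity
  -- K is a common Lipschitz constant, so a solution starting from 1 loses at most K δ ≤ 1/2 on [0,
  -- δ].
  set δ := min r (1 / (2 * (K + 1))) with hδ
  have hδ0 : 0 < δ := lt_min hr.1 (by positivity)
  have hδr : δ ≤ r := min_le_left _ _
  have hδK : K * δ ≤ 1 / 2 := by
    have h1 : δ ≤ 1 / (2 * (K + 1)) := min_le_right _ _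
    calc K * δ ≤ (K + 1) * (1 / (2 * (K + 1))) := by gcongr; linarith
      _ = 1 / 2 := by field_simp
  have hWδ := (h.weight.mono (hδr.trans hr.2)).integral_pos hδ0
  have hlip : ∀ s, r ≤ s → s ≤ b → ∀ x y, 0 ≤ x → x ≤ y → y ≤ s →
      |φ s y - φ s x| ≤ K * (y - x) := by
    intro s hrs hsb x y hx hxy hys
    have hs : s ∈ Ioc 0 b := ⟨hr.1.trans_le hrs, hsb⟩
    have hsol := h.sol s hs
    refine abs_sub_le_of_hasDerivAt hxy (hsol.continuousOn.mono (Icc_subset_Icc hx hys))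
      (fun t ht => hsol.hasDerivAt t ⟨hx.trans_lt ht.1, ht.2.trans_le hys⟩) fun t ht => ?_
    have htm : t ∈ Icc 0 s := ⟨hx.trans ht.1.le, ht.2.le.trans hys⟩
    refine (IsRegularSolution.abs_deriv_le (h.weight.mono hsb) (h.abs_le_one hs) htm).trans ?_
    rw [abs_of_nonneg (h.nonneg s hs)]
    have h1 : Λ s ≤ Λ r := h.anti hr hs hrs
    have h2 : t ≤ b := htm.2.trans hsb
    have h3 := htm.1
    rw [hK]
    gcongr
  have hhalf : ∀ s, r ≤ s → s ≤ b → ∀ x ∈ Icc 0 δ, 1 / 2 ≤ φ s x := by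
    intro s hrs hsb x hx
    have hsol := h.sol s ⟨hr.1.trans_le hrs, hsb⟩
    have h1 := hlip s hrs hsb 0 x le_rfl hx.1 (hx.2.trans (hδr.trans hrs))
    rw [hsol.zero, sub_zero] at h1
    have h2 := (abs_le.1 h1).1
    have h3 : K * x ≤ K * δ := by gcongr; exact hx.2
    linarith
  refine ⟨Λ r * (∫ x in (0 : ℝ)..b, w x) * K / (1 / 4 * ∫ x in (0 : ℝ)..δ, w x),
    fun s t hrs hst htb => ?_⟩
  have hs : s ∈ Ioc 0 b := ⟨hr.1.trans_le hrs, hst.trans htb⟩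
  have ht : t ∈ Ioc 0 b := ⟨hs.1.trans_le hst, htb⟩
  have h0s : (0 : ℝ) ∈ Icc 0 s := left_mem_Icc.2 hs.1.le
  have hδs : δ ∈ Icc 0 s := ⟨hδ0.le, hδr.trans hrs⟩
  have hss : s ∈ Icc 0 s := right_mem_Icc.2 hs.1.le
  have hws := h.weight.mono hs.2
  have hcs := (h.sol s hs).continuousOn_mul hws
  have hct : ContinuousOn (φ t) (Icc 0 s) :=
    (h.sol t ht).continuousOn.mono (Icc_subset_Icc_right hst)
  have hwron := h.wronskian hs ht hst
  have hprod : ContinuousOn (fun x => w x * φ s x * φ t x) (Icc 0 s) := hcs.mul hct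
  have hWb := (h.weight.integral_pos hb).le
  have hI : 1 / 4 * (∫ x in (0 : ℝ)..δ, w x) ≤ ∫ x in (0 : ℝ)..s, w x * φ s x * φ t x := by
    rw [← intervalIntegral.integral_add_adjacent_intervals
      (intervalIntegrable_of_continuousOn_Icc hprod h0s hδs)
      (intervalIntegrable_of_continuousOn_Icc hprod hδs hss),
      ← intervalIntegral.integral_const_mul]
    refine le_add_of_le_of_nonneg ?_ ?_
    · refine intervalIntegral.integral_mono_on hδ0.le
        ((intervalIntegrable_of_continuousOn_Icc hws.continuousOn h0s hδs).const_mul _)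
        (intervalIntegrable_of_continuousOn_Icc hprod h0s hδs) fun x hx => ?_
      have h1 := hhalf s hrs hs.2 x hx
      have h2 := hhalf t (hrs.trans hst) htb x hx
      have h3 := hws.nonneg ⟨hx.1, hx.2.trans hδs.2⟩
      have h4 : 1 / 2 * (1 / 2) ≤ φ s x * φ t x := by gcongr
      calc 1 / 4 * w x = w x * (1 / 2 * (1 / 2)) := by ring
        _ ≤ w x * (φ s x * φ t x) := by gcongr
        _ = _ := by ring
    · refine intervalIntegral.integral_nonneg hδs.2 fun x hx => ?_
      have hx' : x ∈ Icc 0 s := ⟨hδ0.le.trans hx.1, hx.2⟩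
      exact mul_nonneg (mul_nonneg (hws.nonneg hx') (h.nonneg_sol hs x hx'))
        (h.nonneg_sol ht x ⟨hx'.1, hx'.2.trans hst⟩)
  have hA : |∫ x in (0 : ℝ)..s, w x * φ s x| ≤ ∫ x in (0 : ℝ)..b, w x := by
    rw [abs_of_nonneg (IsRegularSolution.integral_nonneg hws (h.nonneg_sol hs) hss)]
    have hw0b : IntervalIntegrable w volume 0 s :=
      intervalIntegrable_of_continuousOn_Icc hws.continuousOn h0s hss
    have hwsb : IntervalIntegrable w volume s b :=
      intervalIntegrable_of_continuousOn_Icc h.weight.continuousOn ⟨hs.1.le, hs.2⟩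
        (right_mem_Icc.2 hb.le)
    rw [← intervalIntegral.integral_add_adjacent_intervals hw0b hwsb]
    refine le_add_of_le_of_nonneg ?_ ?_
    · refine intervalIntegral.integral_mono_on hs.1.le
        (intervalIntegrable_of_continuousOn_Icc hcs h0s hss) hw0b fun x hx => ?_
      exact mul_le_of_le_one_right (hws.nonneg hx) (h.le_one hs hx)
    · exact intervalIntegral.integral_nonneg hs.2 fun x hx =>
        h.weight.nonneg ⟨hs.1.le.trans hx.1, hx.2⟩
  have hφ : |φ t s| ≤ K * (t - s) := by
    have := hlip t (hrs.trans hst) htb s t hs.1.le hst le_rfl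
    rwa [h.boundary t ht, zero_sub, abs_neg] at this
  have hΛs : |Λ s| ≤ Λ r := by
    rw [abs_of_nonneg (h.nonneg s hs)]
    exact h.anti hr hs hrs
  have hpos : 0 < 1 / 4 * ∫ x in (0 : ℝ)..δ, w x := by positivity
  rw [div_mul_eq_mul_div, le_div_iff₀ hpos]
  calc |Λ t - Λ s| * (1 / 4 * ∫ x in (0 : ℝ)..δ, w x)
      ≤ |Λ t - Λ s| * ∫ x in (0 : ℝ)..s, w x * φ s x * φ t x := by gcongr
    _ = |(Λ t - Λ s) * ∫ x in (0 : ℝ)..s, w x * φ s x * φ t x| := by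
        rw [abs_mul, abs_of_nonneg (hpos.le.trans hI)]
    _ = |Λ s| * |∫ x in (0 : ℝ)..s, w x * φ s x| * |φ t s| := by
        rw [← hwron, abs_mul, abs_neg, abs_mul]
    _ ≤ Λ r * (∫ x in (0 : ℝ)..b, w x) * (K * (t - s)) := by gcongr
    _ = _ := by ring

theorem continuousAt (h : IsDirichletFamily w b C Λ φ) {r : ℝ} (hr : r ∈ Ioo 0 b) :
    ContinuousAt Λ r := by
  obtain ⟨L, hL⟩ := h.lipschitz (r := r / 2) ⟨by linarith [hr.1], by linarith [hr.1, hr.2]⟩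
  rw [ContinuousAt, ← tendsto_sub_nhds_zero_iff]
  have hlim : Tendsto (fun s : ℝ => L * |s - r|) (𝓝 r) (𝓝 0) := by
    have : Continuous fun s : ℝ => L * |s - r| := by fun_prop
    simpa using this.tendsto r
  refine squeeze_zero_norm' ?_ hlim
  filter_upwards [Ioo_mem_nhds (show r / 2 < r by linarith [hr.1]) hr.2] with s hs
  rw [Real.norm_eq_abs]
  rcases le_total s r with hsr | hsr
  · have := hL s r hs.1.le hsr hr.2.le
    rwa [abs_sub_comm, abs_sub_comm s r, abs_of_nonneg (sub_nonneg.2 hsr)]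
  · have := hL r s (by linarith [hr.1]) hsr hs.2.le
    rwa [abs_of_nonneg (sub_nonneg.2 hsr)]

/-- Extension by zero puts the solutions for varying radii on one domain. Below r this is continuous
dependence on the eigenvalue; above r both sides are eventually 0. The excluded point t = r is a
null set. -/
theorem tendsto_indicator (h : IsDirichletFamily w b C Λ φ) {r : ℝ} (hr : r ∈ Ioo 0 b) {t : ℝ}
    (ht0 : 0 < t) (htr : t ≠ r) :
    Tendsto (fun s => (Ioc 0 s).indicator (φ s) t) (𝓝 r) (𝓝 ((Ioc 0 r).indicator (φ r) t)) := by
  rcases lt_or_gt_of_ne htr with htr | htr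
  · have e1 : (Ioc 0 r).indicator (φ r) t = φ r t := indicator_of_mem (show t ∈ Ioc 0 r from ⟨ht0, htr.le⟩) _
    rw [e1, ← tendsto_sub_nhds_zero_iff]
    have hlim : Tendsto (fun s => |Λ r - Λ s| * C * 1 * t * t * Real.exp (|Λ r| * C * t ^ 2))
        (𝓝 r) (𝓝 0) := by
      have h1 : Tendsto (fun s => |Λ r - Λ s|) (𝓝 r) (𝓝 |Λ r - Λ r|) :=
        ((h.continuousAt hr).tendsto.const_sub (Λ r)).abs
      rw [sub_self, abs_zero] at h1
      have h2 := h1.mul_const (C * 1 * t * t * Real.exp (|Λ r| * C * t ^ 2))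
      rw [zero_mul] at h2
      exact h2.congr fun s => by ring
    refine squeeze_zero_norm' ?_ hlim
    filter_upwards [Ioo_mem_nhds htr hr.2] with s hs
    have hsb : s ∈ Ioc 0 b := ⟨ht0.trans hs.1, hs.2.le⟩
    have e2 : (Ioc 0 s).indicator (φ s) t = φ s t := indicator_of_mem (show t ∈ Ioc 0 s from ⟨ht0, hs.1.le⟩) _
    rw [e2, Real.norm_eq_abs, abs_sub_comm]
    exact IsRegularSolution.abs_sub_le_of_same_weight ht0.le (h.weight.mono (hs.1.le.trans hsb.2))
      ((h.sol r ⟨hr.1, hr.2.le⟩).mono htr.le) ((h.sol s hsb).mono hs.1.le)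
      (fun x hx => h.abs_le_one hsb x ⟨hx.1, hx.2.trans hs.1.le⟩) t (right_mem_Icc.2 ht0.le)
  · have e1 : (Ioc 0 r).indicator (φ r) t = 0 := indicator_of_notMem (show t ∉ Ioc 0 r from fun hm => hm.2.not_gt htr) _
    rw [e1]
    refine tendsto_const_nhds.congr' ?_
    filter_upwards [Iio_mem_nhds htr] with s hs
    exact (indicator_of_notMem (show t ∉ Ioc 0 s from fun hm => hm.2.not_gt hs) _).symm

theorem abs_indicator_le (h : IsDirichletFamily w b C Λ φ) {s : ℝ} (hs : s ∈ Ioc 0 b) (t : ℝ) :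
    |(Ioc 0 s).indicator (φ s) t| ≤ 1 := by
  by_cases ht : t ∈ Ioc 0 s
  · rw [indicator_of_mem ht]
    exact h.abs_le_one hs t (Ioc_subset_Icc_self ht)
  · rw [indicator_of_notMem ht]
    simp

theorem tendsto_integral (h : IsDirichletFamily w b C Λ φ) {r : ℝ} (hr : r ∈ Ioo 0 b) :
    Tendsto (fun s => ∫ x in (0 : ℝ)..s, w x * φ s x) (𝓝 r)
      (𝓝 (∫ x in (0 : ℝ)..r, w x * φ r x)) := by
  have hb : 0 < b := hr.1.trans hr.2
  have key : Tendsto (fun s => ∫ x in (0 : ℝ)..b, w x * (Ioc 0 s).indicator (φ s) x) (𝓝 r)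
      (𝓝 (∫ x in (0 : ℝ)..b, w x * (Ioc 0 r).indicator (φ r) x)) := by
    refine intervalIntegral.tendsto_integral_filter_of_dominated_convergence w ?_ ?_
      (intervalIntegrable_of_continuousOn_Icc h.weight.continuousOn (left_mem_Icc.2 hb.le)
        (right_mem_Icc.2 hb.le)) ?_
    · filter_upwards [Ioo_mem_nhds hr.1 hr.2] with s hs
      rw [uIoc_of_le hb.le]
      exact ((h.weight.continuousOn.mono Ioc_subset_Icc_self).aestronglyMeasurable
        measurableSet_Ioc).mul (aestronglyMeasurable_indicator_of_continuousOn
          (h.sol s (Ioo_subset_Ioc_self hs)).continuousOn)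
    · filter_upwards [Ioo_mem_nhds hr.1 hr.2] with s hs
      refine Eventually.of_forall fun x hx => ?_
      rw [uIoc_of_le hb.le] at hx
      have hwx := h.weight.nonneg (Ioc_subset_Icc_self hx)
      rw [Real.norm_eq_abs, abs_mul, abs_of_nonneg hwx]
      exact mul_le_of_le_one_right hwx (h.abs_indicator_le (Ioo_subset_Ioc_self hs) x)
    · have hae : ∀ᵐ t ∂(volume : Measure ℝ), t ≠ r := by simp [ae_iff]
      filter_upwards [hae] with x hxr hx
      rw [uIoc_of_le hb.le] at hx
      exact (h.tendsto_indicator hr hx.1 hxr).const_mul _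
  have heq : ∀ s ∈ Ioo 0 b, ∫ x in (0 : ℝ)..b, w x * (Ioc 0 s).indicator (φ s) x
      = ∫ x in (0 : ℝ)..s, w x * φ s x := by
    intro s hs
    rw [← integral_indicator_Ioc_of_le (fun x => w x * φ s x) hs.1.le hs.2.le]
    simp only [indicator_mul_right]
  rw [heq r hr] at key
  refine key.congr' ?_
  filter_upwards [Ioo_mem_nhds hr.1 hr.2] with s hs using heq s hs

/-- Using the minimum and maximum of s and r treats both sides of r at once, since the Wronskian
identity needs ordered radii. The weight w dominates because every solution is bounded by 1. -/
theorem tendsto_integral_mul (h : IsDirichletFamily w b C Λ φ) {r : ℝ} (hr : r ∈ Ioo 0 b) :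
    Tendsto (fun s => ∫ x in (0 : ℝ)..min s r, w x * φ (min s r) x * φ (max s r) x) (𝓝 r)
      (𝓝 (∫ x in (0 : ℝ)..r, w x * φ r x ^ 2)) := by
  have hb : 0 < b := hr.1.trans hr.2
  have hmin : Tendsto (fun s => min s r) (𝓝 r) (𝓝 r) := by
    have : Continuous fun s : ℝ => min s r := by fun_prop
    simpa using this.tendsto r
  have hmax : Tendsto (fun s => max s r) (𝓝 r) (𝓝 r) := by
    have : Continuous fun s : ℝ => max s r := by fun_prop
    simpa using this.tendsto r
  have hm1 : ∀ s ∈ Ioo 0 b, min s r ∈ Ioc 0 b := fun s hs =>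
    ⟨lt_min hs.1 hr.1, (min_le_right _ _).trans hr.2.le⟩
  have hm2 : ∀ s ∈ Ioo 0 b, max s r ∈ Ioc 0 b := fun s hs =>
    ⟨lt_max_of_lt_left hs.1, max_le hs.2.le hr.2.le⟩
  have key : Tendsto (fun s => ∫ x in (0 : ℝ)..b, w x *
        ((Ioc 0 (min s r)).indicator (φ (min s r)) x * (Ioc 0 (max s r)).indicator (φ (max s r)) x))
      (𝓝 r) (𝓝 (∫ x in (0 : ℝ)..b, w x *
        ((Ioc 0 r).indicator (φ r) x * (Ioc 0 r).indicator (φ r) x))) := by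
    refine intervalIntegral.tendsto_integral_filter_of_dominated_convergence w ?_ ?_
      (intervalIntegrable_of_continuousOn_Icc h.weight.continuousOn (left_mem_Icc.2 hb.le)
        (right_mem_Icc.2 hb.le)) ?_
    · filter_upwards [Ioo_mem_nhds hr.1 hr.2] with s hs
      rw [uIoc_of_le hb.le]
      exact ((h.weight.continuousOn.mono Ioc_subset_Icc_self).aestronglyMeasurable
        measurableSet_Ioc).mul ((aestronglyMeasurable_indicator_of_continuousOn
          (h.sol _ (hm1 s hs)).continuousOn).mul (aestronglyMeasurable_indicator_of_continuousOn
          (h.sol _ (hm2 s hs)).continuousOn))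
    · filter_upwards [Ioo_mem_nhds hr.1 hr.2] with s hs
      refine Eventually.of_forall fun x hx => ?_
      rw [uIoc_of_le hb.le] at hx
      have hwx := h.weight.nonneg (Ioc_subset_Icc_self hx)
      rw [Real.norm_eq_abs, abs_mul, abs_of_nonneg hwx, abs_mul]
      exact mul_le_of_le_one_right hwx (mul_le_one₀ (h.abs_indicator_le (hm1 s hs) x)
        (abs_nonneg _) (h.abs_indicator_le (hm2 s hs) x))
    · have hae : ∀ᵐ t ∂(volume : Measure ℝ), t ≠ r := by simp [ae_iff]
      filter_upwards [hae] with x hxr hx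
      rw [uIoc_of_le hb.le] at hx
      have := h.tendsto_indicator hr hx.1 hxr
      exact ((this.comp hmin).mul (this.comp hmax)).const_mul _
  have heq : ∀ s t, 0 ≤ s → s ≤ t → t ≤ b → ∫ x in (0 : ℝ)..b, w x *
      ((Ioc 0 s).indicator (φ s) x * (Ioc 0 t).indicator (φ t) x)
      = ∫ x in (0 : ℝ)..s, w x * φ s x * φ t x := by
    intro s t hs hst htb
    rw [← integral_indicator_Ioc_of_le (fun x => w x * φ s x * φ t x) hs (hst.trans htb)]
    congr 1
    ext x
    by_cases hx : x ∈ Ioc 0 s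
    · have hx' : x ∈ Ioc 0 t := ⟨hx.1, hx.2.trans hst⟩
      simp only [indicator_of_mem hx, indicator_of_mem hx', mul_assoc]
    · simp only [indicator_of_notMem hx, zero_mul, mul_zero]
  rw [heq r r hr.1.le le_rfl hr.2.le] at key
  have e : ∫ x in (0 : ℝ)..r, w x * φ r x * φ r x = ∫ x in (0 : ℝ)..r, w x * φ r x ^ 2 := by
    congr 1
    ext x
    ring
  rw [e] at key
  refine key.congr' ?_
  filter_upwards [Ioo_mem_nhds hr.1 hr.2] with s hs
  exact heq _ _ (hm1 s hs).1.le min_le_max (hm2 s hs).2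

theorem integral_sq_pos (h : IsDirichletFamily w b C Λ φ) {r : ℝ} (hr : r ∈ Ioc 0 b) :
    0 < ∫ x in (0 : ℝ)..r, w x * φ r x ^ 2 := by
  have hw := h.weight.mono hr.2
  have hs := h.sol r hr
  refine intervalIntegral.intervalIntegral_pos_of_pos_on
    (intervalIntegrable_of_continuousOn_Icc (hw.continuousOn.mul (hs.continuousOn.pow 2))
      (left_mem_Icc.2 hr.1.le) (right_mem_Icc.2 hr.1.le)) (fun t ht => ?_) hr.1
  exact mul_pos (hw.pos t (Ioo_subset_Ioc_self ht)) (pow_pos (hs.pos_of_nonneg hw (h.nonneg r hr)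
    (h.nonneg_sol hr) (h.boundary r hr) t (Ioo_subset_Ico_self ht)) 2)

/-- Hadamard's formula for the derivative of the eigenvalue. -/
theorem hasDerivAt (h : IsDirichletFamily w b C Λ φ) {r : ℝ} (hr : r ∈ Ioo 0 b) :
    HasDerivAt Λ (-((Λ r * ∫ x in (0 : ℝ)..r, w x * φ r x) ^ 2 / w r) /
      ∫ x in (0 : ℝ)..r, w x * φ r x ^ 2) r := by
  have hb : 0 < b := hr.1.trans hr.2
  have hrb : r ∈ Ioc 0 b := Ioo_subset_Ioc_self hr
  have hN := h.integral_sq_pos hrb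
  set A : ℝ → ℝ := fun s => ∫ x in (0 : ℝ)..s, w x * φ s x with hA
  have hAlim : Tendsto A (𝓝 r) (𝓝 (A r)) := h.tendsto_integral hr
  have hle : 𝓝[≠] r ≤ 𝓝 r := nhdsWithin_le_nhds
  have hmin : Tendsto (fun s => min s r) (𝓝[≠] r) (𝓝 r) := by
    have : Continuous fun s : ℝ => min s r := by fun_prop
    simpa using (this.tendsto r).mono_left hle
  have hmax : Tendsto (fun s => max s r) (𝓝[≠] r) (𝓝 r) := by
    have : Continuous fun s : ℝ => max s r := by fun_prop
    simpa using (this.tendsto r).mono_left hle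
  have hm1 : ∀ s ∈ Ioo 0 b, min s r ∈ Ioc 0 b := fun s hs =>
    ⟨lt_min hs.1 hr.1, (min_le_right _ _).trans hr.2.le⟩
  have hm2 : ∀ s ∈ Ioo 0 b, max s r ∈ Ioc 0 b := fun s hs =>
    ⟨lt_max_of_lt_left hs.1, max_le hs.2.le hr.2.le⟩
  have hmm : ∀ s, s ≠ r → min s r < max s r := fun s hs => min_lt_max.2 hs
  have hev : ∀ᶠ s in 𝓝[≠] r, s ∈ Ioo 0 b ∧ s ≠ r := by
    filter_upwards [hle (Ioo_mem_nhds hr.1 hr.2), self_mem_nhdsWithin] with s h1 h2 using ⟨h1, h2⟩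
  -- The Wronskian involves the larger-radius solution at the smaller radius; as that solution
  -- vanishes at the larger radius, the mean value theorem rewrites its value as the gap times a
  -- flux quotient at ξ s.
  have hξ : ∀ s, s ∈ Ioo 0 b ∧ s ≠ r → ∃ ξ ∈ Ioo (min s r) (max s r),
      -(Λ (max s r) * ∫ x in (0 : ℝ)..ξ, w x * φ (max s r) x) / w ξ
        = (φ (max s r) (max s r) - φ (max s r) (min s r)) / (max s r - min s r) := by
    intro s hs
    have hsol := h.sol _ (hm2 s hs.1)
    exact exists_hasDerivAt_eq_slope (φ (max s r)) _ (hmm s hs.2)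
      (hsol.continuousOn.mono (Icc_subset_Icc_left (hm1 s hs.1).1.le))
      (fun t ht => hsol.hasDerivAt t ⟨(hm1 s hs.1).1.trans ht.1, ht.2⟩)
  choose! ξ hξ1 hξ2 using hξ
  have hξlim : Tendsto ξ (𝓝[≠] r) (𝓝 r) :=
    tendsto_of_tendsto_of_tendsto_of_le_of_le' hmin hmax
      (hev.mono fun s hs => (hξ1 s hs).1.le) (hev.mono fun s hs => (hξ1 s hs).2.le)
  have hΛ := (h.continuousAt hr).tendsto
  have hwr : 0 < w r := h.weight.pos r hrb
  have hwlim : Tendsto (fun s => w (ξ s)) (𝓝[≠] r) (𝓝 (w r)) :=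
    ((h.weight.continuousOn.continuousAt (Icc_mem_nhds hr.1 hr.2)).tendsto).comp hξlim
  obtain ⟨W, hW⟩ := isCompact_Icc.exists_bound_of_continuousOn h.weight.continuousOn
  have hW0 := (norm_nonneg _).trans (hW 0 (left_mem_Icc.2 hb.le))
  have hAξ : Tendsto (fun s => ∫ x in (0 : ℝ)..ξ s, w x * φ (max s r) x) (𝓝[≠] r)
      (𝓝 (A r)) := by
    have h1 : Tendsto (fun s => (∫ x in (0 : ℝ)..ξ s, w x * φ (max s r) x) - A (max s r))
        (𝓝[≠] r) (𝓝 0) := by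
      have hlim : Tendsto (fun s => W * (max s r - ξ s)) (𝓝[≠] r) (𝓝 0) := by
        simpa using (hmax.sub hξlim).const_mul W
      refine squeeze_zero_norm' (hev.mono fun s hs => ?_) hlim
      have hx := hξ1 s hs
      have hm := hm2 s hs.1
      have hξm : ξ s ∈ Icc 0 (max s r) := ⟨((hm1 s hs.1).1.trans hx.1).le, hx.2.le⟩
      have hc := (h.sol _ hm).continuousOn_mul (h.weight.mono hm.2)
      have h2 := intervalIntegral.integral_add_adjacent_intervals
        (intervalIntegrable_of_continuousOn_Icc hc (left_mem_Icc.2 hm.1.le) hξm)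
        (intervalIntegrable_of_continuousOn_Icc hc hξm (right_mem_Icc.2 hm.1.le))
      have h3 : (∫ x in (0 : ℝ)..ξ s, w x * φ (max s r) x) - A (max s r)
          = -∫ x in (ξ s)..(max s r), w x * φ (max s r) x := by
        simp only [hA]
        rw [← h2]
        ring
      rw [h3, norm_neg]
      have h4 := intervalIntegral.norm_integral_le_of_norm_le_const (a := ξ s) (b := max s r)
        (f := fun x => w x * φ (max s r) x) (C := W) (fun x hx' => by
          rw [uIoc_of_le hx.2.le] at hx'
          have hxm : x ∈ Icc 0 (max s r) := ⟨hξm.1.trans hx'.1.le, hx'.2⟩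
          have h5 := hW x ⟨hxm.1, hxm.2.trans hm.2⟩
          have h6 := h.abs_le_one hm x hxm
          rw [norm_mul, ← mul_one W]
          gcongr
          exact h6)
      rwa [abs_of_pos (sub_pos.2 hx.2)] at h4
    simpa using h1.add (hAlim.comp hmax)
  have hI := (h.tendsto_integral_mul hr).mono_left hle
  rw [hasDerivAt_iff_tendsto_slope]
  -- By the Wronskian identity this expression equals the slope of Λ once s ≠ r is close to r; in
  -- the limit both fluxes become Λ r * A r.
  have hlim := ((((hΛ.comp hmin).mul (hAlim.comp hmin)).neg).mul
    (((hΛ.comp hmax).mul hAξ).div hwlim hwr.ne')).div hI hN.ne'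
  have hval : -(Λ r * A r) * (Λ r * A r / w r) / (∫ x in (0 : ℝ)..r, w x * φ r x ^ 2)
      = -((Λ r * A r) ^ 2 / w r) / ∫ x in (0 : ℝ)..r, w x * φ r x ^ 2 := by ring
  rw [hval] at hlim
  have hIpos : ∀ᶠ s in 𝓝[≠] r, 0 < ∫ x in (0 : ℝ)..min s r,
      w x * φ (min s r) x * φ (max s r) x := hI.eventually (lt_mem_nhds hN)
  refine hlim.congr' ?_
  filter_upwards [hev, hIpos] with s hs hIs
  have hwron := h.wronskian (hm1 s hs.1) (hm2 s hs.1) min_le_max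
  have hslope := hξ2 s hs
  rw [h.boundary _ (hm2 s hs.1), zero_sub] at hslope
  have hd : 0 < max s r - min s r := sub_pos.2 (hmm s hs.2)
  have hquot : slope Λ r s = (Λ (max s r) - Λ (min s r)) / (max s r - min s r) := by
    rw [slope_def_field]
    rcases le_total s r with hsr | hsr
    · rw [max_eq_right hsr, min_eq_left hsr, ← neg_sub, ← neg_sub r s, neg_div_neg_eq]
    · rw [max_eq_left hsr, min_eq_right hsr]
  rw [hquot]
  have e1 : Λ (max s r) * (∫ x in (0 : ℝ)..ξ s, w x * φ (max s r) x) / w (ξ s)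
      = φ (max s r) (min s r) / (max s r - min s r) := by
    rw [neg_div, neg_div, neg_inj] at hslope
    exact hslope
  simp only [Pi.div_apply, Function.comp_apply]
  rw [e1, ← mul_div_assoc, hwron, div_div, mul_comm (max s r - min s r), ← div_div,
    mul_div_assoc, div_self hIs.ne', mul_one]

end IsDirichletFamily


/-! ### Bessel functions and the limit of small balls -/

theorem summable_mul_pow_of_abs_le {c : ℕ → ℝ} (hc : ∀ m, |c m| ≤ 1 / (m.factorial : ℝ)) (y : ℝ) :
    Summable fun m => c m * y ^ m := by
  refine Summable.of_norm_bounded (Real.summable_pow_div_factorial |y|) fun m => ?_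
  rw [norm_mul, Real.norm_eq_abs, norm_pow, Real.norm_eq_abs, div_eq_mul_one_div, mul_comm]
  exact mul_le_mul_of_nonneg_left (hc m) (by positivity)

/-- The bound 1/m! survives formal differentiation, so one differentiation lemma can be applied
repeatedly. -/
theorem abs_succ_mul_le {c : ℕ → ℝ} (hc : ∀ m, |c m| ≤ 1 / (m.factorial : ℝ)) (m : ℕ) :
    |((m : ℝ) + 1) * c (m + 1)| ≤ 1 / (m.factorial : ℝ) := by
  have h1 := hc (m + 1)
  have h0 : (0 : ℝ) < (m : ℝ) + 1 := by positivity
  rw [abs_mul, abs_of_pos h0]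
  calc ((m : ℝ) + 1) * |c (m + 1)| ≤ ((m : ℝ) + 1) * (1 / ((m + 1).factorial : ℝ)) := by gcongr
    _ = 1 / (m.factorial : ℝ) := by
      rw [Nat.factorial_succ]
      push_cast
      field_simp

theorem hasDerivAt_tsum_mul_pow {c : ℕ → ℝ} (hc : ∀ m, |c m| ≤ 1 / (m.factorial : ℝ)) (y : ℝ) :
    HasDerivAt (fun y => ∑' m, c m * y ^ m) (∑' m : ℕ, ((m : ℝ) + 1) * c (m + 1) * y ^ m) y := by
  set ρ := |y| + 1 with hρ
  -- On the ball of radius |y| + 1 the differentiated series has a summable majorant, which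
  -- justifies termwise differentiation.
  have hρ0 : 0 < ρ := by positivity
  set u : ℕ → ℝ := fun m => |c m| * (m * ρ ^ (m - 1)) with hu
  have hus : Summable u := by
    rw [← summable_nat_add_iff 1]
    refine Summable.of_nonneg_of_le (fun m => by positivity) (fun m => ?_)
      (Real.summable_pow_div_factorial ρ)
    have h1 := abs_succ_mul_le hc m
    rw [abs_mul, abs_of_pos (by positivity : (0 : ℝ) < (m : ℝ) + 1)] at h1
    simp only [hu, Nat.add_sub_cancel]
    push_cast
    calc |c (m + 1)| * (((m : ℝ) + 1) * ρ ^ m) = (((m : ℝ) + 1) * |c (m + 1)|) * ρ ^ m := by ring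
      _ ≤ 1 / (m.factorial : ℝ) * ρ ^ m := by gcongr
      _ = _ := by ring
  have hmem : y ∈ Metric.ball (0 : ℝ) ρ := by
    rw [mem_ball_zero_iff, Real.norm_eq_abs]
    linarith
  have key := hasDerivAt_tsum_of_isPreconnected (g := fun m y => c m * y ^ m)
    (g' := fun m y => c m * (m * y ^ (m - 1))) hus Metric.isOpen_ball
    (convex_ball (0 : ℝ) ρ).isPreconnected
    (fun m x _ => (hasDerivAt_pow m x).const_mul (c m))
    (fun m x hx => by
      rw [mem_ball_zero_iff] at hx
      rw [norm_mul, norm_mul, norm_pow, Real.norm_eq_abs, Real.norm_natCast]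
      change _ ≤ |c m| * (m * ρ ^ (m - 1))
      have := hx.le
      gcongr) hmem (summable_mul_pow_of_abs_le hc y) hmem
  refine key.congr_deriv ?_
  have hs : Summable fun m => c m * (m * y ^ (m - 1)) := by
    refine Summable.of_norm_bounded hus fun m => ?_
    rw [norm_mul, norm_mul, norm_pow, Real.norm_eq_abs, Real.norm_natCast, Real.norm_eq_abs]
    change _ ≤ |c m| * (m * ρ ^ (m - 1))
    have : |y| ≤ ρ := by linarith
    gcongr
  rw [hs.tsum_eq_zero_add]
  simp only [Nat.cast_zero, zero_mul, mul_zero, zero_add, Nat.add_sub_cancel]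
  refine tsum_congr fun m => ?_
  push_cast
  ring

/-- The coefficients of `Γ(ν + 1) (x / 2) ^ (-ν) J_ν(x)` as a power series in `x ^ 2`. -/
noncomputable def besselCoeff (ν : ℝ) (m : ℕ) : ℝ :=
  (-1) ^ m * Real.Gamma (ν + 1) / ((m.factorial : ℝ) * Real.Gamma (m + ν + 1) * 4 ^ m)

/-- The normalized Bessel function `Γ(ν + 1) (x / 2) ^ (-ν) J_ν(x)` as a function of `y = x ^ 2`. -/
noncomputable def besselSeries (ν y : ℝ) : ℝ := ∑' m, besselCoeff ν m * y ^ m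

theorem besselCoeff_zero {ν : ℝ} (hν : 0 ≤ ν) : besselCoeff ν 0 = 1 := by
  have := (Real.Gamma_pos_of_pos (by linarith : 0 < ν + 1)).ne'
  simp [besselCoeff, this]

/-- The recursions of Γ and of the factorial; coefficientwise this is the differential equation of
the series. -/
theorem besselCoeff_succ {ν : ℝ} (hν : 0 ≤ ν) (m : ℕ) :
    4 * ((m : ℝ) + 1) * (m + ν + 1) * besselCoeff ν (m + 1) = -besselCoeff ν m := by
  have h1 : (0 : ℝ) < m + ν + 1 := by positivity
  have h2 := (Real.Gamma_pos_of_pos h1).ne'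
  have h3 : ((m + 1 : ℕ) : ℝ) + ν + 1 = (m + ν + 1) + 1 := by push_cast; ring
  rw [besselCoeff, besselCoeff, h3, Real.Gamma_add_one h1.ne', Nat.factorial_succ]
  push_cast
  field_simp
  ring

theorem abs_besselCoeff_le {ν : ℝ} (hν : 0 ≤ ν) (m : ℕ) :
    |besselCoeff ν m| ≤ 1 / (m.factorial : ℝ) := by
  induction m with
  | zero => simp [besselCoeff_zero hν]
  | succ m ih =>
    have h0 : (0 : ℝ) < (m : ℝ) + 1 := by positivity
    have h1 := congrArg abs (besselCoeff_succ hν m)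
    rw [abs_neg, abs_mul, abs_of_pos (by positivity : (0 : ℝ) < 4 * ((m : ℝ) + 1) * (m + ν + 1))]
      at h1
    have h2 : ((m : ℝ) + 1) * |besselCoeff ν (m + 1)| ≤ 1 / (m.factorial : ℝ) := by
      refine le_trans ?_ (h1.le.trans ih)
      have h3 : (m : ℝ) + 1 ≤ 4 * ((m : ℝ) + 1) * (m + ν + 1) := by
        have h4 : (1 : ℝ) ≤ 4 * (m + ν + 1) := by
          have : (0 : ℝ) ≤ m := by positivity
          linarith
        calc (m : ℝ) + 1 = ((m : ℝ) + 1) * 1 := by ring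
          _ ≤ ((m : ℝ) + 1) * (4 * (m + ν + 1)) := by gcongr
          _ = _ := by ring
      gcongr
    rw [Nat.factorial_succ]
    push_cast
    rw [mul_comm, ← le_div_iff₀ h0] at h2
    refine h2.trans (le_of_eq ?_)
    field_simp

theorem besselSeries_zero {ν : ℝ} (hν : 0 ≤ ν) : besselSeries ν 0 = 1 := by
  rw [besselSeries, tsum_eq_single 0 (fun m hm => by simp [hm])]
  simp [besselCoeff_zero hν]

/-- The differential equation of `besselSeries`. -/
theorem exists_hasDerivAt_besselSeries {ν : ℝ} (hν : 0 ≤ ν) : ∃ E₁ E₂ : ℝ → ℝ,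
    (∀ y, HasDerivAt (besselSeries ν) (E₁ y) y) ∧ (∀ y, HasDerivAt E₁ (E₂ y) y) ∧
      ∀ y, 4 * y * E₂ y + 4 * (ν + 1) * E₁ y + besselSeries ν y = 0 := by
  set c := besselCoeff ν with hc
  set d : ℕ → ℝ := fun m => ((m : ℝ) + 1) * c (m + 1) with hd
  set e : ℕ → ℝ := fun m => ((m : ℝ) + 1) * d (m + 1) with he
  have hcb := abs_besselCoeff_le hν
  have hdb := abs_succ_mul_le hcb
  have heb := abs_succ_mul_le hdb
  refine ⟨fun y => ∑' m, d m * y ^ m, fun y => ∑' m, e m * y ^ m,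
    fun y => hasDerivAt_tsum_mul_pow hcb y, fun y => hasDerivAt_tsum_mul_pow hdb y, fun y => ?_⟩
  have hes := summable_mul_pow_of_abs_le heb y
  have hds := summable_mul_pow_of_abs_le hdb y
  have hcs := summable_mul_pow_of_abs_le hcb y
  have hshift : ∀ m : ℕ, ((m + 1 : ℕ) : ℝ) * d (m + 1) * y ^ (m + 1) = y * (e m * y ^ m) := by
    intro m
    simp only [he]
    push_cast
    ring
  have hms : Summable fun m : ℕ => (m : ℝ) * d m * y ^ m := by
    rw [← summable_nat_add_iff 1]
    simp_rw [hshift]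
    exact hes.mul_left y
  have h1 : y * ∑' m, e m * y ^ m = ∑' m : ℕ, (m : ℝ) * d m * y ^ m := by
    rw [hms.tsum_eq_zero_add]
    simp_rw [hshift]
    rw [tsum_mul_left]
    simp
  rw [mul_assoc, h1, besselSeries, ← tsum_mul_left, ← tsum_mul_left,
    ← (hms.mul_left 4).tsum_add (hds.mul_left _),
    ← ((hms.mul_left 4).add (hds.mul_left _)).tsum_add hcs]
  convert tsum_zero using 2 with m
  ext m
  have := besselCoeff_succ hν m
  simp only [hd]
  linear_combination y ^ m * this

theorem besselJ_eq {ν x : ℝ} (hν : 0 ≤ ν) (hx : 0 < x) :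
    besselJ ν x = (x / 2) ^ ν / Real.Gamma (ν + 1) * besselSeries ν (x ^ 2) := by
  rw [besselJ, besselSeries, ← tsum_mul_left]
  refine tsum_congr fun m => ?_
  have hx2 : 0 < x / 2 := by positivity
  have h2 := (Real.Gamma_pos_of_pos (by linarith : 0 < ν + 1)).ne'
  have h3 := (Real.Gamma_pos_of_pos (by positivity : (0 : ℝ) < m + ν + 1)).ne'
  have h4 : (x / 2) ^ (2 * (m : ℝ) + ν) = (x / 2) ^ (2 * m) * (x / 2) ^ ν := by
    rw [Real.rpow_add hx2]
    congr 1
    rw [← Real.rpow_natCast]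
    push_cast
    rfl
  have h5 : (x / 2) ^ (2 * m) * 4 ^ m = (x ^ 2) ^ m := by
    rw [pow_mul, ← mul_pow]
    congr 1
    ring
  rw [h4, besselCoeff, ← h5]
  field_simp

theorem besselJ_eq_zero_iff {ν x : ℝ} (hν : 0 ≤ ν) (hx : 0 < x) :
    besselJ ν x = 0 ↔ besselSeries ν (x ^ 2) = 0 := by
  have h2 := (Real.Gamma_pos_of_pos (by linarith : 0 < ν + 1)).ne'
  have h3 : (x / 2) ^ ν ≠ 0 := (Real.rpow_pos_of_pos (by positivity) ν).ne'
  rw [besselJ_eq hν hx, mul_eq_zero, or_iff_right (div_ne_zero h3 h2)]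

/-! ### Euclidean balls and the rescaled limit at the pole -/

theorem isAdmissibleWeight_pow {k : ℕ} (hk : k ≠ 0) (b : ℝ) :
    IsAdmissibleWeight (fun x : ℝ => x ^ k) b 1 where
  continuousOn := by fun_prop
  pos t ht := pow_pos ht.1 k
  zero := zero_pow hk
  le s t hs hst _ := by rw [one_mul]; exact pow_le_pow_left₀ hs hst k

/-- The radial eigenfunctions of Euclidean balls. -/
theorem isRegularSolution_besselSeries {n : ℕ} (hn : 2 ≤ n) (κ b : ℝ) :
    IsRegularSolution (fun x : ℝ => x ^ (n - 1)) κ b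
      (fun x => besselSeries ((n : ℝ) / 2 - 1) (κ * x ^ 2)) := by
  have hν : (0 : ℝ) ≤ (n : ℝ) / 2 - 1 := by
    have : (2 : ℝ) ≤ n := by exact_mod_cast hn
    linarith
  obtain ⟨E₁, E₂, h1, h2, h3⟩ := exists_hasDerivAt_besselSeries hν
  set ν := (n : ℝ) / 2 - 1 with hνdef
  have hsq : ∀ x : ℝ, HasDerivAt (fun x : ℝ => κ * x ^ 2) (κ * (2 * x)) x := fun x => by
    simpa using (hasDerivAt_pow 2 x).const_mul κ
  have hY : ∀ x : ℝ, HasDerivAt (fun x => besselSeries ν (κ * x ^ 2))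
      (E₁ (κ * x ^ 2) * (κ * (2 * x))) x := fun x => (h1 _).comp x (hsq x)
  have hYc : Continuous fun x : ℝ => besselSeries ν (κ * x ^ 2) :=
    continuous_iff_continuousAt.2 fun x => (hY x).continuousAt
  obtain ⟨k, rfl⟩ := Nat.exists_eq_add_of_le' hn
  have hk : k + 2 - 1 = k + 1 := rfl
  rw [hk]
  refine ⟨hYc.continuousOn, by simp [besselSeries_zero hν], fun x hx => ?_⟩
  -- The primitive comes from the Bessel equation: with y = κ s² and 4(ν + 1) = 2(k + 2), the
  -- derivative of -2 s^(k+2) E₁(y) is -s^(k+1) (4 y E₂ + 4(ν + 1) E₁), which is s^(k+1) times the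
  -- series.
  have hint : ∫ s in (0 : ℝ)..x, s ^ (k + 1) * besselSeries ν (κ * s ^ 2)
      = -2 * x ^ (k + 2) * E₁ (κ * x ^ 2) := by
    have := intervalIntegral.integral_eq_sub_of_hasDerivAt (a := 0) (b := x)
      (f := fun s => -2 * s ^ (k + 2) * E₁ (κ * s ^ 2))
      (f' := fun s => s ^ (k + 1) * besselSeries ν (κ * s ^ 2))
      (fun s _ => by
        refine ((((hasDerivAt_pow (k + 2) s).const_mul (-2)).mul
          ((h2 _).comp s (hsq s)))).congr_deriv ?_
        have h4 := h3 (κ * s ^ 2)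
        have h5 : ν + 1 = ((k : ℝ) + 2) / 2 := by rw [hνdef]; push_cast; ring
        rw [h5] at h4
        simp only [Function.comp_apply, Nat.add_succ_sub_one]
        push_cast
        linear_combination (-(s ^ (k + 1))) * h4)
      (((continuous_pow (k + 1)).mul hYc).intervalIntegrable 0 x)
    rw [this]
    simp
  refine (hY x).congr_deriv ?_
  have hx0 : x ≠ 0 := hx.1.ne'
  rw [hint]
  field_simp
  ring

/-- The Euclidean solution with eigenvalue L is nonnegative and vanishes at 1, hence is positive on
[0, 1). Substituting x = √L · (x/√L), no Bessel zero lies below √L, while √L is one. -/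
theorem besselFirstZero_sq_eq {n : ℕ} (hn : 2 ≤ n) {L : ℝ} (hL : 0 ≤ L)
    (h0 : besselSeries ((n : ℝ) / 2 - 1) L = 0)
    (hnn : ∀ x ∈ Icc (0 : ℝ) 1, 0 ≤ besselSeries ((n : ℝ) / 2 - 1) (L * x ^ 2)) :
    besselFirstZero ((n : ℝ) / 2 - 1) ^ 2 = L := by
  have hν : (0 : ℝ) ≤ (n : ℝ) / 2 - 1 := by
    have : (2 : ℝ) ≤ n := by exact_mod_cast hn
    linarith
  have hsol := isRegularSolution_besselSeries hn L 1
  have h01 : besselSeries ((n : ℝ) / 2 - 1) (L * 1 ^ 2) = 0 := by simpa using h0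
  have hL0 : 0 < L := lt_of_le_of_ne hL (hsol.ne_zero_of_eq_zero zero_le_one h01).symm
  have hpos := hsol.pos_of_nonneg (isAdmissibleWeight_pow (by omega) 1) hL hnn h01
  have hleast : IsLeast {x : ℝ | 0 < x ∧ besselJ ((n : ℝ) / 2 - 1) x = 0} (√L) := by
    refine ⟨⟨Real.sqrt_pos.2 hL0, ?_⟩, fun x hx => ?_⟩
    · rw [besselJ_eq_zero_iff hν (Real.sqrt_pos.2 hL0), Real.sq_sqrt hL, h0]
    · by_contra! hlt
      have hs := Real.sqrt_pos.2 hL0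
      have h1 := hpos (x / √L) ⟨div_nonneg hx.1.le hs.le, (div_lt_one hs).2 hlt⟩
      have h2 : L * (x / √L) ^ 2 = x ^ 2 := by
        rw [div_pow, Real.sq_sqrt hL]
        field_simp
      rw [h2, (besselJ_eq_zero_iff hν hx.1).1 hx.2] at h1
      exact lt_irrefl _ h1
  rw [besselFirstZero, hleast.csInf_eq, Real.sq_sqrt hL]

/-- Rescaling a regular solution to the unit interval. -/
theorem IsRegularSolution.comp_mul {w φ : ℝ → ℝ} {μ s : ℝ} (hs : 0 < s)
    (h : IsRegularSolution w μ s φ) :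
    IsRegularSolution (fun x => w (s * x)) (s ^ 2 * μ) 1 (fun x => φ (s * x)) := by
  have hmaps : MapsTo (fun x => s * x) (Icc 0 1) (Icc 0 s) := fun x hx =>
    ⟨mul_nonneg hs.le hx.1, mul_le_of_le_one_right hs.le hx.2⟩
  refine ⟨h.continuousOn.comp (by fun_prop) hmaps, by simp [h.zero], fun x hx => ?_⟩
  have hm : s * x ∈ Ioo 0 s := ⟨mul_pos hs hx.1, mul_lt_of_lt_one_right hs hx.2⟩
  have h1 : HasDerivAt (fun x => s * x) s x := by simpa using (hasDerivAt_id x).const_mul s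
  refine ((h.hasDerivAt _ hm).comp x h1).congr_deriv ?_
  have h2 := intervalIntegral.mul_integral_comp_mul_left (a := 0) (b := x) s
    (f := fun y => w y * φ y)
  rw [mul_zero] at h2
  rw [← h2]
  ring

theorem IsAdmissibleWeight.comp_mul {w : ℝ → ℝ} {C s : ℝ} (hs : 0 < s)
    (h : IsAdmissibleWeight w s C) : IsAdmissibleWeight (fun x => w (s * x)) 1 C where
  continuousOn := h.continuousOn.comp (by fun_prop) fun x hx =>
    ⟨mul_nonneg hs.le hx.1, mul_le_of_le_one_right hs.le hx.2⟩
  pos t ht := h.pos _ ⟨mul_pos hs ht.1, mul_le_of_le_one_right hs.le ht.2⟩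
  zero := by simp [h.zero]
  le x y hx hxy hy := h.le _ _ (mul_nonneg hs.le hx) (mul_le_mul_of_nonneg_left hxy hs.le)
    (mul_le_of_le_one_right hs.le hy)

/-- The rescaled eigenvalues of small balls tend to the eigenvalue of the Euclidean unit ball. -/
theorem IsDirichletFamily.limit_eq_besselFirstZero {n : ℕ} (hn : 2 ≤ n) {f Λ : ℝ → ℝ}
    {φ : ℝ → ℝ → ℝ} {b C L : ℝ} (hb : 0 < b) (hf0 : f 0 = 0) (hfpos : ∀ t ∈ Ioc 0 b, 0 < f t)
    (hf : Tendsto (fun t => f t / t) (𝓝[>] 0) (𝓝 1))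
    (h : IsDirichletFamily (fun t => f t ^ (n - 1)) b C Λ φ)
    (hL : Tendsto (fun s => s ^ 2 * Λ s) (𝓝[>] 0) (𝓝 L)) :
    besselFirstZero ((n : ℝ) / 2 - 1) ^ 2 = L := by
  have hn1 : n - 1 ≠ 0 := by omega
  have hL0 : 0 ≤ L := by
    refine ge_of_tendsto hL ?_
    filter_upwards [Ioo_mem_nhdsGT hb] with s hs
    exact mul_nonneg (sq_nonneg s) (h.nonneg s (Ioo_subset_Ioc_self hs))
  -- The three variables stand for the radius s and the two points s y, s z of the kernel.
  -- Convergence along the product filter makes the estimate uniform in y and z.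
  have hker : Tendsto (fun p : ℝ × ℝ × ℝ => |L - p.1 ^ 2 * Λ p.1 *
      ((f p.2.1 / p.2.1) / (f p.2.2 / p.2.2)) ^ (n - 1)|)
      (𝓝[>] 0 ×ˢ (𝓝[>] 0 ×ˢ 𝓝[>] 0)) (𝓝 0) := by
    have h1 := (hL.comp tendsto_fst).mul ((((hf.comp tendsto_fst).div (hf.comp tendsto_snd)
      one_ne_zero).comp (tendsto_snd (f := 𝓝[>] (0 : ℝ)))).pow (n - 1))
    have h2 := (h1.const_sub L).abs
    simpa using h2
  have hlim : ∀ x ∈ Icc (0 : ℝ) 1, Tendsto (fun s => φ s (s * x)) (𝓝[>] 0)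
      (𝓝 (besselSeries ((n : ℝ) / 2 - 1) (L * x ^ 2))) := by
    intro x hx
    rw [Metric.tendsto_nhds]
    intro ε hε
    -- Chosen so that the stability estimate, with weight constant, bound and interval length all 1,
    -- gives ε/2.
    set ε' := ε / 2 / Real.exp (|L| * 1 * 1 ^ 2) with hε'
    have hε'0 : 0 < ε' := by positivity
    obtain ⟨pa, hpa, pb, hpb, hab⟩ := eventually_prod_iff.1
      (hker.eventually (gt_mem_nhds hε'0))
    obtain ⟨pc, hpc, pd, hpd, hcd⟩ := eventually_prod_iff.1 hpb
    obtain ⟨δ, hδ, hδs⟩ := mem_nhdsGT_iff_exists_Ioo_subset.1 (hpc.and hpd)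
    filter_upwards [hpa, Ioo_mem_nhdsGT hb, Ioo_mem_nhdsGT hδ] with s hs1 hs2 hs3
    have hsb := Ioo_subset_Ioc_self hs2
    have hws := (h.weight.mono hsb.2).comp_mul hs2.1
    have key := IsRegularSolution.abs_sub_le (ε := ε') (B := 1) zero_le_one
      (isAdmissibleWeight_pow hn1 1) hws
      (isRegularSolution_besselSeries hn L 1) ((h.sol s hsb).comp_mul hs2.1)
      (fun t ht => h.abs_le_one hsb _ ⟨mul_nonneg hs2.1.le ht.1,
        mul_le_of_le_one_right hs2.1.le ht.2⟩) hε'0.le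
      (fun y z hy hyz hz hz1 => by
        rcases hy.eq_or_lt with rfl | hy
        · simp [hf0, hn1, hε'0.le]
        have hy1 : y ≤ 1 := hyz.trans hz1
        have hsy : s * y ∈ Ioo 0 δ := ⟨mul_pos hs2.1 hy,
          (mul_le_of_le_one_right hs2.1.le hy1).trans_lt hs3.2⟩
        have hsz : s * z ∈ Ioo 0 δ := ⟨mul_pos hs2.1 hz,
          (mul_le_of_le_one_right hs2.1.le hz1).trans_lt hs3.2⟩
        have hk := hab hs1 (hcd (hδs hsy).1 (hδs hsz).2)
        have hfz : 0 < f (s * z) := hfpos _ ⟨hsz.1,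
          (mul_le_of_le_one_right hs2.1.le hz1).trans hs2.2.le⟩
        have hs0 := hs2.1
        -- Factoring out the Euclidean kernel (y/z)^(n-1) ≤ 1 leaves the quantity controlled above.
        have e1 : L * (y ^ (n - 1) / z ^ (n - 1))
            - s ^ 2 * Λ s * (f (s * y) ^ (n - 1) / f (s * z) ^ (n - 1))
            = (y / z) ^ (n - 1) * (L - s ^ 2 * Λ s *
              ((f (s * y) / (s * y)) / (f (s * z) / (s * z))) ^ (n - 1)) := by
          have e2 : f (s * y) / f (s * z)
              = (y / z) * ((f (s * y) / (s * y)) / (f (s * z) / (s * z))) := by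
            field_simp
          rw [← div_pow, ← div_pow, e2, mul_pow]
          ring
        rw [e1, abs_mul, abs_of_nonneg (by positivity)]
        have e3 : (y / z) ^ (n - 1) ≤ 1 := pow_le_one₀ (by positivity) ((div_le_one hz).2 hyz)
        exact (mul_le_of_le_one_left (abs_nonneg _) e3).trans hk.le) x hx
    rw [dist_comm, Real.dist_eq]
    refine key.trans_lt ?_
    have : ε' * 1 * 1 * 1 * Real.exp (|L| * 1 * 1 ^ 2) = ε / 2 := by
      simp only [hε']
      field_simp
    rw [this]
    linarith
  refine besselFirstZero_sq_eq hn hL0 ?_ fun x hx => ?_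
  · have h1 := hlim 1 (right_mem_Icc.2 zero_le_one)
    simp only [mul_one, one_pow] at h1
    refine tendsto_nhds_unique h1 (tendsto_const_nhds.congr' ?_)
    filter_upwards [Ioo_mem_nhdsGT hb] with s hs
    exact (h.boundary s (Ioo_subset_Ioc_self hs)).symm
  · refine ge_of_tendsto (hlim x hx) ?_
    filter_upwards [Ioo_mem_nhdsGT hb] with s hs
    exact h.nonneg_sol (Ioo_subset_Ioc_self hs) _ ⟨mul_nonneg hs.1.le hx.1,
      mul_le_of_le_one_right hs.1.le hx.2⟩


/-! ### The eigenvalue identities -/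

namespace IsProfile

variable {f f₁ f₂ f₃ : ℝ → ℝ} {b : ℝ}

/-- The normalized radial eigenfunctions form a Dirichlet family. -/
theorem exists_isDirichletFamily (h : IsProfile f f₁ f₂ f₃ b) (hb : 0 < b) {n : ℕ} (hn : 2 ≤ n)
    {ψ : ℝ → ℝ → ℝ}
    (hψ : ∀ r ∈ Ioc 0 b, IsRadialEigenfunction n f r (firstEigenvalue n f r) (ψ r)) :
    ∃ C, IsDirichletFamily (fun t => f t ^ (n - 1)) b C (firstEigenvalue n f)
      (fun r t => ψ r t / ψ r 0) := by
  obtain ⟨C, hw⟩ := h.exists_isAdmissibleWeight hb (m := n - 1) (by omega)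
  have hpos : ∀ r ∈ Ioc 0 b, ∀ t ∈ Ioo 0 r, 0 < f t := fun r hr t ht =>
    h.pos t ⟨ht.1, ht.2.le.trans hr.2⟩
  refine ⟨C, hw, fun r hr => (h.isRegularSolution_of_isRadialEigenfunction hn hr (hψ r hr)).2,
    fun r hr => by simp [(hψ r hr).boundary], fun r hr => firstEigenvalue_nonneg (hpos r hr),
    fun s hs r hr hsr => firstEigenvalue_anti hs.1 hsr (hpos r hr), fun r hr μ χ hχ h0 =>
    firstEigenvalue_le_of_isRegularSolution hn hr.1 (hpos r hr) (hw.mono hr.2) hχ h0⟩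

/-- The integrability claims and the identity `r λ' + 2 λ = (n - 1) / 2 * Q` on an interval. -/
theorem eigenvalue_identity (h : IsProfile f f₁ f₂ f₃ b) {n : ℕ} (hn : 2 ≤ n)
    {ψ : ℝ → ℝ → ℝ}
    (hψ : ∀ r ∈ Ioc 0 b, IsRadialEigenfunction n f r (firstEigenvalue n f r) (ψ r))
    {r : ℝ} (hr : r ∈ Ioo 0 b) :
    IntervalIntegrable (fun s => HFun n f s * f s ^ (n - 1) * ψ r s ^ 2) volume 0 r ∧
      IntervalIntegrable (fun s => f s ^ (n - 1) * ψ r s ^ 2) volume 0 r ∧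
      0 < (∫ s in (0 : ℝ)..r, f s ^ (n - 1) * ψ r s ^ 2) ∧
      DifferentiableAt ℝ (firstEigenvalue n f) r ∧
      r * deriv (firstEigenvalue n f) r + 2 * firstEigenvalue n f r =
        ((n : ℝ) - 1) / 2 * weightedMeanH n f (ψ r) r := by
  have hb : 0 < b := hr.1.trans hr.2
  have hrb : r ∈ Ioc 0 b := Ioo_subset_Ioc_self hr
  obtain ⟨C, hfam⟩ := h.exists_isDirichletFamily hb hn hψ
  have hψ0 := (h.isRegularSolution_of_isRadialEigenfunction hn hrb (hψ r hrb)).1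
  have hc : ContinuousOn (fun s => f s ^ (n - 1) * ψ r s ^ 2) (Icc 0 r) :=
    (hfam.weight.mono hrb.2).continuousOn.mul ((hψ r hrb).continuousOn.pow 2)
  have hN := hfam.integral_sq_pos hrb
  have hd := hfam.hasDerivAt hr
  have hvir := h.virial_identity hn hr (hfam.sol r hrb) (hfam.boundary r hrb)
  -- The factor ψ r 0 ^ 2 cancels in the weighted mean, so Q does not depend on the normalization of
  -- the eigenfunction.
  have e1 : ∫ s in (0 : ℝ)..r, f s ^ (n - 1) * ψ r s ^ 2
      = ψ r 0 ^ 2 * ∫ s in (0 : ℝ)..r, f s ^ (n - 1) * (ψ r s / ψ r 0) ^ 2 := by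
    rw [← intervalIntegral.integral_const_mul]
    refine intervalIntegral.integral_congr fun s _ => ?_
    field_simp
  have e2 : ∫ s in (0 : ℝ)..r, HFun n f s * f s ^ (n - 1) * ψ r s ^ 2
      = ψ r 0 ^ 2 * ∫ s in (0 : ℝ)..r, HFun n f s * (f s ^ (n - 1) * (ψ r s / ψ r 0) ^ 2) := by
    rw [← intervalIntegral.integral_const_mul]
    refine intervalIntegral.integral_congr fun s _ => ?_
    field_simp
  have hc2 : 0 < ψ r 0 ^ 2 := by positivity
  refine ⟨?_, intervalIntegrable_of_continuousOn_Icc hc (left_mem_Icc.2 hr.1.le)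
    (right_mem_Icc.2 hr.1.le), ?_, hd.differentiableAt, ?_⟩
  · simp_rw [mul_assoc]
    exact h.intervalIntegrable_HFun_mul hb n hr hc
  · rw [e1]
    exact mul_pos hc2 hN
  · rw [hd.deriv, weightedMeanH, e1, e2, mul_div_mul_left _ _ hc2.ne']
    have hN' := hN.ne'
    generalize (firstEigenvalue n f r * ∫ s in (0 : ℝ)..r, f s ^ (n - 1) * (ψ r s / ψ r 0)) ^ 2 /
      f r ^ (n - 1) = V at hvir ⊢
    generalize (∫ s in (0 : ℝ)..r, f s ^ (n - 1) * (ψ r s / ψ r 0) ^ 2) = N at hvir hN' ⊢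
    generalize (∫ s in (0 : ℝ)..r, HFun n f s * (f s ^ (n - 1) * (ψ r s / ψ r 0) ^ 2)) = I
      at hvir ⊢
    field_simp
    linear_combination (-2) * hvir

/-- A mean with a nonnegative weight does not exceed a bound of the averaged function; this keeps Q
bounded down to the pole. -/
theorem abs_weightedMeanH_le (h : IsProfile f f₁ f₂ f₃ b) {n : ℕ} (hn : 2 ≤ n)
    {ψ : ℝ → ℝ → ℝ}
    (hψ : ∀ r ∈ Ioc 0 b, IsRadialEigenfunction n f r (firstEigenvalue n f r) (ψ r))
    {r M : ℝ} (hr : r ∈ Ioo 0 b) (hM : ∀ t ∈ Ioo 0 b, |HFun n f t| ≤ M) :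
    |weightedMeanH n f (ψ r) r| ≤ M := by
  obtain ⟨i1, i2, hN, -, -⟩ := h.eigenvalue_identity hn hψ hr
  rw [weightedMeanH, abs_div, abs_of_pos hN, div_le_iff₀ hN,
    ← intervalIntegral.integral_const_mul, ← Real.norm_eq_abs]
  refine intervalIntegral.norm_integral_le_of_norm_le hr.1.le
    (Eventually.of_forall fun t ht => ?_) (i2.const_mul M)
  have htb : t ∈ Ioo 0 b := ⟨ht.1, ht.2.trans_lt hr.2⟩
  have hft := (h.pos t (Ioo_subset_Ioc_self htb)).le
  rw [mul_assoc, norm_mul, Real.norm_eq_abs, Real.norm_eq_abs,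
    abs_of_nonneg (a := f t ^ (n - 1) * ψ r t ^ 2) (by positivity)]
  exact mul_le_mul_of_nonneg_right (hM t htb) (by positivity)

/-- The eigenvalue identity multiplied by r: r² is its integrating factor. -/
theorem hasDerivAt_sq_mul_firstEigenvalue (h : IsProfile f f₁ f₂ f₃ b) {n : ℕ} (hn : 2 ≤ n)
    {ψ : ℝ → ℝ → ℝ}
    (hψ : ∀ r ∈ Ioc 0 b, IsRadialEigenfunction n f r (firstEigenvalue n f r) (ψ r))
    {r : ℝ} (hr : r ∈ Ioo 0 b) :
    HasDerivAt (fun s => s ^ 2 * firstEigenvalue n f s)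
      (((n : ℝ) - 1) / 2 * (r * weightedMeanH n f (ψ r) r)) r := by
  obtain ⟨-, -, -, hd, heq⟩ := h.eigenvalue_identity hn hψ hr
  refine ((hasDerivAt_pow 2 r).mul hd.hasDerivAt).congr_deriv ?_
  simp only [Nat.add_one_sub_one, pow_one, Nat.cast_ofNat]
  linear_combination r * heq

/-- Nothing is assumed about the dependence of ψ t on t. Measurability holds because t Q(t) is a
constant multiple of a derivative, and derivatives are measurable; boundedness of Q does the rest.
-/
theorem intervalIntegrable_mul_weightedMeanH (h : IsProfile f f₁ f₂ f₃ b) {n : ℕ} (hn : 2 ≤ n)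
    {ψ : ℝ → ℝ → ℝ}
    (hψ : ∀ r ∈ Ioc 0 b, IsRadialEigenfunction n f r (firstEigenvalue n f r) (ψ r))
    {r : ℝ} (hr : r ∈ Ioo 0 b) :
    IntervalIntegrable (fun t => t * weightedMeanH n f (ψ t) t) volume 0 r := by
  have hb : 0 < b := hr.1.trans hr.2
  have hn1 : ((n : ℝ) - 1) / 2 ≠ 0 := by
    have : (2 : ℝ) ≤ n := by exact_mod_cast hn
    linarith
  obtain ⟨M, hM0, hM⟩ := h.exists_bound_HFun hb n
  rw [intervalIntegrable_iff, uIoc_of_le hr.1.le]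
  have hsub : Ioc 0 r ⊆ Ioo 0 b := fun t ht => ⟨ht.1, ht.2.trans_lt hr.2⟩
  have hmeas : AEStronglyMeasurable (fun t => t * weightedMeanH n f (ψ t) t)
      (volume.restrict (Ioc 0 r)) := by
    have h1 : Measurable fun t => (((n : ℝ) - 1) / 2)⁻¹ *
        deriv (fun s => s ^ 2 * firstEigenvalue n f s) t := (measurable_deriv _).const_mul _
    refine h1.aestronglyMeasurable.congr ?_
    filter_upwards [ae_restrict_mem measurableSet_Ioc] with t ht
    rw [(h.hasDerivAt_sq_mul_firstEigenvalue hn hψ (hsub ht)).deriv, inv_mul_cancel_left₀ hn1]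
  refine Integrable.of_bound hmeas (r * M) ?_
  filter_upwards [ae_restrict_mem measurableSet_Ioc] with t ht
  have h2 := h.abs_weightedMeanH_le hn hψ (hsub ht) hM
  have h3 := ht.1
  have h4 := ht.2
  have h5 := hr.1.le
  rw [norm_mul, Real.norm_eq_abs, Real.norm_eq_abs, abs_of_pos h3]
  gcongr

/-- The integral formula between two positive radii. -/
theorem integral_mul_weightedMeanH (h : IsProfile f f₁ f₂ f₃ b) {n : ℕ} (hn : 2 ≤ n)
    {ψ : ℝ → ℝ → ℝ}
    (hψ : ∀ r ∈ Ioc 0 b, IsRadialEigenfunction n f r (firstEigenvalue n f r) (ψ r))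
    {s r : ℝ} (hs : s ∈ Ioo 0 b) (hr : r ∈ Ioo 0 b) :
    ((n : ℝ) - 1) / 2 * ∫ t in s..r, t * weightedMeanH n f (ψ t) t
      = r ^ 2 * firstEigenvalue n f r - s ^ 2 * firstEigenvalue n f s := by
  rw [← intervalIntegral.integral_const_mul]
  refine intervalIntegral.integral_eq_sub_of_hasDerivAt
    (f := fun s => s ^ 2 * firstEigenvalue n f s) (fun t ht => ?_)
    (((h.intervalIntegrable_mul_weightedMeanH hn hψ hs).symm.trans
      (h.intervalIntegrable_mul_weightedMeanH hn hψ hr)).const_mul _)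
  exact h.hasDerivAt_sq_mul_firstEigenvalue hn hψ (ordConnected_Ioo.uIcc_subset hs hr ht)

/-- The behaviour of `s² λ(s)` at the pole. -/
theorem tendsto_sq_mul_firstEigenvalue (h : IsProfile f f₁ f₂ f₃ b) {n : ℕ} (hn : 2 ≤ n)
    {ψ : ℝ → ℝ → ℝ}
    (hψ : ∀ r ∈ Ioc 0 b, IsRadialEigenfunction n f r (firstEigenvalue n f r) (ψ r))
    {r : ℝ} (hr : r ∈ Ioo 0 b) :
    Tendsto (fun s => s ^ 2 * firstEigenvalue n f s) (𝓝[>] 0)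
      (𝓝 (r ^ 2 * firstEigenvalue n f r
        - ((n : ℝ) - 1) / 2 * ∫ t in (0 : ℝ)..r, t * weightedMeanH n f (ψ t) t)) := by
  have hi := h.intervalIntegrable_mul_weightedMeanH hn hψ hr
  -- Existence of the limit is a consequence of integrability: the formula between two positive
  -- radii expresses s² λ(s) by a primitive that is continuous at 0.
  have hcont := intervalIntegral.continuousOn_primitive_interval' hi.symm left_mem_uIcc
    0 right_mem_uIcc
  rw [uIcc_of_ge hr.1.le] at hcont
  have hlim : Tendsto (fun s => ∫ t in r..s, t * weightedMeanH n f (ψ t) t) (𝓝[>] 0)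
      (𝓝 (∫ t in r..0, t * weightedMeanH n f (ψ t) t)) :=
    hcont.mono_left (nhdsWithin_le_of_mem (mem_of_superset (Ioo_mem_nhdsGT hr.1)
      Ioo_subset_Icc_self))
  have h2 := (hlim.const_mul (((n : ℝ) - 1) / 2)).const_add (r ^ 2 * firstEigenvalue n f r)
  rw [intervalIntegral.integral_symm 0 r, mul_neg, ← sub_eq_add_neg] at h2
  refine h2.congr' ?_
  filter_upwards [Ioo_mem_nhdsGT (hr.1.trans hr.2)] with s hs
  rw [h.integral_mul_weightedMeanH hn hψ hr hs]
  ring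

end IsProfile

theorem mainTheorem4 (n : ℕ) (hn : 2 ≤ n) (R : EReal) (hR : 0 < R) (f : ℝ → ℝ)
    (hf : ContDiffOn ℝ 3 f {t : ℝ | 0 ≤ t ∧ (t : EReal) < R})
    (hf0 : f 0 = 0) (hf1 : derivWithin f (Ici 0) 0 = 1)
    (hf2 : iteratedDerivWithin 2 f (Ici 0) 0 = 0)
    (hfpos : ∀ t : ℝ, 0 < t → (t : EReal) < R → 0 < f t)
    (ψ : ℝ → ℝ → ℝ)
    (hψ : ∀ r : ℝ, 0 < r → (r : EReal) < R →
      IsRadialEigenfunction n f r (firstEigenvalue n f r) (ψ r)) :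
    -- the identity for the derivative of the eigenvalue
    (∀ r : ℝ, 0 < r → (r : EReal) < R →
      IntervalIntegrable (fun s => HFun n f s * f s ^ (n - 1) * ψ r s ^ 2) volume 0 r ∧
      IntervalIntegrable (fun s => f s ^ (n - 1) * ψ r s ^ 2) volume 0 r ∧
      0 < (∫ s in (0 : ℝ)..r, f s ^ (n - 1) * ψ r s ^ 2) ∧
      DifferentiableAt ℝ (firstEigenvalue n f) r ∧
      r * deriv (firstEigenvalue n f) r + 2 * firstEigenvalue n f r =
        ((n : ℝ) - 1) / 2 * weightedMeanH n f (ψ r) r) ∧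
    -- the integral formula, for every starting radius
    (∀ r₀ r : ℝ, 0 ≤ r₀ → (r₀ : EReal) < R → 0 < r → (r : EReal) < R →
      IntervalIntegrable (fun t => t * weightedMeanH n f (ψ t) t) volume r₀ r ∧
      ∃ L : ℝ,
        Tendsto (fun s => s ^ 2 * firstEigenvalue n f s)
          (𝓝[{s : ℝ | 0 < s ∧ (s : EReal) < R}] r₀) (𝓝 L) ∧
        firstEigenvalue n f r = 1 / r ^ 2 * L +
          ((n : ℝ) - 1) / (2 * r ^ 2) * ∫ t in r₀..r, t * weightedMeanH n f (ψ t) t) ∧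
    -- the integral formula with starting radius zero
    (∀ r : ℝ, 0 < r → (r : EReal) < R →
      firstEigenvalue n f r = besselFirstZero ((n : ℝ) / 2 - 1) ^ 2 / r ^ 2 +
        ((n : ℝ) - 1) / (2 * r ^ 2) * ∫ t in (0 : ℝ)..r, t * weightedMeanH n f (ψ t) t) := by
  obtain ⟨f₁, f₂, f₃, hprof⟩ := exists_isProfile hf hf0 hf1 hf2 hfpos
  have hψ' : ∀ b : ℝ, (b : EReal) < R → ∀ r ∈ Ioc 0 b,
      IsRadialEigenfunction n f r (firstEigenvalue n f r) (ψ r) := fun b hb r hr =>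
    hψ r hr.1 ((EReal.coe_le_coe_iff.2 hr.2).trans_lt hb)
  -- The interval results concern interior points of [0, b], so a real b strictly between r and R is
  -- inserted, also when R is infinite.
  have hbig : ∀ r : ℝ, 0 < r → (r : EReal) < R → ∃ b : ℝ, r ∈ Ioo 0 b ∧ (b : EReal) < R := by
    intro r hr hrR
    obtain ⟨b, hb1, hb2⟩ := EReal.lt_iff_exists_real_btwn.1 hrR
    exact ⟨b, ⟨hr, EReal.coe_lt_coe_iff.1 hb1⟩, hb2⟩
  refine ⟨fun r hr hrR => ?_, fun r₀ r hr₀ hr₀R hr hrR => ?_, fun r hr hrR => ?_⟩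
  · obtain ⟨b, hb, hbR⟩ := hbig r hr hrR
    exact (hprof b (hb.1.trans hb.2) hbR).eigenvalue_identity hn (hψ' b hbR) hb
  · rcases hr₀.eq_or_lt with rfl | hr₀0
    · obtain ⟨b, hb, hbR⟩ := hbig r hr hrR
      have hp := hprof b (hb.1.trans hb.2) hbR
      refine ⟨hp.intervalIntegrable_mul_weightedMeanH hn (hψ' b hbR) hb, _,
        (hp.tendsto_sq_mul_firstEigenvalue hn (hψ' b hbR) hb).mono_left
          (nhdsWithin_mono _ fun s hs => hs.1), ?_⟩
      field_simp
      ring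
    -- The starting radius may exceed r, so b is taken beyond both. Here the limit L is simply the
    -- value at r₀, by continuity.
    · have hmax : ((max r₀ r : ℝ) : EReal) < R := by
        rcases max_choice r₀ r with h | h <;> rw [h] <;> assumption
      obtain ⟨b, hb, hbR⟩ := hbig (max r₀ r) (lt_max_of_lt_right hr) hmax
      have hp := hprof b (hb.1.trans hb.2) hbR
      have hr₀b : r₀ ∈ Ioo 0 b := ⟨hr₀0, (le_max_left _ _).trans_lt hb.2⟩
      have hrb : r ∈ Ioo 0 b := ⟨hr, (le_max_right _ _).trans_lt hb.2⟩
      refine ⟨(hp.intervalIntegrable_mul_weightedMeanH hn (hψ' b hbR) hr₀b).symm.trans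
        (hp.intervalIntegrable_mul_weightedMeanH hn (hψ' b hbR) hrb), _,
        (hp.hasDerivAt_sq_mul_firstEigenvalue hn (hψ' b hbR) hr₀b).continuousAt.tendsto.mono_left
          nhdsWithin_le_nhds, ?_⟩
      have h1 := hp.integral_mul_weightedMeanH hn (hψ' b hbR) hr₀b hrb
      field_simp
      linear_combination (-2) * h1
  · obtain ⟨b, hb, hbR⟩ := hbig r hr hrR
    have hb0 := hb.1.trans hb.2
    have hp := hprof b hb0 hbR
    obtain ⟨C, hfam⟩ := hp.exists_isDirichletFamily hb0 hn (hψ' b hbR)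
    rw [hfam.limit_eq_besselFirstZero hn hb0 hf0 hp.pos (hp.tendsto_div_self hb0)
      (hp.tendsto_sq_mul_firstEigenvalue hn (hψ' b hbR) hb)]
    field_simp
    ring
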